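/- Let $\Omega=\mathbf P^1(\mathbf F_{23})=\{\infty,0,1,\dots,22\}$ and let $\mathcal S$ be a Steiner system $S(5,8,24)$ on $\Omega$, i.e. a set of eight-element subsets of $\Omega$ (octads) such that every five-element subset of $\Omega$ lies in exactly one octad. On $\mathbf R^{\Omega}$ put $\langle x,y\rangle=-\frac{x\cdot y}{8}$, and write $\nu_A=\sum_{i\in A}e_i$ for $A\subseteq\Omega$ and $\nu_i=\nu_{\{i\}}$. Let $\Lambda\subset\mathbf R^\Omega$ be the (negative definite) Leech lattice generated by $\nu_\Omega-4\nu_\infty$ and the vectors $2\nu_K$, $K\in\mathcal S$. Let $\mathrm{II}_{1,25}=U\oplus\Lambda$ be the lattice of all $(m,n,\lambda)$ with $m,n\in\mathbf Z$, $\lambda\in\Lambda$, and with norm $2mn+\langle\lambda,\lambda\rangle$, and let $\rho=(1,0,0)$. A Leech root is a vector $r\in\mathrm{II}_{1,25}$ with $\langle r,r\rangle=-2$ and $\langle r,\rho\rangle=1$; the Leech root corresponding to $\lambda\in\Lambda$ is $(-1-\langle\lambda,\lambda\rangle/2,\,1,\,\lambda)$. Let $P^+$ be the connected component of $\{v\in\mathrm{II}_{1,25}\otimes\mathbf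 R:\langle v,v\rangle>0\}$ that contains $(1,1,0)$, let $C=\{v\in P^+:\langle v,r\rangle>0\text{ for all Leech roots }r\}$, and let $\mathrm{Aut}(C)$ be the group of isometries of $\mathrm{II}_{1,25}$ that map $C$ onto itself. Let $R$ be the subgroup generated by $$x=(2,1,4\nu_\infty+\nu_\Omega),\quad z=(-1,1,0),\quad p=(1,1,4\nu_\infty+4\nu_0),\quad q=(1,1,\nu_\Omega-4\nu_1).$$ Then $x,z,p,q$ are Leech roots, and $R\subset\mathrm{II}_{1,25}$ is a root lattice with basis $x,z,p,q$, isomorphic to $A_2\oplus A_2$ (negative definite; $x,z$ span one summand and $p,q$ the other). There are exactly $112$ Leech roots orthogonal to $R$. They are the Leech roots corresponding to the following vectors of norm $-4$ in $\Lambda$: (i) the $56$ vectors $2\nu_K$, where $K$ is one of the $56$ octads that contain $\infty$ and $0$ but not $1$; (ii) the $56$ vectors with coordinate $3$ at $\infty$, $-1$ at the seven other points of $K$, and $1$ at the points outside $K$, where $K$ is one of the $56$ octads that contain $\infty$ and $1$ but not $0$. The pointwise stabilizer of $R$ in $\mathrm{Aut}(C)$ is isomorphic to $\mathrm{PSU}(4,\mathbf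 F_3)$ (the special unitary group of the Hermitian form $\sum_i a_i b_i^{3}$ on $\mathbf F_9^4$ modulo its centre); through this isomorphism $\mathrm{PSU}(4,\mathbf F_3)$ acts on the set of these $112$ Leech roots, and the action is transitive. -/

import Mathlib

open scoped Pointwise Matrix

noncomputable section

/-- The set `Ω = P¹(𝔽₂₃) = {∞, 0, 1, …, 22}`. -/
abbrev Omega : Type := OnePoint (ZMod 23)

instance instDecidableEqOmega : DecidableEq Omega :=
  inferInstanceAs (DecidableEq (Option (ZMod 23)))

/-- The point `∞` of `Ω`. -/
def ptInf : Omega := OnePoint.infty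

/-- The point `0` of `Ω`. -/
def ptZero : Omega := ((0 : ZMod 23) : OnePoint (ZMod 23))

/-- The point `1` of `Ω`. -/
def ptOne : Omega := ((1 : ZMod 23) : OnePoint (ZMod 23))

/-- A set `𝒮` of subsets of `Ω` is a Steiner system `S(5,8,24)`: its members (the octads) have eight
elements, and each five-element subset of `Ω` is contained in exactly one of them. -/
def IsSteinerSystem (𝒮 : Set (Finset Omega)) : Prop :=
  (∀ K ∈ 𝒮, K.card = 8) ∧ ∀ A : Finset Omega, A.card = 5 → ∃! K, K ∈ 𝒮 ∧ A ⊆ K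

/-- `ν_A = ∑_{i ∈ A} e_i`. -/
def nu (A : Finset Omega) : Omega → ℝ := fun i => if i ∈ A then 1 else 0

/-- The negative definite form `⟨x, y⟩ = -(x · y) / 8` on `ℝ^Ω`. -/
def leechForm (x y : Omega → ℝ) : ℝ := -(x ⬝ᵥ y) / 8

/-- The Leech lattice `Λ`, generated by `ν_Ω - 4 ν_∞` and the `2 ν_K`, `K` an octad. -/
def leechLattice (𝒮 : Set (Finset Omega)) : AddSubgroup (Omega → ℝ) :=
  AddSubgroup.closure
    ({nu Finset.univ - (4 : ℝ) • nu {ptInf}} ∪ {v | ∃ K ∈ 𝒮, v = (2 : ℝ) • nu K})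

/-- The real quadratic space `(U ⊕ Λ) ⊗ ℝ` with elements `(m, n, λ)`. -/
abbrev LorentzSpace : Type := ℝ × ℝ × (Omega → ℝ)

/-- The form on `(U ⊕ Λ) ⊗ ℝ`, for which `(m, n, λ)` has norm `2mn + ⟨λ, λ⟩`. -/
def lorentzForm (v w : LorentzSpace) : ℝ :=
  v.1 * w.2.1 + v.2.1 * w.1 + leechForm v.2.2 w.2.2

/-- The lattice `II_{1,25} = U ⊕ Λ`: the `(m, n, λ)` with `m, n ∈ ℤ` and `λ ∈ Λ`. -/
def latticeII (𝒮 : Set (Finset Omega)) : AddSubgroup LorentzSpace :=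
  (Int.castAddHom ℝ).range.prod ((Int.castAddHom ℝ).range.prod (leechLattice 𝒮))

/-- The Weyl vector `ρ = (1, 0, 0)`. -/
def weylVector : LorentzSpace := (1, 0, 0)

/-- Leech roots: vectors `r ∈ II_{1,25}` with `⟨r, r⟩ = -2` and `⟨r, ρ⟩ = 1`. -/
def leechRoots (𝒮 : Set (Finset Omega)) : Set LorentzSpace :=
  {r | r ∈ latticeII 𝒮 ∧ lorentzForm r r = -2 ∧ lorentzForm r weylVector = 1}

/-- The Leech root `(-1 - ⟨λ, λ⟩ / 2, 1, λ)` that corresponds to a Leech vector `λ`. -/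
def leechRootOf (l : Omega → ℝ) : LorentzSpace := (-1 - leechForm l l / 2, 1, l)

/-- The connected component of the cone of vectors of positive norm that contains `(1, 1, 0)`; it is
the one that has `ρ` in its closure. -/
def positiveCone : Set LorentzSpace :=
  connectedComponentIn {v | 0 < lorentzForm v v} (1, 1, 0)

/-- The chamber `C` cut out of the positive cone by all Leech roots. -/
def chamber (𝒮 : Set (Finset Omega)) : Set LorentzSpace :=
  {v | v ∈ positiveCone ∧ ∀ r ∈ leechRoots 𝒮, 0 < lorentzForm v r}

/-- The real linear isometries of `II_{1,25} ⊗ ℝ`. -/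
def lorentzIsometries : Subgroup (LorentzSpace ≃ₗ[ℝ] LorentzSpace) where
  carrier := {g | ∀ v w, lorentzForm (g v) (g w) = lorentzForm v w}
  mul_mem' {a b} ha hb v w := by
    have h := ha (b v) (b w)
    rw [hb] at h
    exact h
  one_mem' _ _ := rfl
  inv_mem' {a} ha v w := by
    have h := ha (a⁻¹ v) (a⁻¹ w)
    rw [← LinearEquiv.mul_apply, ← LinearEquiv.mul_apply, mul_inv_cancel] at h
    exact h.symm

/-- `O(II_{1,25})`. As `II_{1,25}` spans the real space, an isometry of the lattice is the same thing
as a real linear isometry `g` with `g(II_{1,25}) = II_{1,25}`. -/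
def orthogonalGroupII (𝒮 : Set (Finset Omega)) : Subgroup (LorentzSpace ≃ₗ[ℝ] LorentzSpace) :=
  lorentzIsometries ⊓ MulAction.stabilizer _ (latticeII 𝒮 : Set LorentzSpace)

/-- `Aut(C)`: the isometries of `II_{1,25}` that map the chamber `C` onto itself. -/
def autChamber (𝒮 : Set (Finset Omega)) : Subgroup (LorentzSpace ≃ₗ[ℝ] LorentzSpace) :=
  orthogonalGroupII 𝒮 ⊓ MulAction.stabilizer _ (chamber 𝒮)

/-- The Leech roots `x, z` (first summand) and `p, q` (second summand), given by the Leech vectors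
`X = 4ν_∞ + ν_Ω`, `Z = 0`, `P = 4ν_∞ + 4ν_0`, `Q = ν_Ω - 4ν_1`. -/
def rootBasis : Fin 2 ⊕ Fin 2 → LorentzSpace :=
  Sum.elim
    ![(2, 1, (4 : ℝ) • nu {ptInf} + nu Finset.univ), (-1, 1, 0)]
    ![(1, 1, (4 : ℝ) • nu {ptInf} + (4 : ℝ) • nu {ptZero}),
      (1, 1, nu Finset.univ - (4 : ℝ) • nu {ptOne})]

/-- The lattice `R` generated by `x, z, p, q`. -/
def latticeR : AddSubgroup LorentzSpace := AddSubgroup.closure (Set.range rootBasis)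

/-- The Leech roots that are orthogonal to `R`. -/
def leechRootsPerpR (𝒮 : Set (Finset Omega)) : Set LorentzSpace :=
  {r | r ∈ leechRoots 𝒮 ∧ ∀ v ∈ latticeR, lorentzForm r v = 0}

/-- The pointwise stabilizer of `R` in `Aut(C)`. -/
def autFixR (𝒮 : Set (Finset Omega)) : Subgroup (LorentzSpace ≃ₗ[ℝ] LorentzSpace) :=
  autChamber 𝒮 ⊓ fixingSubgroup _ (latticeR : Set LorentzSpace)

/-- The octads that contain `∞` and `0`, but not `1`. -/
def octadsI (𝒮 : Set (Finset Omega)) : Set (Finset Omega) :=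
  {K | K ∈ 𝒮 ∧ ptInf ∈ K ∧ ptZero ∈ K ∧ ptOne ∉ K}

/-- The octads that contain `∞` and `1`, but not `0`. -/
def octadsII (𝒮 : Set (Finset Omega)) : Set (Finset Omega) :=
  {K | K ∈ 𝒮 ∧ ptInf ∈ K ∧ ptOne ∈ K ∧ ptZero ∉ K}

/-- The vector `2 ν_K`. -/
def vecI (K : Finset Omega) : Omega → ℝ := (2 : ℝ) • nu K

/-- The vector with coordinate `3` at `∞`, `-1` at the other points of `K`, and `1` outside `K`. -/
def vecII (K : Finset Omega) : Omega → ℝ :=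
  fun i => if i = ptInf then 3 else if i ∈ K then -1 else 1

/-- The field `𝔽₉`. -/
abbrev F9 : Type := GaloisField 3 2

/-- The conjugation `a ↦ a³` of `𝔽₉` over `𝔽₃`. -/
instance instStarRingF9 : StarRing F9 where
  star a := a ^ 3
  star_involutive a := by
    let _ := Fintype.ofFinite F9
    have h := FiniteField.pow_card a
    rw [Fintype.card_eq_nat_card, GaloisField.card 3 2 (by norm_num)] at h
    exact (pow_mul a 3 3).symm.trans h
  star_mul a b := by rw [mul_pow, mul_comm]
  star_add a b := add_pow_char a b 3

/-- `PSU(4, 𝔽₃)`: the special unitary group of the standard Hermitian form `∑ aᵢ bᵢ³` on `𝔽₉⁴`,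
modulo its centre. -/
abbrev PSU43 : Type :=
  Matrix.specialUnitaryGroup (Fin 4) F9 ⧸ Subgroup.center (Matrix.specialUnitaryGroup (Fin 4) F9)

end

/-!
Write `X = 4 ν_∞ + ν_Ω`, `P = 4 ν_∞ + 4 ν_0`, `Q = ν_Ω - 4 ν_1` for the Leech vectors of `x`, `p`,
`q`; the root `z` belongs to the zero vector. Leech roots correspond to Leech vectors, and the
products of two Leech roots are determined by the norm of the difference of their vectors. A Leech
root is therefore orthogonal to `R` exactly if its vector has norm `-4` and prescribed products with
`X`, `P`, `Q`. The Leech lattice consists of the integral vectors with coordinates of equal parity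
that satisfy a congruence modulo eight for the coordinate sum and congruences modulo four for the
sums over octads, so the vectors of norm `-4` have shape `4²`, `2⁸` or `3, 1²³` (up to signs). With
the prescribed products only the vectors (i) and (ii) remain (`leechRootsPerpR_eq`). Each family has 56 members by the design counts of `S(5, 8, 24)`.

Each Leech root `r` has the point `r + 2 ρ` on its wall and on no other. Automorphisms of the
chamber therefore permute the Leech roots (`autChamber_mem_leechRoots`), and they fix `ρ`, the only
vector that has product `1` with all of them. Hence the stabilizer `G` of `R` acts by isometries of
the Leech lattice that fix `X`, `P`, `Q` (`autFixR_apply`), and every such isometry occurs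
(`mem_autFixR`).

The group is identified by a bound from above and a homomorphism from `SU(4, 𝔽₃)` onto it.

The bound is `|G| ≤ 162 · 56 · 360 = 3265920` (`card_autFixR_le`). There are at most 162 Leech
vectors with the same norm and products as `4 ν_0 - 4 ν_∞`. The elements of `G` that fix this vector
are given by automorphisms of the Steiner system that fix `∞`, `0` and `1`. They permute the 56
octads through `∞` and `0` that do not contain `1`. If `O` is one of these octads, an automorphism
that fixes `O` and four of its six remaining points is trivial, which leaves `6 · 5 · 4 · 3`
possibilities. This last fact comes from Sylvester's synthemes. The octads through `∞, 0, 1` and two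
of the six points label the 15 points outside `O ∪ {1}` by the synthemes of the six points
(`exists_golayLabelling`). The labelling makes seventeen octads explicit, independently of the given
Steiner system, and these octads are rigid (`GolayLabelling.rigid`).

For the homomorphism, the 112 roots correspond to the 112 totally isotropic lines of the Hermitian
space `𝔽₉⁴`. Elimination shows that `SU(4, 𝔽₃)` is generated by three matrices
(`eq_top_of_generators_mem`). For each of them an integral matrix in the labelled coordinates is
given that is four times an isometry of the Leech lattice fixing `X`, `P`, `Q`, and that permutes
the roots as the generator permutes the lines (`isLabelledIsometry_isoMat`, `suGen_onLine`,
`isoMat_rootZ`). The pairs of an element of `SU(4, 𝔽₃)` and an element of `G` that permute lines and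
roots in the same way form a subgroup of the product. It projects onto `SU(4, 𝔽₃)`, since the
generators are in the image. It is the graph of a homomorphism (`exists_hom`), since an element of
`G` that fixes the 112 roots is trivial: they span the complement of `R`. The kernel consists of the
matrices that fix all isotropic lines; these are the scalar ones (`scalar_of_fix_lines`), hence the
kernel is the centre. As `|SU(4, 𝔽₃)| ≥ 2160 · 252 · 24 = 4 · 3265920`, and the centre has at most
four elements, the image has at least 3265920 elements, and by the bound for `|G|` it is all of `G`.
Transitivity is read off from the action of the generators on the lines (`exists_imageGen_eq`).
-/

noncomputable section

open Finset

variable {𝒮 : Set (Finset Omega)}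

/-! ### Counting octads -/

namespace IsSteinerSystem

theorem card_omega : Fintype.card Omega = 24 := by
  rw [Fintype.card_eq_nat_card]
  have : Nat.card Omega = Nat.card (Option (ZMod 23)) := rfl
  rw [this, Finite.card_option, Nat.card_zmod]

open Classical in
/-- The octads containing a given set. -/
def above (𝒮 : Set (Finset Omega)) (B : Finset Omega) : Finset (Finset Omega) :=
  univ.filter fun K => K ∈ 𝒮 ∧ B ⊆ K

theorem mem_above {B K : Finset Omega} : K ∈ above 𝒮 B ↔ K ∈ 𝒮 ∧ B ⊆ K := by
  simp [above]

theorem eq_of_five (h : IsSteinerSystem 𝒮) {K L : Finset Omega} (hK : K ∈ 𝒮) (hL : L ∈ 𝒮)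
    (hc : 5 ≤ (K ∩ L).card) : K = L := by
  obtain ⟨A, hA, hA5⟩ := exists_subset_card_eq hc
  exact (h.2 A hA5).unique ⟨hK, hA.trans inter_subset_left⟩ ⟨hL, hA.trans inter_subset_right⟩

/-- Up to five points lie in a common octad. -/
theorem exists_octad (h : IsSteinerSystem 𝒮) {A : Finset Omega} (hA : A.card ≤ 5) :
    ∃ K ∈ 𝒮, A ⊆ K := by
  obtain ⟨B, hAB, hB⟩ := exists_superset_card_eq hA (by rw [card_omega]; norm_num)
  obtain ⟨K, hK, -⟩ := h.2 B hB
  exact ⟨K, hK.1, hAB.trans hK.2⟩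

theorem card_inter_eq_sum (K T : Finset Omega) :
    (K ∩ T).card = ∑ x ∈ T, if x ∈ K then 1 else 0 := by
  rw [sum_boole, inter_comm]; simp [filter_mem_eq_inter]

/-- Double counting of incidences between a family of sets and the points of a set. -/
theorem sum_card_inter (F : Finset (Finset Omega)) (T : Finset Omega) :
    ∑ K ∈ F, (K ∩ T).card = ∑ x ∈ T, (F.filter (x ∈ ·)).card := by
  simp_rw [card_inter_eq_sum, card_filter]
  exact sum_comm

theorem filter_above (B : Finset Omega) (x : Omega) :
    (above 𝒮 B).filter (x ∈ ·) = above 𝒮 (insert x B) := by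
  ext K
  simp only [mem_filter, mem_above, insert_subset_iff]
  tauto

/-- If the number `n` of octads through `k + 1` points is constant, then counting the pairs of an octad
through `k` points and a further point of it gives the number through `k` points. -/
theorem card_above_step (h : IsSteinerSystem 𝒮) {k n : ℕ}
    (hn : ∀ B : Finset Omega, B.card = k + 1 → (above 𝒮 B).card = n) {B : Finset Omega}
    (hB : B.card = k) : (above 𝒮 B).card * (8 - k) = (24 - k) * n := by
  have h1 := sum_card_inter (above 𝒮 B) Bᶜ
  rw [sum_congr rfl (g := fun _ => 8 - k), sum_const, smul_eq_mul] at h1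
  · rw [h1, sum_congr rfl (g := fun _ => n), sum_const, card_compl, card_omega, hB, smul_eq_mul]
    intro x hx
    rw [filter_above]
    exact hn _ (by rw [card_insert_of_notMem (mem_compl.1 hx), hB])
  · intro K hK
    obtain ⟨hK, hBK⟩ := mem_above.1 hK
    have : K ∩ Bᶜ = K \ B := by ext; simp
    rw [this, card_sdiff_of_subset hBK, hB, h.1 K hK]

theorem card_above_five (h : IsSteinerSystem 𝒮) {B : Finset Omega} (hB : B.card = 5) :
    (above 𝒮 B).card = 1 := by
  obtain ⟨K, hK, hu⟩ := h.2 B hB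
  rw [card_eq_one]
  refine ⟨K, ?_⟩
  ext L
  rw [mem_above, mem_singleton]
  exact ⟨hu L, fun e => e ▸ hK⟩

theorem card_above_four (h : IsSteinerSystem 𝒮) {B : Finset Omega} (hB : B.card = 4) :
    (above 𝒮 B).card = 5 := by
  have := h.card_above_step (fun B => h.card_above_five) hB
  omega

theorem card_above_three (h : IsSteinerSystem 𝒮) {B : Finset Omega} (hB : B.card = 3) :
    (above 𝒮 B).card = 21 := by
  have := h.card_above_step (fun B => h.card_above_four) hB
  omega

theorem card_above_two (h : IsSteinerSystem 𝒮) {B : Finset Omega} (hB : B.card = 2) :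
    (above 𝒮 B).card = 77 := by
  have := h.card_above_step (fun B => h.card_above_three) hB
  omega

theorem card_above_one (h : IsSteinerSystem 𝒮) {B : Finset Omega} (hB : B.card = 1) :
    (above 𝒮 B).card = 253 := by
  have := h.card_above_step (fun B => h.card_above_two) hB
  omega

theorem card_filter_erase_above {B K : Finset Omega} (hK : K ∈ 𝒮)
    {x : Omega} (hB : insert x B ⊆ K) :
    (((above 𝒮 B).erase K).filter (x ∈ ·)).card = (above 𝒮 (insert x B)).card - 1 := by
  rw [← filter_above, filter_erase, card_erase_of_mem]
  rw [filter_above, mem_above]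
  exact ⟨hK, hB⟩

/-- The other octads through three points of an octad `K` account for all the pairs of points
outside; this leaves no octad meeting `K` in exactly three points. -/
theorem card_inter_ne_three (h : IsSteinerSystem 𝒮) {K L : Finset Omega} (hK : K ∈ 𝒮)
    (hL : L ∈ 𝒮) : (L ∩ K).card ≠ 3 := by
  intro h3
  set I := L ∩ K with hI
  have hIK : I ⊆ K := inter_subset_right
  have hsum := sum_card_inter ((above 𝒮 I).erase K) (K \ I)
  -- each of the five other points of `K` lies in four of the twenty octads `M ≠ K` through `I`
  have hr : ∑ x ∈ K \ I, ((((above 𝒮 I).erase K)).filter (x ∈ ·)).card = 20 := by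
    rw [sum_congr rfl (g := fun _ => 4), sum_const, card_sdiff_of_subset hIK, h.1 K hK, h3]
    · rfl
    intro x hx
    rw [mem_sdiff] at hx
    rw [card_filter_erase_above hK (insert_subset hx.1 hIK),
      h.card_above_four (by rw [card_insert_of_notMem hx.2, h3])]
  have hc : ((above 𝒮 I).erase K).card = 20 := by
    rw [card_erase_of_mem (mem_above.2 ⟨hK, hIK⟩), h.card_above_three h3]
  have hle : ∀ M ∈ (above 𝒮 I).erase K, (M ∩ (K \ I)).card ≤ 1 := by
    intro M hM
    rw [mem_erase, mem_above] at hM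
    by_contra! hlt
    refine hM.1 (h.eq_of_five hM.2.1 hK ?_)
    have hd : Disjoint I (M ∩ (K \ I)) :=
      disjoint_left.2 fun x hx hx' => (mem_sdiff.1 (mem_inter.1 hx').2).2 hx
    have hs : I ∪ M ∩ (K \ I) ⊆ M ∩ K :=
      union_subset (subset_inter hM.2.2 hIK) (inter_subset_inter_left sdiff_subset)
    have := card_le_card hs
    rw [card_union_of_disjoint hd] at this
    omega
  have hLm : L ∈ (above 𝒮 I).erase K := by
    rw [mem_erase, mem_above]
    refine ⟨?_, hL, inter_subset_left⟩
    rintro rfl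
    rw [hI, inter_self, h.1 L hL] at h3
    omega
  -- as `L` contains none of these points, twenty incidences are too many for the other nineteen octads
  have hlt : ∑ M ∈ (above 𝒮 I).erase K, (M ∩ (K \ I)).card <
      ∑ M ∈ (above 𝒮 I).erase K, 1 := by
    refine sum_lt_sum hle ⟨L, hLm, ?_⟩
    have : L ∩ (K \ I) = ∅ := by
      ext x
      simp only [mem_inter, mem_sdiff, notMem_empty, iff_false, hI]
      tauto
    rw [this]
    simp
  rw [hsum, hr, sum_const, hc] at hlt
  exact absurd hlt (by decide)

/-- With `t` the number of further common points, `∑ (t - 1) (t - 3) = 0` over the octads that share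
a given point with `K`; as `t ≠ 2`, no summand is negative and `t = 0` does not occur. -/
theorem card_inter_ne_one (h : IsSteinerSystem 𝒮) {K L : Finset Omega} (hK : K ∈ 𝒮)
    (hL : L ∈ 𝒮) : (L ∩ K).card ≠ 1 := by
  intro h1
  set I := L ∩ K with hI
  have hIK : I ⊆ K := inter_subset_right
  set F := (above 𝒮 I).erase K with hF
  set T := K \ I with hT
  have hTc : T.card = 7 := by rw [hT, card_sdiff_of_subset hIK, h.1 K hK, h1]
  have hFc : F.card = 252 := by
    rw [hF, card_erase_of_mem (mem_above.2 ⟨hK, hIK⟩), h.card_above_one h1]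
  have hdeg1 : ∀ x ∈ T, (F.filter (x ∈ ·)).card = 76 := by
    intro x hx
    rw [hT, mem_sdiff] at hx
    rw [hF, card_filter_erase_above hK (insert_subset hx.1 hIK),
      h.card_above_two (by rw [card_insert_of_notMem hx.2, h1])]
  have hdeg2 : ∀ x ∈ T, ∀ y ∈ T, x ≠ y → ((F.filter (x ∈ ·)).filter (y ∈ ·)).card = 20 := by
    intro x hx y hy hxy
    rw [hT, mem_sdiff] at hx hy
    have : F.filter (x ∈ ·) = (above 𝒮 (insert x I)).erase K := by
      rw [hF, filter_erase, filter_above]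
    rw [this, card_filter_erase_above hK
      (insert_subset hy.1 (insert_subset hx.1 hIK)), h.card_above_three]
    rw [card_insert_of_notMem, card_insert_of_notMem hx.2, h1]
    rw [mem_insert]
    rintro (e | e)
    · exact hxy e.symm
    · exact hy.2 e
  have hs1 : ∑ M ∈ F, (M ∩ T).card = 532 := by
    rw [sum_card_inter, sum_congr rfl hdeg1, sum_const, hTc]
    rfl
  have hs2 : ∑ M ∈ F, (M ∩ T).card ^ 2 = 1372 := by
    have e : ∀ M ∈ F, (M ∩ T).card ^ 2 = ∑ x ∈ T, if x ∈ M then (M ∩ T).card else 0 := by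
      intro M _
      rw [sum_ite, sum_const_zero, add_zero, sum_const, smul_eq_mul, sq, filter_mem_eq_inter,
        inter_comm T M]
    rw [sum_congr rfl e, sum_comm]
    have e2 : ∀ x ∈ T, ∑ M ∈ F, (if x ∈ M then (M ∩ T).card else 0) = 196 := by
      intro x hx
      rw [← sum_filter, sum_card_inter, ← add_sum_erase _ _ hx,
        sum_congr rfl (g := fun _ => 20) fun y hy => ?_]
      · rw [filter_filter]
        simp only [and_self]
        rw [hdeg1 x hx, sum_const, card_erase_of_mem hx, hTc]
        rfl
      · rw [mem_erase] at hy
        exact hdeg2 x hx y hy.2 (Ne.symm hy.1)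
    rw [sum_congr rfl e2, sum_const, hTc]
    rfl
  have hcard : ∀ M ∈ F, (M ∩ K).card = 1 + (M ∩ T).card := by
    intro M hM
    rw [hF, mem_erase, mem_above] at hM
    have hu : M ∩ K = I ∪ M ∩ T := by
      ext x
      have := @hM.2.2 x
      have := @hIK x
      simp only [hT, mem_union, mem_inter, mem_sdiff]
      tauto
    have hd : Disjoint I (M ∩ T) :=
      disjoint_left.2 fun x hx hx' => (mem_sdiff.1 (mem_inter.1 hx').2).2 hx
    rw [hu, card_union_of_disjoint hd, h1]
  have hpos : ∀ M ∈ F, (0 : ℤ) ≤ (((M ∩ T).card : ℤ) - 1) * (((M ∩ T).card : ℤ) - 3) := by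
    intro M hM
    have hc := hcard M hM
    rw [hF, mem_erase, mem_above] at hM
    have h3 := h.card_inter_ne_three hK hM.2.1
    have h5 : ¬ 5 ≤ (M ∩ K).card := fun h5 => hM.1 (h.eq_of_five hM.2.1 hK h5)
    have : (M ∩ T).card = 0 ∨ (M ∩ T).card = 1 ∨ (M ∩ T).card = 3 := by omega
    rcases this with e | e | e <;> rw [e] <;> norm_num
  have hz : ∑ M ∈ F, (((M ∩ T).card : ℤ) - 1) * (((M ∩ T).card : ℤ) - 3) = 0 := by
    have e : ∀ M ∈ F, (((M ∩ T).card : ℤ) - 1) * (((M ∩ T).card : ℤ) - 3) =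
        (((M ∩ T).card ^ 2 : ℕ) : ℤ) - 4 * ((M ∩ T).card : ℤ) + 3 := by
      intro M _; push_cast; ring
    rw [sum_congr rfl e, sum_add_distrib, sum_sub_distrib, ← mul_sum, ← Nat.cast_sum,
      ← Nat.cast_sum, hs1, hs2, sum_const, hFc]
    norm_num
  have hLm : L ∈ F := by
    rw [hF, mem_erase, mem_above]
    refine ⟨?_, hL, inter_subset_left⟩
    rintro rfl
    rw [hI, inter_self, h.1 L hL] at h1
    omega
  have := (sum_eq_zero_iff_of_nonneg hpos).1 hz L hLm
  have hL0 := hcard L hLm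
  rw [← hI, h1] at hL0
  have h0 : (L ∩ T).card = 0 := by omega
  rw [h0] at this
  exact absurd this (by norm_num)

theorem card_inter (h : IsSteinerSystem 𝒮) {K L : Finset Omega} (hK : K ∈ 𝒮) (hL : L ∈ 𝒮)
    (hne : K ≠ L) : (K ∩ L).card = 0 ∨ (K ∩ L).card = 2 ∨ (K ∩ L).card = 4 := by
  have h1 := h.card_inter_ne_one hL hK
  have h3 := h.card_inter_ne_three hL hK
  have h5 : ¬ 5 ≤ (K ∩ L).card := fun h5 => hne (h.eq_of_five hK hL h5)
  omega

theorem even_card_inter (h : IsSteinerSystem 𝒮) {K L : Finset Omega} (hK : K ∈ 𝒮) (hL : L ∈ 𝒮) :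
    Even (K ∩ L).card := by
  by_cases hne : K = L
  · rw [hne, inter_self, h.1 L hL]; decide
  · rcases h.card_inter hK hL hne with e | e | e <;> rw [e] <;> decide

/-- Through four points of an octad `O` and a point outside goes an octad meeting `O` in just these
four points. -/
theorem exists_inter_eq (h : IsSteinerSystem 𝒮) {O T : Finset Omega} (hO : O ∈ 𝒮) (hT : T ⊆ O)
    (hT4 : T.card = 4) : ∃ K ∈ 𝒮, K ∩ O = T := by
  have : ∃ z, z ∉ O := by
    by_contra! hall
    have : O = univ := eq_univ_iff_forall.2 hall
    have h8 := h.1 O hO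
    rw [this, card_univ, card_omega] at h8
    omega
  obtain ⟨z, hz⟩ := this
  obtain ⟨K, hK, hs⟩ := h.exists_octad (A := insert z T) ((card_insert_le _ _).trans (by omega))
  rw [insert_subset_iff] at hs
  refine ⟨K, hK, (eq_of_subset_of_card_le (subset_inter hs.2 hT) ?_).symm⟩
  by_contra! hlt
  have := h.eq_of_five hK hO (by omega)
  exact hz (this ▸ hs.1)

/-- A set of one to six points meets some octad in an odd number of points. -/
theorem exists_odd (h : IsSteinerSystem 𝒮) {W : Finset Omega} (hW : W.Nonempty)
    (hW6 : W.card ≤ 6) : ∃ K ∈ 𝒮, ¬ Even (K ∩ W).card := by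
  by_contra! hall
  have hsub : ∃ O ∈ 𝒮, W ⊆ O := by
    by_cases h5 : W.card ≤ 5
    · exact h.exists_octad h5
    · obtain ⟨A, hA, hA5⟩ := exists_subset_card_eq (show 5 ≤ W.card by omega)
      obtain ⟨O, hO, hAO⟩ := h.exists_octad hA5.le
      refine ⟨O, hO, ?_⟩
      have h1 : A.card ≤ (O ∩ W).card := card_le_card (subset_inter hAO hA)
      have h2 := hall O hO
      have h3 : (O ∩ W).card ≤ W.card := card_le_card inter_subset_right
      have h4 : (O ∩ W).card = 6 := by
        rcases h2 with ⟨r, hr⟩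
        omega
      have : O ∩ W = W := eq_of_subset_of_card_le inter_subset_right (by omega)
      exact inter_eq_right.1 this
  obtain ⟨O, hO, hWO⟩ := hsub
  have hO8 := h.1 O hO
  have hev := hall O hO
  rw [inter_eq_right.2 hWO] at hev
  have hpos := hW.card_pos
  have hcO : (O \ W).card = 8 - W.card := by rw [card_sdiff_of_subset hWO, hO8]
  -- four points of `O`, an odd number of which lie in `W`
  have hT : ∃ T ⊆ O, T.card = 4 ∧ ¬ Even (T ∩ W).card := by
    have key : ∀ a b : ℕ, a + b = 4 → ¬ Even a → a ≤ W.card → b ≤ (O \ W).card →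
        ∃ T ⊆ O, T.card = 4 ∧ ¬ Even (T ∩ W).card := by
      intro a b hab ha haW hbW
      obtain ⟨A, hA, hAc⟩ := exists_subset_card_eq haW
      obtain ⟨B, hB, hBc⟩ := exists_subset_card_eq hbW
      have hd : Disjoint A B := disjoint_left.2 fun x hx hx' => (mem_sdiff.1 (hB hx')).2 (hA hx)
      refine ⟨A ∪ B, union_subset (hA.trans hWO) (hB.trans sdiff_subset), ?_, ?_⟩
      · rw [card_union_of_disjoint hd]; omega
      · have : (A ∪ B) ∩ W = A := by
          ext x
          have h1 := @hA x
          have h2 := @hB x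
          simp only [mem_inter, mem_union, mem_sdiff] at h2 ⊢
          tauto
        rw [this, hAc]
        exact ha
    by_cases h2 : W.card = 2
    · exact key 1 3 rfl (by decide) (by omega) (by omega)
    · have : W.card ≠ 1 := by rintro e; rw [e] at hev; exact absurd hev (by decide)
      exact key 3 1 rfl (by decide) (by omega) (by omega)
  obtain ⟨T, hTO, hT4, hTodd⟩ := hT
  obtain ⟨K, hK, hKO⟩ := h.exists_inter_eq hO hTO hT4
  refine hTodd ?_
  have : T ∩ W = K ∩ W := by
    rw [← hKO, inter_assoc, inter_eq_right.2 hWO]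
  rw [this]
  exact hall K hK

theorem even_card_inter_symmDiff {K A B : Finset Omega} (hA : Even (K ∩ A).card)
    (hB : Even (K ∩ B).card) : Even (K ∩ symmDiff A B).card := by
  have h1 : K ∩ symmDiff A B = (K ∩ A) \ (K ∩ B) ∪ (K ∩ B) \ (K ∩ A) := by
    ext x
    simp only [mem_inter, mem_symmDiff, mem_union, mem_sdiff]
    tauto
  rw [h1, card_union_of_disjoint
    (disjoint_left.2 fun x hx hx' => (mem_sdiff.1 hx').2 (mem_sdiff.1 hx).1)]
  have h2 := card_sdiff_add_card_inter (K ∩ A) (K ∩ B)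
  have h3 := card_sdiff_add_card_inter (K ∩ B) (K ∩ A)
  rw [inter_comm (K ∩ B)] at h3
  rcases hA with ⟨a, ha⟩
  rcases hB with ⟨b, hb⟩
  rw [Nat.even_iff]
  omega

/-- An eight-element set that meets all octads in even sets is an octad. -/
theorem mem_of_even (h : IsSteinerSystem 𝒮) {W : Finset Omega} (hW8 : W.card = 8)
    (hW : ∀ K ∈ 𝒮, Even (K ∩ W).card) : W ∈ 𝒮 := by
  obtain ⟨A, hA, hA5⟩ := exists_subset_card_eq (show 5 ≤ W.card by omega)
  obtain ⟨K, hK, hAK⟩ := h.exists_octad hA5.le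
  suffices symmDiff W K = ∅ by
    have : W = K := symmDiff_eq_bot.1 this
    exact this ▸ hK
  by_contra hne
  have h1 : A.card ≤ (W ∩ K).card := card_le_card (subset_inter hA hAK)
  have h2 : (symmDiff W K).card ≤ 6 := by
    have e : symmDiff W K = W \ K ∪ K \ W := rfl
    have h3 := card_sdiff_add_card_inter W K
    have h4 := card_sdiff_add_card_inter K W
    rw [inter_comm K, h.1 K hK] at h4
    have := card_union_le (W \ K) (K \ W)
    rw [e]
    omega
  obtain ⟨L, hL, hodd⟩ := h.exists_odd (nonempty_iff_ne_empty.2 hne) h2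
  exact hodd (even_card_inter_symmDiff (hW L hL) (h.even_card_inter hL hK))

end IsSteinerSystem

/-! ### The Leech lattice as a lattice of integral vectors -/

theorem ptInf_ne_ptZero : ptInf ≠ ptZero := by decide
theorem ptInf_ne_ptOne : ptInf ≠ ptOne := by decide
theorem ptZero_ne_ptOne : ptZero ≠ ptOne := by decide

/-- The real vector with given integral coordinates. -/
def ofInt (u : Omega → ℤ) : Omega → ℝ := fun i => (u i : ℝ)

theorem ofInt_dotProduct (u w : Omega → ℤ) : ofInt u ⬝ᵥ ofInt w = ((u ⬝ᵥ w : ℤ) : ℝ) := by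
  simp [ofInt, dotProduct]

/-- The integral vectors whose coordinates have the same parity, whose coordinate sum is `4 u_∞`
modulo `8`, and whose sum over each octad vanishes modulo `4`. This is Conway's description of the
Leech lattice. -/
def congruenceLattice (𝒮 : Set (Finset Omega)) : AddSubgroup (Omega → ℤ) where
  carrier := {u | (∀ i, 2 ∣ u i - u ptInf) ∧ 8 ∣ ∑ i, u i - 4 * u ptInf ∧
    ∀ K ∈ 𝒮, 4 ∣ ∑ i ∈ K, u i}
  zero_mem' := by simp
  add_mem' := by
    rintro u w ⟨h1, h2, h3⟩ ⟨k1, k2, k3⟩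
    refine ⟨fun i => ?_, ?_, fun K hK => ?_⟩
    · have := dvd_add (h1 i) (k1 i)
      simpa [add_sub_add_comm] using this
    · have := dvd_add h2 k2
      simpa [sum_add_distrib, mul_add, add_sub_add_comm] using this
    · simpa [sum_add_distrib] using dvd_add (h3 K hK) (k3 K hK)
  neg_mem' := by
    rintro u ⟨h1, h2, h3⟩
    refine ⟨fun i => ?_, ?_, fun K hK => ?_⟩
    · have e : (-u) i - (-u) ptInf = -(u i - u ptInf) := by simp only [Pi.neg_apply]; ring
      rw [e]
      exact (h1 i).neg_right
    · have e : ∑ i, (-u) i - 4 * (-u) ptInf = -(∑ i, u i - 4 * u ptInf) := by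
        simp only [Pi.neg_apply, sum_neg_distrib]; ring
      rw [e]
      exact h2.neg_right
    · simpa using h3 K hK

/-- Integral version of `ν_K`. -/
def nuZ (K : Finset Omega) : Omega → ℤ := fun i => if i ∈ K then 1 else 0

theorem sum_nuZ (K L : Finset Omega) : ∑ i ∈ K, nuZ L i = ((K ∩ L).card : ℤ) := by
  simp [nuZ]

theorem dotProduct_nuZ (u : Omega → ℤ) (K : Finset Omega) : nuZ K ⬝ᵥ u = ∑ i ∈ K, u i := by
  simp [dotProduct, nuZ, ite_mul]

/-- Integral version of the generator `ν_Ω - 4 ν_∞`. -/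
def oddGen : Omega → ℤ := nuZ univ - 4 • nuZ {ptInf}

theorem ofInt_oddGen : ofInt oddGen = nu univ - (4 : ℝ) • nu {ptInf} := by
  funext i
  simp only [ofInt, oddGen, nu, nuZ, Pi.sub_apply, Pi.smul_apply]
  split_ifs <;> norm_num

theorem ofInt_two_nuZ (K : Finset Omega) : ofInt (2 • nuZ K) = (2 : ℝ) • nu K := by
  funext i
  simp only [ofInt, nu, nuZ, Pi.smul_apply]
  split_ifs <;> simp

theorem ofInt_add (u w : Omega → ℤ) : ofInt (u + w) = ofInt u + ofInt w := by
  funext i; simp [ofInt]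

theorem ofInt_neg (u : Omega → ℤ) : ofInt (-u) = -ofInt u := by
  funext i; simp [ofInt]

theorem ofInt_injective : Function.Injective ofInt := fun u w h => by
  funext i
  have := congrFun h i
  exact Int.cast_injective this

theorem oddGen_dotProduct (u : Omega → ℤ) : oddGen ⬝ᵥ u = ∑ i, u i - 4 * u ptInf := by
  rw [oddGen, sub_dotProduct, smul_dotProduct, dotProduct_nuZ, dotProduct_nuZ]
  simp

theorem sum_omega_one : ∑ _i : Omega, (1 : ℤ) = 24 := by
  rw [sum_const, card_univ, IsSteinerSystem.card_omega]; norm_num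

theorem oddGen_mem (h : IsSteinerSystem 𝒮) : oddGen ∈ congruenceLattice 𝒮 := by
  have hv : ∀ i, oddGen i = if i = ptInf then -3 else 1 := by
    intro i
    simp only [oddGen, nuZ, Pi.sub_apply, Pi.smul_apply, mem_singleton, mem_univ, if_true]
    split_ifs <;> rfl
  refine ⟨fun i => ?_, ?_, fun K hK => ?_⟩
  · rw [hv, hv]
    split_ifs <;> simp
  · have : ∑ i, oddGen i = 20 := by
      have := oddGen_dotProduct (nuZ univ)
      rw [dotProduct_comm, dotProduct_nuZ] at this
      rw [this]
      simp [nuZ, IsSteinerSystem.card_omega]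
    rw [this, hv]
    norm_num
  · have : ∑ i ∈ K, oddGen i = (8 : ℤ) - 4 * ((K ∩ {ptInf}).card : ℤ) := by
      rw [← sum_nuZ, mul_sum, oddGen]
      simp only [Pi.sub_apply, sum_sub_distrib, Pi.smul_apply]
      rw [sum_nuZ, inter_univ, h.1 K hK]
      simp
    rw [this]
    exact dvd_sub (by norm_num) (dvd_mul_right _ _)

theorem two_nuZ_mem (h : IsSteinerSystem 𝒮) {K : Finset Omega} (hK : K ∈ 𝒮) :
    2 • nuZ K ∈ congruenceLattice 𝒮 := by
  refine ⟨fun i => ?_, ?_, fun L hL => ?_⟩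
  · exact ⟨nuZ K i - nuZ K ptInf, by simp only [Pi.smul_apply, nsmul_eq_mul]; push_cast; ring⟩
  · have : ∑ i, (2 • nuZ K) i = 16 := by
      simp only [Pi.smul_apply, ← smul_sum]
      rw [sum_nuZ, univ_inter, h.1 K hK]
      rfl
    rw [this]
    simp only [Pi.smul_apply, nsmul_eq_mul]
    refine dvd_sub (by norm_num) ⟨nuZ K ptInf, by push_cast; ring⟩
  · simp only [Pi.smul_apply, ← smul_sum]
    rw [sum_nuZ]
    obtain ⟨r, hr⟩ := h.even_card_inter hL hK
    rw [hr]
    exact ⟨r, by push_cast; ring⟩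

theorem ofInt_oddGen_mem : ofInt oddGen ∈ leechLattice 𝒮 := by
  rw [ofInt_oddGen]
  exact AddSubgroup.subset_closure (Or.inl rfl)

theorem two_nu_mem {K : Finset Omega} (hK : K ∈ 𝒮) : (2 : ℝ) • nu K ∈ leechLattice 𝒮 :=
  AddSubgroup.subset_closure (Or.inr ⟨K, hK, rfl⟩)

/-- Leech vectors are integral and satisfy the congruences. -/
theorem exists_ofInt (h : IsSteinerSystem 𝒮) {v : Omega → ℝ} (hv : v ∈ leechLattice 𝒮) :
    ∃ u ∈ congruenceLattice 𝒮, v = ofInt u := by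
  induction hv using AddSubgroup.closure_induction with
  | mem x hx =>
    rcases hx with hx | ⟨K, hK, rfl⟩
    · exact ⟨oddGen, oddGen_mem h, by rw [ofInt_oddGen]; exact hx⟩
    · exact ⟨2 • nuZ K, two_nuZ_mem h hK, (ofInt_two_nuZ K).symm⟩
  | zero => exact ⟨0, zero_mem _, by funext i; simp [ofInt]⟩
  | add x y _ _ hx hy =>
    obtain ⟨u, hu, rfl⟩ := hx
    obtain ⟨w, hw, rfl⟩ := hy
    exact ⟨u + w, add_mem hu hw, (ofInt_add u w).symm⟩
  | neg x _ hx =>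
    obtain ⟨u, hu, rfl⟩ := hx
    exact ⟨-u, neg_mem hu, (ofInt_neg u).symm⟩

/-- Leech vectors pair with the congruence lattice into `8ℤ`: the congruences that define it are the
pairings with the generators. -/
theorem exists_dotProduct_eq {v : Omega → ℝ} (hv : v ∈ leechLattice 𝒮) {u : Omega → ℤ}
    (hu : u ∈ congruenceLattice 𝒮) : ∃ k : ℤ, v ⬝ᵥ ofInt u = 8 * k := by
  induction hv using AddSubgroup.closure_induction with
  | mem x hx =>
    rcases hx with hx | ⟨K, hK, rfl⟩
    · rw [Set.mem_singleton_iff] at hx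
      rw [hx, ← ofInt_oddGen, ofInt_dotProduct, oddGen_dotProduct]
      obtain ⟨k, hk⟩ := hu.2.1
      exact ⟨k, by rw [hk]; push_cast; ring⟩
    · rw [← ofInt_two_nuZ, ofInt_dotProduct, smul_dotProduct, dotProduct_nuZ]
      obtain ⟨k, hk⟩ := hu.2.2 K hK
      exact ⟨k, by rw [hk]; simp only [nsmul_eq_mul]; push_cast; ring⟩
  | zero => exact ⟨0, by simp⟩
  | add x y _ _ hx hy =>
    obtain ⟨a, ha⟩ := hx
    obtain ⟨b, hb⟩ := hy
    exact ⟨a + b, by rw [add_dotProduct, ha, hb]; push_cast; ring⟩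
  | neg x _ hx =>
    obtain ⟨a, ha⟩ := hx
    exact ⟨-a, by rw [neg_dotProduct, ha]; push_cast; ring⟩

/-- The Leech lattice is even. -/
theorem exists_dotProduct_self_eq (h : IsSteinerSystem 𝒮) {v : Omega → ℝ}
    (hv : v ∈ leechLattice 𝒮) : ∃ k : ℤ, v ⬝ᵥ v = 16 * k := by
  induction hv using AddSubgroup.closure_induction with
  | mem x hx =>
    refine ⟨2, ?_⟩
    rcases hx with hx | ⟨K, hK, rfl⟩
    · rw [Set.mem_singleton_iff] at hx
      rw [hx, ← ofInt_oddGen, ofInt_dotProduct, oddGen_dotProduct]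
      have := oddGen_dotProduct (nuZ univ)
      rw [dotProduct_comm, dotProduct_nuZ] at this
      rw [this]
      simp [nuZ, IsSteinerSystem.card_omega, oddGen]
      norm_num
    · rw [← ofInt_two_nuZ, ofInt_dotProduct, smul_dotProduct, dotProduct_nuZ]
      simp only [Pi.smul_apply, ← smul_sum]
      rw [sum_nuZ, inter_self, h.1 K hK]
      norm_num
  | zero => exact ⟨0, by simp⟩
  | add x y hx' hy' hx hy =>
    obtain ⟨a, ha⟩ := hx
    obtain ⟨b, hb⟩ := hy
    obtain ⟨u, hu, rfl⟩ := exists_ofInt h hy'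
    obtain ⟨c, hc⟩ := exists_dotProduct_eq hx' hu
    refine ⟨a + b + c, ?_⟩
    rw [add_dotProduct, dotProduct_add, dotProduct_add, ha, hb, dotProduct_comm (ofInt u) x, hc]
    push_cast; ring
  | neg x _ hx =>
    obtain ⟨a, ha⟩ := hx
    exact ⟨a, by rw [neg_dotProduct, dotProduct_neg, neg_neg, ha]⟩

/-! ### Short vectors of the Leech lattice -/

/-- If `u` is `c + 2 ν_W` modulo `4` on `K`, this determines its sum over `K` modulo `4`. -/
theorem dvd_sum_sub_card (K W : Finset Omega) (u : Omega → ℤ) (c : ℤ)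
    (hW : ∀ i ∈ K, 4 ∣ u i - c - 2 * nuZ W i) :
    4 ∣ ∑ i ∈ K, u i - c * K.card - 2 * (K ∩ W).card := by
  have h := dvd_sum hW
  rw [sum_sub_distrib, sum_sub_distrib, ← mul_sum, sum_nuZ, sum_const, nsmul_eq_mul,
    mul_comm (K.card : ℤ)] at h
  exact h

open Classical in
/-- Even vectors of norm `-4`: the coordinates are divisible by four, or they are `±2` on an octad and
zero elsewhere. -/
theorem even_vector_cases (h : IsSteinerSystem 𝒮) {u : Omega → ℤ} (hu : u ∈ congruenceLattice 𝒮)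
    (h32 : u ⬝ᵥ u = 32) (h0 : 2 ∣ u ptInf) :
    (∀ i, 4 ∣ u i) ∨
      ∃ K ∈ 𝒮, (∀ i ∈ K, u i = 2 ∨ u i = -2) ∧ ∀ i, i ∉ K → u i = 0 := by
  have hev : ∀ i, 2 ∣ u i := fun i => by
    have := hu.1 i
    omega
  -- the points with coordinate `2` modulo `4` meet all octads in even sets; by the norm there are at
  -- most eight of them, and fewer than seven are impossible
  set W : Finset Omega := univ.filter fun i => ¬ 4 ∣ u i with hW
  have hmod : ∀ i, 4 ∣ u i - 0 - 2 * nuZ W i := by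
    intro i
    have := hev i
    simp only [nuZ, hW, mem_filter, mem_univ, true_and]
    split_ifs <;> omega
  have heven : ∀ K ∈ 𝒮, Even (K ∩ W).card := by
    intro K hK
    have h1 := dvd_sum_sub_card K W u 0 fun i _ => hmod i
    have h2 := hu.2.2 K hK
    rw [Nat.even_iff]
    omega
  have hWe : Even W.card := by
    have h1 := dvd_sum_sub_card univ W u 0 fun i _ => hmod i
    have h2 := hu.2.1
    rw [univ_inter] at h1
    rw [Nat.even_iff]
    omega
  by_cases hne : W.Nonempty
  · right
    have h7 : 7 ≤ W.card := by
      by_contra! hlt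
      obtain ⟨K, hK, hodd⟩ := h.exists_odd hne (by omega)
      exact hodd (heven K hK)
    have hsq : ∀ i ∈ W, 4 ≤ u i * u i := by
      intro i hi
      have h1 := hev i
      have h2 : ¬ 4 ∣ u i := (mem_filter.1 hi).2
      have : u i ≤ -2 ∨ 2 ≤ u i := by omega
      rcases this with h | h <;> nlinarith
    have hsum : ∑ i ∈ W, u i * u i + ∑ i ∈ Wᶜ, u i * u i = 32 := by
      rw [sum_add_sum_compl]; exact h32
    have hW1 : (W.card : ℤ) * 4 ≤ ∑ i ∈ W, u i * u i := by
      have := card_nsmul_le_sum W (fun i => u i * u i) 4 hsq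
      simpa using this
    have hW2 : 0 ≤ ∑ i ∈ Wᶜ, u i * u i := sum_nonneg fun i _ => mul_self_nonneg _
    have h8 : W.card = 8 := by
      rcases hWe with ⟨r, hr⟩
      omega
    have hz : ∑ i ∈ Wᶜ, u i * u i = 0 := by omega
    have hz' : ∑ i ∈ W, (u i * u i - 4) = 0 := by
      rw [sum_sub_distrib, sum_const, h8]
      simp only [nsmul_eq_mul]
      push_cast
      omega
    refine ⟨W, h.mem_of_even h8 heven, fun i hi => ?_, fun i hi => ?_⟩
    · have := (sum_eq_zero_iff_of_nonneg fun i hi => sub_nonneg.2 (hsq i hi)).1 hz' i hi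
      have h2 : (u i - 2) * (u i + 2) = 0 := by linarith
      rcases mul_eq_zero.1 h2 with h2 | h2
      · left; omega
      · right; omega
    · have := (sum_eq_zero_iff_of_nonneg fun i _ => mul_self_nonneg (u i)).1 hz i (mem_compl.2 hi)
      exact mul_self_eq_zero.1 this
  · left
    intro i
    by_contra hi
    exact hne ⟨i, mem_filter.2 ⟨mem_univ _, hi⟩⟩

open Classical in
/-- Odd vectors of norm `-4` have one coordinate `±3` and all others `±1`. -/
theorem odd_vector_cases {u : Omega → ℤ} (hu : u ∈ congruenceLattice 𝒮)
    (h32 : u ⬝ᵥ u = 32) (h0 : ¬ 2 ∣ u ptInf) :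
    (∃ i, (u i = 3 ∨ u i = -3) ∧ ∀ j, j ≠ i → u j = 1 ∨ u j = -1) := by
  have hodd : ∀ i, ¬ 2 ∣ u i := fun i => by
    have := hu.1 i
    omega
  have hnn : ∀ i, 0 ≤ u i * u i - 1 := by
    intro i
    have := hodd i
    have : u i ≤ -1 ∨ 1 ≤ u i := by omega
    rcases this with h | h <;> nlinarith
  have hs : ∑ i, (u i * u i - 1) = 8 := by
    rw [sum_sub_distrib, sum_omega_one]
    have : ∑ i, u i * u i = 32 := h32
    rw [this]
    norm_num
  have hex : ∃ i, u i * u i - 1 ≠ 0 := by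
    by_contra! hall
    rw [sum_congr rfl fun i _ => hall i] at hs
    simp at hs
  obtain ⟨i, hi⟩ := hex
  have h3 : u i ≤ -3 ∨ 3 ≤ u i := by
    have h1 := hodd i
    by_contra! hlt
    have : u i = -1 ∨ u i = 1 := by omega
    rcases this with e | e <;> rw [e] at hi <;> exact hi (by norm_num)
  have h8 : 8 ≤ u i * u i - 1 := by rcases h3 with h | h <;> nlinarith
  rw [← add_sum_erase _ _ (mem_univ i)] at hs
  have hrest : 0 ≤ ∑ j ∈ univ.erase i, (u j * u j - 1) := sum_nonneg fun j _ => hnn j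
  have hz : ∑ j ∈ univ.erase i, (u j * u j - 1) = 0 := by omega
  refine ⟨i, ?_, fun j hj => ?_⟩
  · have : u i * u i = 9 := by omega
    rcases h3 with h | h
    · right; nlinarith
    · left; nlinarith
  · have := (sum_eq_zero_iff_of_nonneg fun j _ => hnn j).1 hz j (mem_erase.2 ⟨hj, mem_univ _⟩)
    have h2 : (u j - 1) * (u j + 1) = 0 := by linarith
    rcases mul_eq_zero.1 h2 with h2 | h2
    · left; omega
    · right; omega

/-- The points where an odd Leech vector is `3` modulo `4` form a set that meets all octads in even
sets. -/
theorem even_card_inter_of_odd (h : IsSteinerSystem 𝒮) {u : Omega → ℤ}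
    (hu : u ∈ congruenceLattice 𝒮) {W : Finset Omega} (hW : ∀ i, 4 ∣ u i - 1 - 2 * nuZ W i) :
    ∀ K ∈ 𝒮, Even (K ∩ W).card := by
  intro K hK
  have h1 := dvd_sum_sub_card K W u 1 fun i _ => hW i
  have h2 := hu.2.2 K hK
  rw [h.1 K hK] at h1
  rw [Nat.even_iff]
  omega

/-! ### Vectors of shape `8` and `4, 4` -/

/-- Two octads through a tetrad `T` meet in `T`, and their symmetric difference is a third octad; the
three vectors `2 ν_K` combine to `4 ν_T`. -/
theorem four_nu_mem (h : IsSteinerSystem 𝒮) {T : Finset Omega} (hT : T.card = 4) :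
    (4 : ℝ) • nu T ∈ leechLattice 𝒮 := by
  have h5 := h.card_above_four hT
  obtain ⟨K, hK, L, hL, hne⟩ := one_lt_card.1 (show 1 < (IsSteinerSystem.above 𝒮 T).card by omega)
  rw [IsSteinerSystem.mem_above] at hK hL
  have hKL : K ∩ L = T := by
    refine (eq_of_subset_of_card_le (subset_inter hK.2 hL.2) ?_).symm
    have := h.card_inter hK.1 hL.1 hne
    omega
  have hD : symmDiff K L ∈ 𝒮 := by
    refine h.mem_of_even ?_ fun M hM => IsSteinerSystem.even_card_inter_symmDiff
      (h.even_card_inter hM hK.1) (h.even_card_inter hM hL.1)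
    have e : symmDiff K L = K \ L ∪ L \ K := rfl
    rw [e, card_union_of_disjoint disjoint_sdiff_sdiff]
    have h3 := card_sdiff_add_card_inter K L
    have h4 := card_sdiff_add_card_inter L K
    rw [inter_comm L, h.1 L hL.1, hKL] at h4
    rw [h.1 K hK.1, hKL] at h3
    omega
  have : (4 : ℝ) • nu T = (2 : ℝ) • nu K + (2 : ℝ) • nu L - (2 : ℝ) • nu (symmDiff K L) := by
    funext i
    simp only [← hKL, nu, Pi.smul_apply, Pi.sub_apply, Pi.add_apply, mem_inter, mem_symmDiff]
    by_cases h1 : i ∈ K <;> by_cases h2 : i ∈ L <;> (simp [h1, h2]; try norm_num)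
  rw [this]
  exact sub_mem (add_mem (two_nu_mem hK.1) (two_nu_mem hL.1)) (two_nu_mem hD)

/-- The difference of two tetrads with three common points. -/
theorem four_sub_four_mem (h : IsSteinerSystem 𝒮) (i j : Omega) :
    (4 : ℝ) • nu {i} - (4 : ℝ) • nu {j} ∈ leechLattice 𝒮 := by
  by_cases hij : i = j
  · rw [hij, sub_self]; exact zero_mem _
  obtain ⟨A, hA, hA5⟩ := exists_superset_card_eq (s := {i, j}) (n := 5)
    ((card_insert_le _ _).trans (by simp)) (by rw [IsSteinerSystem.card_omega]; norm_num)
  have hi : i ∈ A := hA (by simp)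
  have hj : j ∈ A := hA (by simp)
  have h1 := four_nu_mem h (T := A.erase j) (by rw [card_erase_of_mem hj, hA5])
  have h2 := four_nu_mem h (T := A.erase i) (by rw [card_erase_of_mem hi, hA5])
  have : (4 : ℝ) • nu {i} - (4 : ℝ) • nu {j} =
      (4 : ℝ) • nu (A.erase j) - (4 : ℝ) • nu (A.erase i) := by
    funext k
    simp only [nu, Pi.smul_apply, Pi.sub_apply, mem_erase, mem_singleton]
    by_cases hki : k = i
    · subst hki; simp [hij, hi]
    · by_cases hkj : k = j
      · subst hkj; simp [hki, hj]
      · by_cases hkA : k ∈ A <;> simp [hki, hkj, hkA]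
  rw [this]
  exact sub_mem h1 h2

/-- The five octads through a tetrad cover the remaining points once. -/
theorem two_nu_univ_mem (h : IsSteinerSystem 𝒮) : (2 : ℝ) • nu univ ∈ leechLattice 𝒮 := by
  obtain ⟨T, -, hT⟩ := exists_subset_card_eq (s := (univ : Finset Omega)) (n := 4)
    (by rw [card_univ, IsSteinerSystem.card_omega]; norm_num)
  have : (2 : ℝ) • nu univ = ∑ K ∈ IsSteinerSystem.above 𝒮 T, (2 : ℝ) • nu K
      - (2 : ℕ) • (4 : ℝ) • nu T := by
    funext i
    rw [← smul_sum]
    simp only [nu, Pi.smul_apply, Pi.sub_apply, Finset.sum_apply, sum_boole, mem_univ, if_true]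
    rw [IsSteinerSystem.filter_above]
    by_cases hi : i ∈ T
    · rw [insert_eq_of_mem hi, h.card_above_four hT, if_pos hi]
      norm_num
    · rw [h.card_above_five (by rw [card_insert_of_notMem hi, hT]), if_neg hi]
      norm_num
  rw [this]
  refine sub_mem (sum_mem fun K hK => two_nu_mem (IsSteinerSystem.mem_above.1 hK).1) ?_
  exact nsmul_mem (four_nu_mem h hT) 2

theorem eight_mem (h : IsSteinerSystem 𝒮) (i : Omega) : (8 : ℝ) • nu {i} ∈ leechLattice 𝒮 := by
  have h1 := nsmul_mem (ofInt_oddGen_mem (𝒮 := 𝒮)) 2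
  have h2 := nsmul_mem (four_sub_four_mem h i ptInf) 2
  have : (8 : ℝ) • nu {i} = (2 : ℝ) • nu univ - 2 • ofInt oddGen +
      2 • ((4 : ℝ) • nu {i} - (4 : ℝ) • nu {ptInf}) := by
    rw [ofInt_oddGen]; module
  rw [this]
  exact add_mem (sub_mem (two_nu_univ_mem h) h1) h2

theorem four_add_four_mem (h : IsSteinerSystem 𝒮) (i j : Omega) :
    (4 : ℝ) • nu {i} + (4 : ℝ) • nu {j} ∈ leechLattice 𝒮 := by
  have : (4 : ℝ) • nu {i} + (4 : ℝ) • nu {j} =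
      (4 : ℝ) • nu {i} - (4 : ℝ) • nu {j} + (8 : ℝ) • nu {j} := by module
  rw [this]
  exact add_mem (four_sub_four_mem h i j) (eight_mem h j)

/-! ### The Leech roots `x`, `z`, `p`, `q` -/

/-- The Leech vectors of the roots `x`, `z`, `p`, `q`. -/
def rootVec : Fin 2 ⊕ Fin 2 → Omega → ℝ :=
  Sum.elim ![(4 : ℝ) • nu {ptInf} + nu univ, 0]
    ![(4 : ℝ) • nu {ptInf} + (4 : ℝ) • nu {ptZero}, nu univ - (4 : ℝ) • nu {ptOne}]

theorem rootVec_mem (h : IsSteinerSystem 𝒮) (i : Fin 2 ⊕ Fin 2) :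
    rootVec i ∈ leechLattice 𝒮 := by
  have ho := ofInt_oddGen_mem (𝒮 := 𝒮)
  rw [ofInt_oddGen] at ho
  rcases i with i | i <;> fin_cases i
  · have : rootVec (Sum.inl 0) = nu univ - (4 : ℝ) • nu {ptInf} + (8 : ℝ) • nu {ptInf} := by
      simp only [rootVec, Sum.elim_inl, Matrix.cons_val_zero]; module
    exact this ▸ add_mem ho (eight_mem h _)
  · exact zero_mem _
  · exact four_add_four_mem h _ _
  · have : rootVec (Sum.inr 1) = nu univ - (4 : ℝ) • nu {ptInf} +
        ((4 : ℝ) • nu {ptInf} - (4 : ℝ) • nu {ptOne}) := by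
      simp only [rootVec, Sum.elim_inr, Matrix.cons_val_one, Matrix.cons_val_fin_one]; module
    exact this ▸ add_mem ho (four_sub_four_mem h _ _)

theorem dotProduct_nu (v : Omega → ℝ) (K : Finset Omega) : v ⬝ᵥ nu K = ∑ i ∈ K, v i := by
  simp [dotProduct, nu]

theorem dotProduct_rootVec_x (v : Omega → ℝ) :
    v ⬝ᵥ rootVec (Sum.inl 0) = 4 * v ptInf + ∑ i, v i := by
  simp only [rootVec, Sum.elim_inl, Matrix.cons_val_zero, dotProduct_add, dotProduct_smul,
    dotProduct_nu, sum_singleton, smul_eq_mul]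

theorem rootVec_z : rootVec (Sum.inl 1) = 0 := rfl

theorem dotProduct_rootVec_p (v : Omega → ℝ) :
    v ⬝ᵥ rootVec (Sum.inr 0) = 4 * v ptInf + 4 * v ptZero := by
  simp only [rootVec, Sum.elim_inr, Matrix.cons_val_zero, dotProduct_add, dotProduct_smul,
    dotProduct_nu, sum_singleton, smul_eq_mul]

theorem dotProduct_rootVec_q (v : Omega → ℝ) :
    v ⬝ᵥ rootVec (Sum.inr 1) = ∑ i, v i - 4 * v ptOne := by
  simp only [rootVec, Sum.elim_inr, Matrix.cons_val_one, Matrix.cons_val_fin_one, dotProduct_sub,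
    dotProduct_smul, dotProduct_nu, sum_singleton, smul_eq_mul]

theorem nu_apply_self (i : Omega) : nu {i} i = 1 := by simp [nu]
theorem nu_apply_ne {i j : Omega} (h : j ≠ i) : nu {i} j = 0 := by simp [nu, h]
theorem nu_univ_apply (i : Omega) : nu univ i = 1 := by simp [nu]
theorem sum_nu (K : Finset Omega) : ∑ i, nu K i = K.card := by simp [nu]

theorem card_univ_real : ((univ : Finset Omega).card : ℝ) = 24 := by
  rw [card_univ, IsSteinerSystem.card_omega]; norm_num

/-- The Gram matrix of the four Leech vectors. -/
theorem rootVec_dotProduct (i j : Fin 2 ⊕ Fin 2) : rootVec i ⬝ᵥ rootVec j =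
    Matrix.fromBlocks !![48, 0; 0, 0] !![24, 24; 0, 0] !![24, 0; 24, 0] !![32, 8; 8, 32] i j := by
  have e1 := ptInf_ne_ptZero
  have e2 := ptInf_ne_ptOne
  have e3 := ptZero_ne_ptOne
  have hX : rootVec (Sum.inl 0) = (4 : ℝ) • nu {ptInf} + nu univ := rfl
  have hP : rootVec (Sum.inr 0) = (4 : ℝ) • nu {ptInf} + (4 : ℝ) • nu {ptZero} := rfl
  have hQ : rootVec (Sum.inr 1) = nu univ - (4 : ℝ) • nu {ptOne} := rfl
  have sX : ∑ i, rootVec (Sum.inl 0) i = 28 := by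
    rw [hX]
    simp only [Pi.add_apply, Pi.smul_apply, smul_eq_mul, sum_add_distrib, ← mul_sum, sum_nu,
      card_univ_real, card_singleton]
    norm_num
  have sP : ∑ i, rootVec (Sum.inr 0) i = 8 := by
    rw [hP]
    simp only [Pi.add_apply, Pi.smul_apply, smul_eq_mul, sum_add_distrib, ← mul_sum, sum_nu,
      card_singleton]
    norm_num
  have sQ : ∑ i, rootVec (Sum.inr 1) i = 20 := by
    rw [hQ]
    simp only [Pi.sub_apply, Pi.smul_apply, smul_eq_mul, sum_sub_distrib, ← mul_sum, sum_nu,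
      card_singleton, card_univ_real]
    norm_num
  have ev : rootVec (Sum.inl 0) ptInf = 5 ∧ rootVec (Sum.inl 0) ptZero = 1 ∧
      rootVec (Sum.inl 0) ptOne = 1 ∧ rootVec (Sum.inr 0) ptInf = 4 ∧
      rootVec (Sum.inr 0) ptZero = 4 ∧ rootVec (Sum.inr 0) ptOne = 0 ∧
      rootVec (Sum.inr 1) ptInf = 1 ∧ rootVec (Sum.inr 1) ptZero = 1 ∧
      rootVec (Sum.inr 1) ptOne = -3 := by
    rw [hX, hP, hQ]
    simp only [Pi.add_apply, Pi.sub_apply, Pi.smul_apply, nu_apply_self, nu_apply_ne e1,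
      nu_apply_ne e2, nu_apply_ne e3, nu_apply_ne e1.symm, nu_apply_ne e2.symm,
      nu_apply_ne e3.symm, nu_univ_apply, smul_eq_mul]
    norm_num
  obtain ⟨v1, v2, v3, v4, v5, v6, v7, v8, v9⟩ := ev
  rcases j with j | j <;> fin_cases j <;> rcases i with i | i <;> fin_cases i <;>
    simp only [Fin.zero_eta, Fin.mk_one, dotProduct_rootVec_x, dotProduct_rootVec_p,
      dotProduct_rootVec_q, rootVec_z, dotProduct_zero, zero_dotProduct, sX, sP, sQ,
      v1, v2, v3, v4, v5, v6, v7, v8, v9] <;>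
    simp <;> norm_num

theorem leechForm_eq (x y : Omega → ℝ) : leechForm x y = -(x ⬝ᵥ y) / 8 := rfl

/-- The product of two Leech roots depends on the distance of the Leech vectors only. -/
theorem lorentzForm_leechRootOf (l m : Omega → ℝ) : lorentzForm (leechRootOf l) (leechRootOf m) =
    -2 + (l - m) ⬝ᵥ (l - m) / 16 := by
  simp only [lorentzForm, leechRootOf, leechForm_eq, sub_dotProduct, dotProduct_sub,
    dotProduct_comm m l]
  ring

theorem rootBasis_eq (i : Fin 2 ⊕ Fin 2) : rootBasis i = leechRootOf (rootVec i) := by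
  have := rootVec_dotProduct i i
  simp only [leechRootOf, leechForm_eq, this]
  rcases i with i | i <;> fin_cases i <;> simp [rootBasis, rootVec] <;> norm_num

/-- Leech roots correspond to Leech vectors; that the first coordinate is integral holds because the
lattice is even. -/
theorem leechRoots_eq (h : IsSteinerSystem 𝒮) :
    leechRoots 𝒮 = leechRootOf '' (leechLattice 𝒮 : Set (Omega → ℝ)) := by
  ext ⟨a, b, l⟩
  constructor
  · rintro ⟨⟨-, -, hl⟩, h2, h3⟩
    have hb : b = 1 := by
      simpa [lorentzForm, weylVector, leechForm_eq] using h3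
    subst hb
    refine ⟨l, hl, ?_⟩
    have : 2 * a + leechForm l l = -2 := by
      rw [← h2]; simp only [lorentzForm]; ring
    have : a = -1 - leechForm l l / 2 := by linarith
    rw [leechRootOf, ← this]
  · rintro ⟨l, hl, e⟩
    rw [← e]
    obtain ⟨k, hk⟩ := exists_dotProduct_self_eq h hl
    refine ⟨⟨⟨-1 + k, ?_⟩, ⟨1, by simp [leechRootOf]⟩, hl⟩, ?_, ?_⟩
    · simp only [leechRootOf, leechForm_eq, hk]
      simp
      ring
    · rw [lorentzForm_leechRootOf]; simp
    · simp [lorentzForm, weylVector, leechForm_eq, leechRootOf]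

theorem leechRootOf_injective : Function.Injective leechRootOf := fun _ _ h =>
  congrArg (fun v : LorentzSpace => v.2.2) h

theorem rootBasis_mem (h : IsSteinerSystem 𝒮) (i : Fin 2 ⊕ Fin 2) :
    rootBasis i ∈ leechRoots 𝒮 := by
  rw [leechRoots_eq h, rootBasis_eq]
  exact ⟨_, rootVec_mem h i, rfl⟩

theorem latticeR_le (h : IsSteinerSystem 𝒮) : latticeR ≤ latticeII 𝒮 := by
  rw [latticeR, AddSubgroup.closure_le]
  rintro _ ⟨i, rfl⟩
  exact (rootBasis_mem h i).1

theorem rootBasis_gram (i j : Fin 2 ⊕ Fin 2) : lorentzForm (rootBasis i) (rootBasis j) =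
    Matrix.fromBlocks !![-2, 1; 1, -2] 0 0 !![-2, 1; 1, -2] i j := by
  rw [rootBasis_eq, rootBasis_eq, lorentzForm_leechRootOf]
  simp only [sub_dotProduct, dotProduct_sub, rootVec_dotProduct]
  rcases j with j | j <;> fin_cases j <;> rcases i with i | i <;> fin_cases i <;>
    simp <;> norm_num

theorem rootBasis_linearIndependent : LinearIndependent ℝ rootBasis := by
  rw [Fintype.linearIndependent_iff]
  intro g hg
  rw [Fintype.sum_sum_type, Fin.sum_univ_two, Fin.sum_univ_two] at hg
  have e1 := ptInf_ne_ptZero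
  have e2 := ptInf_ne_ptOne
  have e3 := ptZero_ne_ptOne
  set t : Omega := ((2 : ZMod 23) : OnePoint (ZMod 23)) with ht
  have t1 : t ≠ ptInf := by decide
  have t2 : t ≠ ptZero := by decide
  have t3 : t ≠ ptOne := by decide
  have h1 := congrArg (fun v : LorentzSpace => v.2.1) hg
  have h2 := congrArg (fun v : LorentzSpace => v.2.2 ptOne) hg
  have h3 := congrArg (fun v : LorentzSpace => v.2.2 t) hg
  have h4 := congrArg (fun v : LorentzSpace => v.2.2 ptInf) hg
  simp [rootBasis, nu, e1, e2, e2.symm, e3.symm, t1, t2, t3] at h1 h2 h3 h4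
  have k0 : g (Sum.inl 0) = 0 := by linarith
  have k3 : g (Sum.inr 1) = 0 := by linarith
  have k2 : g (Sum.inr 0) = 0 := by linarith
  have k1 : g (Sum.inl 1) = 0 := by linarith
  rintro (i | i) <;> fin_cases i <;> assumption

/-! ### The vectors of the 112 orthogonal roots -/

/-- Integral version of the vectors of type (ii). -/
def vecIIZ (K : Finset Omega) : Omega → ℤ := fun i => if i = ptInf then 3 else if i ∈ K then -1 else 1

theorem ofInt_vecIIZ (K : Finset Omega) : ofInt (vecIIZ K) = vecII K := by
  funext i
  simp only [ofInt, vecIIZ, vecII]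
  split_ifs <;> norm_num

theorem sum_eq_of_sign {u : Omega → ℤ} {W : Finset Omega} {i : Omega} {e : ℤ}
    (hu : ∀ j, u j = 1 - 2 * nuZ W j + 4 * e * nuZ {i} j) :
    ∑ j, u j = 24 - 2 * W.card + 4 * e := by
  rw [sum_congr rfl fun j _ => hu j, sum_add_distrib, sum_sub_distrib, ← mul_sum, ← mul_sum,
    sum_nuZ, sum_nuZ, sum_omega_one, univ_inter, univ_inter]
  simp

open Classical in
/-- Odd vectors of norm `-4`: up to a change by `±4` at one point, the coordinates are signs, and the
negative ones sit on a set that meets all octads in even sets. -/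
theorem odd_vector_exists_octad_form (h : IsSteinerSystem 𝒮) {u : Omega → ℤ}
    (hu : u ∈ congruenceLattice 𝒮)
    (h32 : u ⬝ᵥ u = 32) (h0 : ¬ 2 ∣ u ptInf) :
    ∃ (i : Omega) (W : Finset Omega) (e : ℤ), (e = 1 ∧ i ∈ W ∨ e = -1 ∧ i ∉ W) ∧
      (∀ K ∈ 𝒮, Even (K ∩ W).card) ∧ ∀ j, u j = 1 - 2 * nuZ W j + 4 * e * nuZ {i} j := by
  obtain ⟨i, hi, hj⟩ := odd_vector_cases hu h32 h0
  set W : Finset Omega := univ.filter fun j => u j = 3 ∨ u j = -1 with hW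
  have hmod : ∀ j, 4 ∣ u j - 1 - 2 * nuZ W j := by
    intro j
    simp only [nuZ, hW, mem_filter, mem_univ, true_and]
    by_cases hji : j = i
    · subst hji
      rcases hi with e | e <;> rw [e] <;> norm_num
    · rcases hj j hji with e | e <;> rw [e] <;> norm_num
  refine ⟨i, W, if u i = 3 then 1 else -1, ?_, even_card_inter_of_odd h hu hmod, fun j => ?_⟩
  · rcases hi with e | e
    · left; simp [hW, e]
    · right; simp [hW, e]
  · by_cases hji : j = i
    · subst hji
      rcases hi with e | e <;> simp [hW, nuZ, e]
    · rcases hj j hji with e | e <;> simp [hW, nuZ, e, hji]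

theorem nuZ_apply {K : Finset Omega} {i : Omega} : nuZ K i = 1 ∧ i ∈ K ∨ nuZ K i = 0 ∧ i ∉ K := by
  unfold nuZ
  split_ifs with h <;> simp [h]

theorem nuZ_mem {K : Finset Omega} {i : Omega} (h : i ∈ K) : nuZ K i = 1 := if_pos h
theorem nuZ_notMem {K : Finset Omega} {i : Omega} (h : i ∉ K) : nuZ K i = 0 := if_neg h

theorem nuZ_singleton_ne {i j : Omega} (h : j ≠ i) : nuZ {i} j = 0 :=
  nuZ_notMem (by simpa using h)

theorem nuZ_singleton_self (i : Omega) : nuZ {i} i = 1 := nuZ_mem (by simp)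

theorem sq_add_le {u : Omega → ℤ} (h32 : u ⬝ᵥ u = 32) {T : Finset Omega} :
    ∑ i ∈ T, u i * u i ≤ 32 := by
  rw [← h32]
  exact sum_le_sum_of_subset_of_nonneg (subset_univ _) fun i _ _ => mul_self_nonneg _

theorem sq_add_three_le {u : Omega → ℤ} (h32 : u ⬝ᵥ u = 32) :
    u ptInf * u ptInf + u ptZero * u ptZero + u ptOne * u ptOne ≤ 32 := by
  have := sq_add_le h32 (T := {ptInf, ptZero, ptOne})
  rw [sum_insert (by decide), sum_insert (by decide), sum_singleton] at this
  linarith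

/-- The integral vectors `u` of norm `-4` with `⟨u, P⟩ = ⟨u, Q⟩ = -2` and `⟨u, X⟩ = -3` are those of
the types (i) and (ii). -/
theorem perp_vector_cases (h : IsSteinerSystem 𝒮) {u : Omega → ℤ} (hu : u ∈ congruenceLattice 𝒮)
    (h32 : u ⬝ᵥ u = 32) (hp : u ptInf + u ptZero = 4) (hx : 4 * u ptInf + ∑ i, u i = 24)
    (hq : ∑ i, u i - 4 * u ptOne = 16) :
    (∃ K ∈ octadsI 𝒮, u = 2 • nuZ K) ∨ ∃ K ∈ octadsII 𝒮, u = vecIIZ K := by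
  have h3 := sq_add_three_le h32
  have hone' : u ptOne = 2 - u ptInf := by linarith
  by_cases h0 : 2 ∣ u ptInf
  · left
    have hr : 0 ≤ u ptInf ∧ u ptInf ≤ 4 := by
      have e1 : u ptZero = 4 - u ptInf := by linarith
      have e2 : u ptOne = 2 - u ptInf := by linarith
      rw [e1, e2] at h3
      constructor <;> nlinarith
    rcases even_vector_cases h hu h32 h0 with h4 | ⟨K, hK, hon, hoff⟩
    · have := h4 ptInf
      have := h4 ptOne
      omega
    · have hval : ∀ i, u i = 2 ∨ u i = -2 ∨ u i = 0 := by
        intro i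
        by_cases hi : i ∈ K
        · rcases hon i hi with e | e <;> simp [e]
        · simp [hoff i hi]
      have v0 := hval ptInf
      have v1 := hval ptZero
      have v2 := hval ptOne
      clear h3
      have hinf : u ptInf = 2 := by omega
      have hzero : u ptZero = 2 := by omega
      have hone : u ptOne = 0 := by omega
      have hnot : ∀ i, u i = 0 → i ∉ K := by
        intro i hi hiK
        rcases hon i hiK with e | e <;> omega
      have hin : ∀ i, u i ≠ 0 → i ∈ K := fun i hi => by
        by_contra hiK
        exact hi (hoff i hiK)
      refine ⟨K, ⟨hK, hin ptInf (by omega), hin ptZero (by omega), hnot _ hone⟩, ?_⟩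
      -- the sum of the coordinates is `16`, which excludes the sign `-2`
      have hs : ∑ i ∈ K, (2 - u i) = 0 := by
        have e : ∑ i, u i = ∑ i ∈ K, u i := by
          rw [← sum_add_sum_compl K, sum_eq_zero (s := Kᶜ) fun i hi => hoff i (mem_compl.1 hi),
            add_zero]
        rw [sum_sub_distrib, ← e, sum_const, h.1 K hK]
        simp only [nsmul_eq_mul]
        push_cast
        linarith
      have hz := (sum_eq_zero_iff_of_nonneg fun i hi => by
        rcases hon i hi with e | e <;> omega).1 hs
      funext i
      by_cases hi : i ∈ K
      · have := hz i hi
        simp only [Pi.smul_apply, nuZ_mem hi]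
        simp only [nsmul_eq_mul]
        push_cast
        linarith
      · simp [hoff i hi, nuZ_notMem hi]
  · right
    obtain ⟨i, W, e, he, hW, hu'⟩ := odd_vector_exists_octad_form h hu h32 h0
    have hs := sum_eq_of_sign hu'
    have u0 := hu' ptInf
    have u1 := hu' ptZero
    have u2 := hu' ptOne
    have w0 := nuZ_apply (K := W) (i := ptInf)
    have w1 := nuZ_apply (K := W) (i := ptZero)
    have w2 := nuZ_apply (K := W) (i := ptOne)
    by_cases hi0 : i = ptInf
    · subst hi0
      rw [nuZ_singleton_self] at u0
      rw [nuZ_singleton_ne ptInf_ne_ptZero.symm] at u1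
      rw [nuZ_singleton_ne ptInf_ne_ptOne.symm] at u2
      have he1 : e = 1 := by
        rcases w0 with w0 | w0 <;> rcases w1 with w1 | w1 <;> omega
      subst he1
      have hWi : ptInf ∈ W := by
        rcases he with he | he
        · exact he.2
        · exact absurd he.1 (by norm_num)
      have hW1 : ptZero ∉ W := by
        rcases w1 with w1 | w1
        · have := w1.1; omega
        · exact w1.2
      have hW2 : ptOne ∈ W := by
        rcases w2 with w2 | w2
        · exact w2.2
        · have := w2.1; omega
      have h8 : W.card = 8 := by omega
      refine ⟨W, ⟨h.mem_of_even h8 hW, hWi, hW2, hW1⟩, ?_⟩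
      funext j
      rw [hu' j, vecIIZ]
      by_cases hj : j = ptInf
      · subst hj; rw [nuZ_singleton_self, nuZ_mem hWi]; simp
      · rw [nuZ_singleton_ne hj, if_neg hj]
        rcases nuZ_apply (K := W) (i := j) with ⟨e1, e2⟩ | ⟨e1, e2⟩ <;> rw [e1] <;> simp [e2]
    · exfalso
      rw [nuZ_singleton_ne (Ne.symm hi0)] at u0
      by_cases hi1 : i = ptZero
      · subst hi1
        rw [nuZ_singleton_self] at u1
        rw [nuZ_singleton_ne ptZero_ne_ptOne.symm] at u2
        -- only `i = 0` remains, where `W` would have four points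
        have h4 : W.card = 4 := by omega
        obtain ⟨K, hK, hodd⟩ := h.exists_odd (W := W) (card_pos.1 (by omega)) (by omega)
        exact hodd (hW K hK)
      · rw [nuZ_singleton_ne (Ne.symm hi1)] at u1
        omega

theorem vecII_mem (h : IsSteinerSystem 𝒮) {K : Finset Omega} (hK : K ∈ octadsII 𝒮) :
    vecII K ∈ leechLattice 𝒮 := by
  have : vecII K = ofInt oddGen + (8 : ℝ) • nu {ptInf} - (2 : ℝ) • nu K := by
    rw [ofInt_oddGen]
    funext i
    simp only [vecII, nu, Pi.add_apply, Pi.sub_apply, Pi.smul_apply, mem_univ, mem_singleton,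
      if_true]
    by_cases hi : i = ptInf
    · subst hi; simp [hK.2.1]; norm_num
    · by_cases hiK : i ∈ K <;> simp [hi, hiK]; norm_num
  rw [this]
  exact sub_mem (add_mem ofInt_oddGen_mem (eight_mem h _)) (two_nu_mem hK.1)

theorem vecIIZ_eq {K : Finset Omega} (hK : ptInf ∈ K) (j : Omega) :
    vecIIZ K j = 1 - 2 * nuZ K j + 4 * 1 * nuZ {ptInf} j := by
  rw [vecIIZ]
  by_cases hj : j = ptInf
  · subst hj; rw [nuZ_singleton_self, nuZ_mem hK]; simp
  · rw [nuZ_singleton_ne hj, if_neg hj]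
    rcases nuZ_apply (K := K) (i := j) with ⟨e1, e2⟩ | ⟨e1, e2⟩ <;> rw [e1] <;> simp [e2]

theorem perp_vector_props (h : IsSteinerSystem 𝒮) {l : Omega → ℝ}
    (hl : l ∈ vecI '' octadsI 𝒮 ∪ vecII '' octadsII 𝒮) : ∃ u : Omega → ℤ, l = ofInt u ∧
      l ∈ leechLattice 𝒮 ∧ u ⬝ᵥ u = 32 ∧ u ptInf + u ptZero = 4 ∧ 4 * u ptInf + ∑ i, u i = 24 ∧
      ∑ i, u i - 4 * u ptOne = 16 := by
  rcases hl with ⟨K, hK, rfl⟩ | ⟨K, hK, rfl⟩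
  · have hs : ∑ i, (2 • nuZ K) i = 16 := by
      simp only [Pi.smul_apply, ← smul_sum]
      rw [sum_nuZ, univ_inter, h.1 K hK.1]
      rfl
    refine ⟨2 • nuZ K, (ofInt_two_nuZ K).symm, two_nu_mem hK.1, ?_, ?_, ?_, ?_⟩
    · rw [smul_dotProduct, dotProduct_smul, dotProduct_nuZ, sum_nuZ, inter_self, h.1 K hK.1]
      rfl
    · simp only [Pi.smul_apply, nuZ_mem hK.2.1, nuZ_mem hK.2.2.1]; rfl
    · rw [hs]; simp only [Pi.smul_apply, nuZ_mem hK.2.1]; rfl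
    · rw [hs]; simp only [Pi.smul_apply, nuZ_notMem hK.2.2.2]; rfl
  · have hs : ∑ i, vecIIZ K i = 12 := by
      rw [sum_eq_of_sign (vecIIZ_eq hK.2.1), h.1 K hK.1]; norm_num
    have v0 : vecIIZ K ptInf = 3 := if_pos rfl
    have v1 : vecIIZ K ptZero = 1 := by
      rw [vecIIZ, if_neg ptInf_ne_ptZero.symm, if_neg hK.2.2.2]
    have v2 : vecIIZ K ptOne = -1 := by
      rw [vecIIZ, if_neg ptInf_ne_ptOne.symm, if_pos hK.2.2.1]
    refine ⟨vecIIZ K, (ofInt_vecIIZ K).symm, vecII_mem h hK, ?_, ?_, ?_, ?_⟩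
    · have : ∀ i, vecIIZ K i * vecIIZ K i = 1 + 8 * nuZ {ptInf} i := by
        intro i
        by_cases hi : i = ptInf
        · subst hi; rw [nuZ_singleton_self, v0]; norm_num
        · rw [nuZ_singleton_ne hi, vecIIZ, if_neg hi]
          split_ifs <;> norm_num
      rw [dotProduct, sum_congr rfl fun i _ => this i, sum_add_distrib, sum_omega_one, ← mul_sum,
        sum_nuZ]
      simp
    · rw [v0, v1]; norm_num
    · rw [v0, hs]; norm_num
    · rw [v2, hs]; norm_num

theorem forall_mem_latticeR {P : LorentzSpace → Prop} (h0 : P 0)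
    (hadd : ∀ v w, P v → P w → P (v + w)) (hneg : ∀ v, P v → P (-v))
    (hb : ∀ i, P (rootBasis i)) : ∀ v ∈ latticeR, P v := by
  intro v hv
  induction hv using AddSubgroup.closure_induction with
  | mem x hx => obtain ⟨i, rfl⟩ := hx; exact hb i
  | zero => exact h0
  | add x y _ _ hx hy => exact hadd x y hx hy
  | neg x _ hx => exact hneg x hx

theorem lorentzForm_add_right (a v w : LorentzSpace) :
    lorentzForm a (v + w) = lorentzForm a v + lorentzForm a w := by
  simp only [lorentzForm, leechForm_eq, Prod.fst_add, Prod.snd_add, dotProduct_add]; ring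

theorem lorentzForm_smul_right (a : LorentzSpace) (c : ℝ) (v : LorentzSpace) :
    lorentzForm a (c • v) = c * lorentzForm a v := by
  simp only [lorentzForm, leechForm_eq, Prod.smul_fst, Prod.smul_snd, dotProduct_smul, smul_eq_mul]
  ring

theorem lorentzForm_comm (v w : LorentzSpace) : lorentzForm v w = lorentzForm w v := by
  simp only [lorentzForm, leechForm_eq, dotProduct_comm v.2.2]; ring

theorem lorentzForm_add_left (v w a : LorentzSpace) :
    lorentzForm (v + w) a = lorentzForm v a + lorentzForm w a := by
  rw [lorentzForm_comm, lorentzForm_add_right, lorentzForm_comm a, lorentzForm_comm a]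

theorem lorentzForm_smul_left (c : ℝ) (v a : LorentzSpace) :
    lorentzForm (c • v) a = c * lorentzForm v a := by
  rw [lorentzForm_comm, lorentzForm_smul_right, lorentzForm_comm a]

theorem lorentzForm_neg_right (a v : LorentzSpace) : lorentzForm a (-v) = -lorentzForm a v := by
  rw [← neg_one_smul ℝ v, lorentzForm_smul_right]; ring

theorem perp_iff (r : LorentzSpace) :
    (∀ v ∈ latticeR, lorentzForm r v = 0) ↔ ∀ i, lorentzForm r (rootBasis i) = 0 := by
  constructor
  · intro h i
    exact h _ (AddSubgroup.subset_closure ⟨i, rfl⟩)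
  · intro h
    refine forall_mem_latticeR ?_ ?_ ?_ h
    · simp [lorentzForm, leechForm_eq]
    · intro v w hv hw; rw [lorentzForm_add_right, hv, hw, add_zero]
    · intro v hv; rw [lorentzForm_neg_right, hv, neg_zero]

theorem sum_ofInt (u : Omega → ℤ) : ∑ i, ofInt u i = ((∑ i, u i : ℤ) : ℝ) := by
  simp [ofInt]

theorem rootBasis_pairing (l : Omega → ℝ) (i : Fin 2 ⊕ Fin 2) :
    lorentzForm (leechRootOf l) (rootBasis i) =
      -2 + (l ⬝ᵥ l - 2 * (l ⬝ᵥ rootVec i) + rootVec i ⬝ᵥ rootVec i) / 16 := by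
  rw [rootBasis_eq, lorentzForm_leechRootOf, sub_dotProduct, dotProduct_sub, dotProduct_sub,
    dotProduct_comm (rootVec i) l]
  ring

/-- Orthogonality to `R` prescribes the norm of the Leech vector and its products with `X`, `P`,
`Q`. -/
theorem perp_leechRootOf_iff (l : Omega → ℝ) :
    (∀ v ∈ latticeR, lorentzForm (leechRootOf l) v = 0) ↔ l ⬝ᵥ l = 32 ∧
      4 * l ptInf + ∑ i, l i = 24 ∧ 4 * l ptInf + 4 * l ptZero = 16 ∧
      ∑ i, l i - 4 * l ptOne = 16 := by
  have hx := rootBasis_pairing l (Sum.inl 0)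
  have hz := rootBasis_pairing l (Sum.inl 1)
  have hp := rootBasis_pairing l (Sum.inr 0)
  have hq := rootBasis_pairing l (Sum.inr 1)
  rw [dotProduct_rootVec_x, rootVec_dotProduct] at hx
  rw [rootVec_z, dotProduct_zero, dotProduct_zero] at hz
  rw [dotProduct_rootVec_p, rootVec_dotProduct] at hp
  rw [dotProduct_rootVec_q, rootVec_dotProduct] at hq
  simp only [Matrix.fromBlocks_apply₁₁, Matrix.fromBlocks_apply₂₂, Matrix.of_apply,
    Matrix.cons_val_zero, Matrix.cons_val_one, Matrix.cons_val_fin_one, Matrix.cons_val'] at hx hp hq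
  rw [perp_iff]
  constructor
  · intro h
    have k0 := h (Sum.inl 0)
    have k1 := h (Sum.inl 1)
    have k2 := h (Sum.inr 0)
    have k3 := h (Sum.inr 1)
    refine ⟨?_, ?_, ?_, ?_⟩ <;> linarith
  · rintro ⟨h1, h2, h3, h4⟩ (i | i) <;> fin_cases i
    · exact hx.trans (by rw [h1, h2]; norm_num)
    · exact hz.trans (by rw [h1]; norm_num)
    · exact hp.trans (by rw [h1, h3]; norm_num)
    · exact hq.trans (by rw [h1, h4]; norm_num)

theorem leechRootsPerpR_eq (h : IsSteinerSystem 𝒮) : leechRootsPerpR 𝒮 =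
    leechRootOf '' (vecI '' octadsI 𝒮 ∪ vecII '' octadsII 𝒮) := by
  ext r
  constructor
  · rintro ⟨hr, hperp⟩
    rw [leechRoots_eq h] at hr
    obtain ⟨l, hl, rfl⟩ := hr
    refine ⟨l, ?_, rfl⟩
    obtain ⟨u, hu, rfl⟩ := exists_ofInt h hl
    obtain ⟨h1, h2, h3, h4⟩ := (perp_leechRootOf_iff _).1 hperp
    rw [ofInt_dotProduct] at h1
    rw [sum_ofInt] at h2 h4
    simp only [ofInt] at h2 h3 h4
    norm_cast at h1 h2 h3 h4
    rcases perp_vector_cases h hu h1 (by linarith) h2 h4 with ⟨K, hK, rfl⟩ | ⟨K, hK, rfl⟩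
    · exact Or.inl ⟨K, hK, (ofInt_two_nuZ K).symm⟩
    · exact Or.inr ⟨K, hK, (ofInt_vecIIZ K).symm⟩
  · rintro ⟨l, hl, rfl⟩
    obtain ⟨u, rfl, hmem, h1, h2, h3, h4⟩ := perp_vector_props h hl
    refine ⟨?_, (perp_leechRootOf_iff _).2 ?_⟩
    · rw [leechRoots_eq h]; exact ⟨_, hmem, rfl⟩
    · rw [ofInt_dotProduct, sum_ofInt]
      simp only [ofInt]
      norm_cast
      exact ⟨h1, h3, by linarith, h4⟩

theorem perp_vector_mem_and_norm (h : IsSteinerSystem 𝒮) :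
    ∀ l ∈ vecI '' octadsI 𝒮 ∪ vecII '' octadsII 𝒮, l ∈ leechLattice 𝒮 ∧ leechForm l l = -4 := by
  intro l hl
  obtain ⟨u, rfl, hmem, h1, -⟩ := perp_vector_props h hl
  refine ⟨hmem, ?_⟩
  rw [leechForm_eq, ofInt_dotProduct, h1]
  norm_num

/-! ### Counting the octads -/

/-- Of the `77` octads through two points, `21` contain a given third point. -/
theorem ncard_octads (h : IsSteinerSystem 𝒮) {a b c : Omega} (hab : a ≠ b) (hac : a ≠ c)
    (hbc : b ≠ c) : {K | K ∈ 𝒮 ∧ a ∈ K ∧ b ∈ K ∧ c ∉ K}.ncard = 56 := by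
  have e : {K | K ∈ 𝒮 ∧ a ∈ K ∧ b ∈ K ∧ c ∉ K} =
      ((IsSteinerSystem.above 𝒮 {a, b} \ IsSteinerSystem.above 𝒮 {c, a, b} :
        Finset (Finset Omega)) : Set (Finset Omega)) := by
    ext K
    simp only [Set.mem_ofPred_eq, coe_sdiff, Set.mem_sdiff, mem_coe, IsSteinerSystem.mem_above,
      insert_subset_iff, singleton_subset_iff]
    tauto
  rw [e, Set.ncard_coe_finset, card_sdiff_of_subset, h.card_above_two, h.card_above_three]
  · rw [card_insert_of_notMem, card_pair hab]
    simp [hac.symm, hbc.symm]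
  · exact card_pair hab
  · intro K hK
    rw [IsSteinerSystem.mem_above] at hK ⊢
    exact ⟨hK.1, (subset_insert _ _).trans hK.2⟩

theorem ncard_octadsI (h : IsSteinerSystem 𝒮) : (octadsI 𝒮).ncard = 56 :=
  ncard_octads h ptInf_ne_ptZero ptInf_ne_ptOne ptZero_ne_ptOne

theorem ncard_octadsII (h : IsSteinerSystem 𝒮) : (octadsII 𝒮).ncard = 56 :=
  ncard_octads h ptInf_ne_ptOne ptInf_ne_ptZero ptZero_ne_ptOne.symm

theorem vecI_apply (K : Finset Omega) (i : Omega) : vecI K i = if i ∈ K then 2 else 0 := by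
  simp [vecI, nu]

theorem vecI_injective : Function.Injective vecI := by
  intro K L hKL
  ext i
  have := congrFun hKL i
  rw [vecI_apply, vecI_apply] at this
  by_cases h1 : i ∈ K <;> by_cases h2 : i ∈ L <;> simp [h1, h2] at this ⊢

theorem vecII_injOn : Set.InjOn vecII (octadsII 𝒮) := by
  intro K hK L hL hKL
  ext i
  have := congrFun hKL i
  simp only [vecII] at this
  by_cases hi : i = ptInf
  · subst hi; simp [hK.2.1, hL.2.1]
  · by_cases h1 : i ∈ K <;> by_cases h2 : i ∈ L <;> simp [h1, h2, hi] at this ⊢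
    all_goals norm_num at this

theorem ncard_vecI (h : IsSteinerSystem 𝒮) : (vecI '' octadsI 𝒮).ncard = 56 := by
  rw [Set.ncard_image_of_injective _ vecI_injective, ncard_octadsI h]

theorem ncard_vecII (h : IsSteinerSystem 𝒮) : (vecII '' octadsII 𝒮).ncard = 56 := by
  rw [vecII_injOn.ncard_image, ncard_octadsII h]

theorem ncard_leechRootsPerpR (h : IsSteinerSystem 𝒮) : (leechRootsPerpR 𝒮).ncard = 112 := by
  rw [leechRootsPerpR_eq h, Set.ncard_image_of_injective _ leechRootOf_injective,
    Set.ncard_union_eq, ncard_vecI h, ncard_vecII h]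
  · rw [Set.disjoint_left]
    rintro _ ⟨K, hK, rfl⟩ ⟨L, hL, e⟩
    have := congrFun e ptInf
    rw [vecI_apply, if_pos hK.2.1, vecII, if_pos rfl] at this
    norm_num at this

section

open Filter Topology

/-! ### The chamber of the Leech roots -/

theorem dotProduct_self_nonneg_real (v : Omega → ℝ) : 0 ≤ v ⬝ᵥ v :=
  sum_nonneg fun i _ => mul_self_nonneg (v i)

theorem continuous_lorentzForm_self : Continuous fun v : LorentzSpace => lorentzForm v v := by
  unfold lorentzForm leechForm dotProduct
  fun_prop

theorem continuous_lorentzForm_left (w : LorentzSpace) :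
    Continuous fun v : LorentzSpace => lorentzForm v w := by
  unfold lorentzForm leechForm dotProduct
  fun_prop

theorem isOpen_positiveCone : IsOpen positiveCone :=
  (isOpen_lt continuous_const continuous_lorentzForm_self).connectedComponentIn

theorem positiveCone_subset {v : LorentzSpace} (hv : v ∈ positiveCone) : 0 < lorentzForm v v :=
  connectedComponentIn_subset {v : LorentzSpace | 0 < lorentzForm v v} (1, 1, 0) hv

theorem one_one_zero_mem : ((1, 1, 0) : LorentzSpace) ∈ positiveCone :=
  mem_connectedComponentIn (by simp [lorentzForm, leechForm_eq])

/-- A vector of positive norm on the wall of a Leech root that lies on no other wall: the sum of the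
root and twice the Weyl vector. -/
def wallVec (l : Omega → ℝ) : LorentzSpace := leechRootOf l + (2 : ℝ) • weylVector

theorem lorentzForm_weylVector_leechRootOf (m : Omega → ℝ) :
    lorentzForm weylVector (leechRootOf m) = 1 := by
  simp [lorentzForm, weylVector, leechForm_eq, leechRootOf]

theorem lorentzForm_wallVec (l m : Omega → ℝ) :
    lorentzForm (wallVec l) (leechRootOf m) = (l - m) ⬝ᵥ (l - m) / 16 := by
  rw [wallVec, lorentzForm_add_left, lorentzForm_leechRootOf, lorentzForm_smul_left,
    lorentzForm_weylVector_leechRootOf]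
  ring

theorem lorentzForm_wallVec_self (l : Omega → ℝ) : lorentzForm (wallVec l) (wallVec l) = 2 := by
  have h : lorentzForm (wallVec l) weylVector = 1 := by
    simp [lorentzForm, weylVector, leechForm_eq, wallVec, leechRootOf]
  nth_rw 2 [wallVec]
  rw [lorentzForm_add_right, lorentzForm_wallVec, lorentzForm_smul_right, h]
  simp

theorem wallVec_zero : wallVec 0 = (1, 1, 0) := by
  simp [wallVec, leechRootOf, weylVector, leechForm_eq]
  norm_num

theorem wallVec_mem (l : Omega → ℝ) : wallVec l ∈ positiveCone := by
  have hc : Continuous fun t : ℝ => wallVec (t • l) := by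
    unfold wallVec leechRootOf leechForm weylVector
    simp only [smul_dotProduct, dotProduct_smul]
    fun_prop
  have hp : IsPreconnected (Set.range fun t : ℝ => wallVec (t • l)) :=
    isPreconnected_range hc
  have hsub := hp.subset_connectedComponentIn (x := (1, 1, 0))
    (F := {v | 0 < lorentzForm v v}) ⟨0, by simp [wallVec_zero]⟩ (by
      rintro _ ⟨t, rfl⟩
      simp [lorentzForm_wallVec_self])
  exact hsub ⟨1, by simp⟩

/-- The coordinates of Leech vectors are integers, so that nonzero Leech vectors are bounded away from
zero. -/
theorem one_le_dotProduct_self (h : IsSteinerSystem 𝒮) {v : Omega → ℝ} (hv : v ∈ leechLattice 𝒮)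
    (h0 : v ≠ 0) : 1 ≤ v ⬝ᵥ v := by
  obtain ⟨k, hk⟩ := exists_dotProduct_self_eq h hv
  have hpos : 0 < v ⬝ᵥ v := by
    refine lt_of_le_of_ne (dotProduct_self_nonneg_real v) fun e => h0 ?_
    exact dotProduct_self_eq_zero.1 e.symm
  rw [hk] at hpos ⊢
  have : 0 < k := by
    by_contra! hlt
    have : (k : ℝ) ≤ 0 := by exact_mod_cast hlt
    linarith
  have : (1 : ℝ) ≤ k := by exact_mod_cast this
  linarith

/-- Near the wall vector of a Leech root `r`, the chamber is the half space of `r`: the products of a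
direction with the other Leech roots grow no faster than those of the wall vector. -/
theorem eventually_mem_chamber (h : IsSteinerSystem 𝒮) {l : Omega → ℝ} (hl : l ∈ leechLattice 𝒮)
    {d : LorentzSpace} (hd : 0 < lorentzForm d (leechRootOf l)) :
    ∀ᶠ ε : ℝ in 𝓝[>] 0, wallVec l + ε • d ∈ chamber 𝒮 := by
  have h1 : ∀ᶠ ε : ℝ in 𝓝[>] 0, wallVec l + ε • d ∈ positiveCone := by
    have hc : Continuous fun ε : ℝ => wallVec l + ε • d := by fun_prop
    have : (fun ε : ℝ => wallVec l + ε • d) ⁻¹' positiveCone ∈ 𝓝 (0 : ℝ) :=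
      (isOpen_positiveCone.preimage hc).mem_nhds (by simpa using wallVec_mem l)
    exact nhdsWithin_le_nhds this
  -- `⟨d, s⟩ ≥ -q B / 16` for the Leech root `s` of a vector at squared distance `q` from `l`, while
  -- the product of `s` with the wall vector is `q / 16`
  set c : Omega → ℝ := d.2.1 • l - d.2.2 with hcdef
  set B : ℝ := |d.2.1| + c ⬝ᵥ c + 1 with hB
  have hcc := dotProduct_self_nonneg_real c
  have hBpos : 0 < B := by positivity
  have h2 : ∀ᶠ ε : ℝ in 𝓝[>] 0, ε < B⁻¹ :=
    nhdsWithin_le_nhds (Iio_mem_nhds (inv_pos.2 hBpos))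
  filter_upwards [h1, h2, self_mem_nhdsWithin] with ε h1 h2 h3
  rw [Set.mem_Ioi] at h3
  refine ⟨h1, fun r hr => ?_⟩
  rw [leechRoots_eq h] at hr
  obtain ⟨m, hm, rfl⟩ := hr
  rw [lorentzForm_add_left, lorentzForm_smul_left, lorentzForm_wallVec]
  by_cases hlm : l = m
  · subst hlm
    simp only [sub_self, dotProduct_zero, zero_div, zero_add]
    positivity
  set δ := m - l with hδ
  set q := δ ⬝ᵥ δ with hq
  have hq1 : 1 ≤ q := one_le_dotProduct_self h (sub_mem hm hl) (sub_ne_zero.2 (Ne.symm hlm))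
  have e1 : (l - m) ⬝ᵥ (l - m) = q := by
    rw [hq, hδ, ← neg_sub m l, neg_dotProduct, dotProduct_neg, neg_neg]
  have e2 : lorentzForm d (leechRootOf m) =
      lorentzForm d (leechRootOf l) + d.2.1 * q / 16 + c ⬝ᵥ δ / 8 := by
    have : m = l + δ := by rw [hδ]; abel
    rw [this]
    simp only [lorentzForm, leechRootOf, leechForm_eq, dotProduct_add, add_dotProduct, hcdef,
      sub_dotProduct, smul_dotProduct, smul_eq_mul, dotProduct_comm δ l, hq]
    ring
  have e3 : 0 ≤ c ⬝ᵥ c + 2 * (c ⬝ᵥ δ) + q := by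
    have := dotProduct_self_nonneg_real (c + δ)
    simp only [dotProduct_add, add_dotProduct, dotProduct_comm δ c] at this
    linarith
  have e4 : c ⬝ᵥ c ≤ c ⬝ᵥ c * q := le_mul_of_one_le_right hcc hq1
  have e5 : -(|d.2.1| * q) ≤ d.2.1 * q := by
    have := neg_abs_le d.2.1
    nlinarith
  have e6 : -(q * B / 16) ≤ lorentzForm d (leechRootOf m) := by
    rw [e2, hB]; nlinarith
  have e7 : ε * B < 1 := by
    have := mul_lt_mul_of_pos_right h2 hBpos
    rwa [inv_mul_cancel₀ hBpos.ne'] at this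
  rw [e1]
  have e8 : -(ε * (q * B / 16)) ≤ ε * lorentzForm d (leechRootOf m) := by
    have := mul_le_mul_of_nonneg_left e6 h3.le
    linarith
  have e9 : q * (ε * B) < q * 1 := mul_lt_mul_of_pos_left e7 (by linarith)
  linarith

theorem lorentzForm_left_eq_zero {v : LorentzSpace} (hv : ∀ w, lorentzForm v w = 0) : v = 0 := by
  obtain ⟨a, b, l⟩ := v
  have h1 := hv (1, 0, 0)
  have h2 := hv (0, 1, 0)
  have h3 := hv (0, 0, l)
  simp only [lorentzForm, leechForm_eq, dotProduct_zero] at h1 h2 h3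
  have hl : l = 0 := dotProduct_self_eq_zero.1 (by linarith)
  simp only [Prod.mk_eq_zero]
  exact ⟨by linarith, by linarith, hl⟩

/-- If the open half space of a vector `r` with `⟨r, r⟩ = -2` is contained in that of `s`, then `s`
is a positive multiple of `r`; for equal norms they agree. -/
theorem eq_of_halfSpace {r s : LorentzSpace} (hr : lorentzForm r r = -2)
    (hs : lorentzForm s s = -2) (hrs : ∀ d, 0 < lorentzForm d r → 0 < lorentzForm d s) : s = r := by
  set c : ℝ := -(lorentzForm s r) / 2 with hc
  -- the half space of `r` is invariant under translations orthogonal to `r`, hence so is the form `s`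
  have hperp : ∀ d, lorentzForm d r = 0 → lorentzForm d s = 0 := by
    intro d hd
    have key : ∀ t : ℝ, 0 < t * lorentzForm d s + lorentzForm (-r) s := by
      intro t
      have := hrs (t • d + -r) (by
        rw [lorentzForm_add_left, lorentzForm_smul_left, hd, lorentzForm_comm (-r),
          lorentzForm_neg_right, hr]; norm_num)
      rwa [lorentzForm_add_left, lorentzForm_smul_left] at this
    by_contra hne
    have := key (-(lorentzForm (-r) s) / lorentzForm d s)
    rw [div_mul_cancel₀ _ hne] at this
    linarith
  have hsc : s = c • r := by
    rw [← sub_eq_zero]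
    refine lorentzForm_left_eq_zero fun w => ?_
    rw [lorentzForm_comm]
    have hw : w = (w + (lorentzForm w r / 2) • r) + (-(lorentzForm w r / 2)) • r := by module
    have h0 : lorentzForm (w + (lorentzForm w r / 2) • r) r = 0 := by
      rw [lorentzForm_add_left, lorentzForm_smul_left, hr]; ring
    have h1 := hperp _ h0
    rw [hw, lorentzForm_add_left, sub_eq_add_neg, lorentzForm_add_right, lorentzForm_add_right,
      h1, lorentzForm_neg_right, lorentzForm_neg_right, lorentzForm_smul_right, h0,
      lorentzForm_smul_left, lorentzForm_smul_left, lorentzForm_smul_right, hr,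
      lorentzForm_comm r s, hc]
    ring
  have hpos : 0 < c := by
    have := hrs (-r) (by rw [lorentzForm_comm, lorentzForm_neg_right, hr]; norm_num)
    rw [lorentzForm_comm, lorentzForm_neg_right] at this
    rw [hc]; linarith
  rw [hsc, lorentzForm_smul_left, lorentzForm_smul_right, hr] at hs
  have : c = 1 := by nlinarith
  rw [hsc, this, one_smul]

theorem autChamber_form {g : LorentzSpace ≃ₗ[ℝ] LorentzSpace} (hg : g ∈ autChamber 𝒮)
    (v w : LorentzSpace) : lorentzForm (g v) (g w) = lorentzForm v w := hg.1.1 v w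

theorem autChamber_inv {g : LorentzSpace ≃ₗ[ℝ] LorentzSpace} (hg : g ∈ autChamber 𝒮) :
    g.symm ∈ autChamber 𝒮 := inv_mem hg

theorem autChamber_mem_chamber {g : LorentzSpace ≃ₗ[ℝ] LorentzSpace} (hg : g ∈ autChamber 𝒮)
    {v : LorentzSpace} (hv : v ∈ chamber 𝒮) : g v ∈ chamber 𝒮 := by
  have h : g • chamber 𝒮 = chamber 𝒮 := hg.2
  rw [← h]
  exact Set.smul_mem_smul_set hv

theorem autChamber_mem_latticeII {g : LorentzSpace ≃ₗ[ℝ] LorentzSpace} (hg : g ∈ autChamber 𝒮)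
    {v : LorentzSpace} (hv : v ∈ latticeII 𝒮) : g v ∈ latticeII 𝒮 := by
  have h : g • (latticeII 𝒮 : Set LorentzSpace) = latticeII 𝒮 := hg.1.2
  rw [← SetLike.mem_coe, ← h]
  exact Set.smul_mem_smul_set hv

/-- If a segment in the vectors of positive norm ends in the positive cone, it starts there. -/
theorem mem_positiveCone_of_segment {v w : LorentzSpace} (hw : w ∈ positiveCone)
    (hseg : ∀ x ∈ segment ℝ v w, 0 < lorentzForm x x) : v ∈ positiveCone := by
  have hp : IsPreconnected (segment ℝ v w) := (convex_segment v w).isPreconnected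
  have hsub := hp.subset_connectedComponentIn (F := {v | 0 < lorentzForm v v})
    (right_mem_segment ℝ v w) hseg
  have := hsub (left_mem_segment ℝ v w)
  rwa [← connectedComponentIn_eq hw] at this

/-- The automorphisms of the chamber permute its walls, hence the Leech roots. -/
theorem autChamber_mem_leechRoots (h : IsSteinerSystem 𝒮) {g : LorentzSpace ≃ₗ[ℝ] LorentzSpace}
    (hg : g ∈ autChamber 𝒮) {r : LorentzSpace} (hr : r ∈ leechRoots 𝒮) : g r ∈ leechRoots 𝒮 := by
  obtain ⟨l, hl, rfl⟩ : ∃ l ∈ leechLattice 𝒮, leechRootOf l = r := by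
    rwa [leechRoots_eq h] at hr
  have hgd : ∀ d, 0 < lorentzForm d (leechRootOf l) →
      ∀ᶠ ε : ℝ in 𝓝[>] 0, g (wallVec l) + ε • g d ∈ chamber 𝒮 := by
    intro d hd
    filter_upwards [eventually_mem_chamber h hl hd] with ε hε
    have := autChamber_mem_chamber hg hε
    rwa [map_add, map_smul] at this
  -- the image of the wall vector is a limit of points of the chamber
  have hd0 : 0 < lorentzForm (-leechRootOf l) (leechRootOf l) := by
    rw [lorentzForm_comm, lorentzForm_neg_right, lorentzForm_leechRootOf]; simp
  have hnn : ∀ s ∈ leechRoots 𝒮, 0 ≤ lorentzForm (g (wallVec l)) s := by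
    intro s hs
    have hc : Continuous fun ε : ℝ => lorentzForm (g (wallVec l) + ε • g (-leechRootOf l)) s :=
      (continuous_lorentzForm_left s).comp (by fun_prop)
    have ht : Tendsto (fun ε : ℝ => lorentzForm (g (wallVec l) + ε • g (-leechRootOf l)) s)
        (𝓝[>] 0) (𝓝 (lorentzForm (g (wallVec l)) s)) := by
      have := hc.tendsto 0
      rw [zero_smul, add_zero] at this
      exact this.mono_left nhdsWithin_le_nhds
    exact ge_of_tendsto ht ((hgd _ hd0).mono fun ε hε => (hε.2 s hs).le)
  have hcone : g (wallVec l) ∈ positiveCone := by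
    have hc : Continuous fun ε : ℝ => lorentzForm (g (wallVec l) + ε • g (-leechRootOf l))
        (g (wallVec l) + ε • g (-leechRootOf l)) :=
      continuous_lorentzForm_self.comp (by fun_prop)
    have h2 : lorentzForm (g (wallVec l)) (g (wallVec l)) = 2 := by
      rw [autChamber_form hg, lorentzForm_wallVec_self]
    have hnb : {ε : ℝ | 0 < lorentzForm (g (wallVec l) + ε • g (-leechRootOf l))
        (g (wallVec l) + ε • g (-leechRootOf l))} ∈ 𝓝 (0 : ℝ) :=
      (isOpen_lt continuous_const hc).mem_nhds (by simp [h2])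
    obtain ⟨η, hη, hball⟩ := Metric.mem_nhds_iff.1 hnb
    have hη' : ∀ᶠ ε : ℝ in 𝓝[>] 0, ε < η := nhdsWithin_le_nhds (Iio_mem_nhds hη)
    obtain ⟨ε, hε, hεη, hε0⟩ :=
      ((hgd _ hd0).and (hη'.and (self_mem_nhdsWithin (s := Set.Ioi (0 : ℝ))))).exists
    refine mem_positiveCone_of_segment hε.1 ?_
    rintro x ⟨a, b, ha, hb, hab, rfl⟩
    have hx : a • g (wallVec l) + b • (g (wallVec l) + ε • g (-leechRootOf l)) =
        g (wallVec l) + (b * ε) • g (-leechRootOf l) := by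
      rw [smul_add, ← add_assoc, ← add_smul, hab, one_smul, smul_smul]
    rw [hx]
    refine hball ?_
    have hε0 : 0 < ε := hε0
    rw [Metric.mem_ball, Real.dist_eq, sub_zero, abs_of_nonneg (by positivity)]
    nlinarith
  -- it is not in the chamber itself, so it lies on the wall of some Leech root `s`; near this point the
  -- chamber is the half space of `g r`, and it is contained in that of `s`
  have hex : ∃ s ∈ leechRoots 𝒮, lorentzForm (g (wallVec l)) s = 0 := by
    by_contra! hall
    have hmem : g (wallVec l) ∈ chamber 𝒮 :=
      ⟨hcone, fun s hs => lt_of_le_of_ne (hnn s hs) (Ne.symm (hall s hs))⟩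
    have := autChamber_mem_chamber (autChamber_inv hg) hmem
    rw [LinearEquiv.symm_apply_apply] at this
    have := this.2 _ hr
    rw [lorentzForm_wallVec] at this
    simp at this
  obtain ⟨s, hs, hs0⟩ := hex
  suffices g.symm s = leechRootOf l by
    rw [← this, LinearEquiv.apply_symm_apply]; exact hs
  have hform : ∀ d, lorentzForm (g d) s = lorentzForm d (g.symm s) := fun d => by
    rw [← autChamber_form hg d, LinearEquiv.apply_symm_apply]
  refine eq_of_halfSpace hr.2.1 ?_ fun d hd => ?_
  · rw [autChamber_form (autChamber_inv hg)]; exact hs.2.1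
  · obtain ⟨ε, hε, hε0⟩ := ((hgd d hd).and (self_mem_nhdsWithin (s := Set.Ioi (0 : ℝ)))).exists
    have := hε.2 s hs
    rw [lorentzForm_add_left, hs0, zero_add, lorentzForm_smul_left, hform] at this
    exact pos_of_mul_pos_right this (le_of_lt hε0)

/-- The Leech roots span. -/
theorem eq_zero_of_leechRoots (h : IsSteinerSystem 𝒮) {v : LorentzSpace}
    (hv : ∀ r ∈ leechRoots 𝒮, lorentzForm v r = 0) : v = 0 := by
  have hr : ∀ l ∈ leechLattice 𝒮, v.1 + v.2.1 * (-1 + l ⬝ᵥ l / 16) - v.2.2 ⬝ᵥ l / 8 = 0 := by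
    intro l hl
    have := hv (leechRootOf l) (by rw [leechRoots_eq h]; exact ⟨l, hl, rfl⟩)
    simp only [lorentzForm, leechRootOf, leechForm_eq] at this
    linarith
  have h0 := hr 0 (zero_mem _)
  have h8 : ∀ i : Omega, v.2.1 * 4 - v.2.2 i = 0 ∧ v.2.1 * 4 + v.2.2 i = 0 := by
    intro i
    have e := eight_mem h i
    have h1 := hr _ e
    have h2 := hr _ (neg_mem e)
    simp only [dotProduct_zero, dotProduct_smul, smul_dotProduct, dotProduct_neg, neg_dotProduct,
      dotProduct_nu, sum_singleton, smul_eq_mul, nu_apply_self] at h0 h1 h2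
    constructor <;> linarith
  have hb : v.2.1 = 0 := by have := h8 ptInf; linarith
  have hl : v.2.2 = 0 := funext fun i => by
    have := h8 i; rw [Pi.zero_apply]; linarith
  rw [hb, hl] at h0
  have ha : v.1 = 0 := by simpa using h0
  exact Prod.ext ha (Prod.ext hb hl)

/-- The Weyl vector is the vector that has product `1` with all Leech roots. -/
theorem autChamber_weylVector (h : IsSteinerSystem 𝒮) {g : LorentzSpace ≃ₗ[ℝ] LorentzSpace}
    (hg : g ∈ autChamber 𝒮) : g weylVector = weylVector := by
  rw [← sub_eq_zero]
  refine eq_zero_of_leechRoots h fun r hr => ?_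
  have h1 := autChamber_form (autChamber_inv hg) (g weylVector) r
  rw [LinearEquiv.symm_apply_apply, lorentzForm_comm,
    (autChamber_mem_leechRoots h (autChamber_inv hg) hr).2.2] at h1
  rw [sub_eq_add_neg, lorentzForm_add_left, ← h1, lorentzForm_comm, lorentzForm_neg_right, hr.2.2]
  norm_num

/-- Conversely, an isometry of `II_{1,25}` that fixes the Weyl vector and `R` preserves the
chamber. -/
theorem mem_autFixR {g : LorentzSpace ≃ₗ[ℝ] LorentzSpace} (hg : g ∈ orthogonalGroupII 𝒮)
    (hw : g weylVector = weylVector) (hR : ∀ i, g (rootBasis i) = rootBasis i) :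
    g ∈ autFixR 𝒮 := by
  have key : ∀ g : LorentzSpace ≃ₗ[ℝ] LorentzSpace, g ∈ orthogonalGroupII 𝒮 →
      g weylVector = weylVector → g (rootBasis (Sum.inl 1)) = rootBasis (Sum.inl 1) →
      ∀ v ∈ chamber 𝒮, g v ∈ chamber 𝒮 := by
    intro g hg hw hz v hv
    have hform : ∀ v w, lorentzForm (g v) (g w) = lorentzForm v w := hg.1
    have hlat : g • (latticeII 𝒮 : Set LorentzSpace) = latticeII 𝒮 := hg.2
    -- `(1, 1, 0) = z + 2 ρ` is fixed, so that `g` preserves the component of the positive cone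
    have h11 : g (1, 1, 0) = (1, 1, 0) := by
      have : ((1, 1, 0) : LorentzSpace) = rootBasis (Sum.inl 1) + (2 : ℝ) • weylVector := by
        rw [rootBasis_eq, rootVec_z, ← wallVec_zero]; rfl
      rw [this, map_add, map_smul, hw, hz]
    have hcont : Continuous g := LinearMap.continuous_of_finiteDimensional g.toLinearMap
    refine ⟨?_, fun r hr => ?_⟩
    · have hp : IsPreconnected (g '' positiveCone) :=
        isPreconnected_connectedComponentIn.image _ hcont.continuousOn
      refine hp.subset_connectedComponentIn ⟨_, one_one_zero_mem, h11⟩ ?_ ⟨v, hv.1, rfl⟩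
      rintro _ ⟨w, hw, rfl⟩
      simp only [Set.mem_ofPred_eq, hform]
      exact positiveCone_subset hw
    · obtain ⟨s, hs, rfl⟩ : ∃ s ∈ latticeII 𝒮, g s = r := by
        have : r ∈ g • (latticeII 𝒮 : Set LorentzSpace) := by rw [hlat]; exact hr.1
        exact this
      rw [hform]
      refine hv.2 s ⟨hs, ?_, ?_⟩
      · rw [← hform]; exact hr.2.1
      · rw [← hform, hw]; exact hr.2.2
  have hz := hR (Sum.inl 1)
  refine ⟨⟨hg, ?_⟩, ?_⟩
  · change g • chamber 𝒮 = chamber 𝒮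
    refine Set.Subset.antisymm ?_ fun v hv => ?_
    · rintro _ ⟨v, hv, rfl⟩
      exact key g hg hw hz v hv
    · refine ⟨g.symm v, key g.symm (inv_mem hg) ?_ ?_ v hv, g.apply_symm_apply v⟩
      · rw [LinearEquiv.symm_apply_eq, hw]
      · rw [LinearEquiv.symm_apply_eq, hz]
  · refine (mem_fixingSubgroup_iff _).2 ?_
    refine forall_mem_latticeR (map_zero g) (fun v w hv hw => ?_) (fun v hv => ?_) hR
    · exact (map_add g v w).trans (congrArg₂ _ hv hw)
    · exact (map_neg g v).trans (congrArg _ hv)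

end

/-! ### The 162 vectors conjugate to `4 ν_0 - 4 ν_∞` -/

/-- The Leech vector `4 ν_0 - 4 ν_∞`; together with `P` it determines `ν_∞` and `ν_0`. -/
def frameVecZ : Omega → ℤ := 4 • nuZ {ptZero} - 4 • nuZ {ptInf}

open Classical in
/-- A list of the integral vectors of norm `-4` in the Leech lattice with the same products with `X`,
`P`, `Q` as `4 ν_0 - 4 ν_∞`: this vector itself, the vectors `4 ν_0 + 4 ν_j - 2 ν_K` for an octad `K`
through `∞, 0, 1` and a further point `j` of it, and the vectors `2 ν_K - ν_Ω - 4 ν_1` for the octads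
`K` through `0` and `1` that do not contain `∞`. -/
def frameVecs (𝒮 : Set (Finset Omega)) : Finset (Omega → ℤ) :=
  {frameVecZ} ∪
    ((IsSteinerSystem.above 𝒮 {ptInf, ptZero, ptOne}).sigma
      fun K => K \ {ptInf, ptZero, ptOne}).image
        (fun s => 4 • nuZ {ptZero} + 4 • nuZ {s.2} - 2 • nuZ s.1) ∪
    (univ.filter fun K => K ∈ 𝒮 ∧ ptZero ∈ K ∧ ptOne ∈ K ∧ ptInf ∉ K).image
      (fun K => 2 • nuZ K - nuZ univ - 4 • nuZ {ptOne})

theorem card_three : ({ptInf, ptZero, ptOne} : Finset Omega).card = 3 := by decide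

/-- The count is `1 + 21 · 5 + 56`. -/
theorem card_frameVecs_le (h : IsSteinerSystem 𝒮) : (frameVecs 𝒮).card ≤ 162 := by
  classical
  refine (card_union_le _ _).trans ?_
  have h1 : ((univ : Finset (Finset Omega)).filter
      fun K => K ∈ 𝒮 ∧ ptZero ∈ K ∧ ptOne ∈ K ∧ ptInf ∉ K).card = 56 := by
    rw [← ncard_octads h ptZero_ne_ptOne ptInf_ne_ptZero.symm ptInf_ne_ptOne.symm,
      ← Set.ncard_coe_finset]
    congr 1
    ext K
    simp
  have h2 : ((IsSteinerSystem.above 𝒮 {ptInf, ptZero, ptOne}).sigma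
      fun K => K \ {ptInf, ptZero, ptOne}).card = 105 := by
    rw [card_sigma, sum_congr rfl (g := fun _ => 5), sum_const, h.card_above_three card_three]
    · rfl
    · intro K hK
      rw [IsSteinerSystem.mem_above] at hK
      rw [card_sdiff_of_subset hK.2, h.1 K hK.1, card_three]
  have h3 := card_image_le (s := (univ : Finset (Finset Omega)).filter
    fun K => K ∈ 𝒮 ∧ ptZero ∈ K ∧ ptOne ∈ K ∧ ptInf ∉ K)
    (f := fun K => 2 • nuZ K - nuZ univ - 4 • nuZ {ptOne})
  have h4 := card_image_le (s := ((IsSteinerSystem.above 𝒮 {ptInf, ptZero, ptOne}).sigma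
    fun K => K \ {ptInf, ptZero, ptOne}))
    (f := fun s => 4 • nuZ {ptZero} + 4 • nuZ {s.2} - 2 • nuZ s.1)
  have h5 := card_union_le {frameVecZ} (((IsSteinerSystem.above 𝒮 {ptInf, ptZero, ptOne}).sigma
    fun K => K \ {ptInf, ptZero, ptOne}).image
    (fun s => 4 • nuZ {ptZero} + 4 • nuZ {s.2} - 2 • nuZ s.1))
  rw [card_singleton] at h5
  omega

theorem mem_frameVecs (h : IsSteinerSystem 𝒮) {u : Omega → ℤ} (hu : u ∈ congruenceLattice 𝒮)
    (h32 : u ⬝ᵥ u = 32) (hp : u ptInf + u ptZero = 0) (hx : 4 * u ptInf + ∑ i, u i = -16)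
    (hq : ∑ i, u i - 4 * u ptOne = 0) : u ∈ frameVecs 𝒮 := by
  classical
  have h3 := sq_add_three_le h32
  have e1 : u ptZero = -u ptInf := by linarith
  have e2 : u ptOne = -4 - u ptInf := by linarith
  have hr : -4 ≤ u ptInf ∧ u ptInf ≤ 1 := by
    rw [e1, e2] at h3
    constructor <;> nlinarith
  rw [frameVecs, mem_union, mem_union]
  by_cases h0 : 2 ∣ u ptInf
  · left
    rcases even_vector_cases h hu h32 h0 with h4 | ⟨K, hK, hon, hoff⟩
    · left
      -- `t² + 4 t ≥ 0` for `t` divisible by four, which excludes `u_∞ = 0`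
      have hpos : 0 ≤ ∑ i, (u i * u i + 4 * u i) := sum_nonneg fun i _ => by
        obtain ⟨t, ht⟩ := h4 i
        rw [ht]
        have : t ≤ -1 ∨ 0 ≤ t := by omega
        rcases this with ht | ht <;> nlinarith
      rw [sum_add_distrib, ← mul_sum, show ∑ i, u i * u i = 32 from h32] at hpos
      have hinf : u ptInf = -4 := by
        have := h4 ptInf
        omega
      have hT : ∀ i, i ≠ ptInf → i ≠ ptZero → u i = 0 := by
        intro i hi hi0
        have hs := sq_add_le h32 (T := {ptInf, ptZero, i})
        rw [sum_insert (by simp [ptInf_ne_ptZero, Ne.symm hi]),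
          sum_insert (by simpa using Ne.symm hi0), sum_singleton, e1, hinf] at hs
        have : u i * u i ≤ 0 := by linarith
        exact mul_self_eq_zero.1 (le_antisymm this (mul_self_nonneg _))
      rw [mem_singleton]
      funext i
      simp only [frameVecZ, Pi.sub_apply, Pi.smul_apply]
      by_cases hi : i = ptInf
      · subst hi
        rw [nuZ_singleton_self, nuZ_singleton_ne ptInf_ne_ptZero, hinf]
        norm_num
      · by_cases hi0 : i = ptZero
        · subst hi0
          rw [nuZ_singleton_self, nuZ_singleton_ne hi, e1, hinf]
          norm_num
        · rw [nuZ_singleton_ne hi, nuZ_singleton_ne hi0, hT i hi hi0]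
          norm_num
    · right
      have hval : ∀ i, u i = 2 ∨ u i = -2 ∨ u i = 0 := by
        intro i
        by_cases hi : i ∈ K
        · rcases hon i hi with e | e <;> simp [e]
        · simp [hoff i hi]
      have v0 := hval ptInf
      have v2 := hval ptOne
      clear h3
      have hinf : u ptInf = -2 := by omega
      have hzero : u ptZero = 2 := by omega
      have hone : u ptOne = -2 := by omega
      have hin : ∀ i, u i ≠ 0 → i ∈ K := fun i hi => by
        by_contra hiK
        exact hi (hoff i hiK)
      have hK0 := hin ptInf (by omega)
      have hK1 := hin ptZero (by omega)
      have hK2 := hin ptOne (by omega)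
      -- the sum of the coordinates is `-8`: exactly two signs are positive, one of them at `0`
      have hs : ∑ i ∈ K, (u i + 2) = 8 := by
        have e : ∑ i, u i = ∑ i ∈ K, u i := by
          rw [← sum_add_sum_compl K, sum_eq_zero (s := Kᶜ) fun i hi => hoff i (mem_compl.1 hi),
            add_zero]
        rw [sum_add_distrib, ← e, sum_const, h.1 K hK]
        simp only [nsmul_eq_mul]
        push_cast
        linarith
      rw [← add_sum_erase _ _ hK1, hzero] at hs
      have hs' : ∑ i ∈ K.erase ptZero, (u i + 2) = 4 := by linarith
      obtain ⟨j, hj, hj0⟩ : ∃ j ∈ K.erase ptZero, u j + 2 ≠ 0 := by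
        by_contra! hall
        rw [sum_eq_zero hall] at hs'
        norm_num at hs'
      have hjK := mem_of_mem_erase hj
      have hj2 : u j = 2 := by
        rcases hon j hjK with e | e <;> omega
      rw [← add_sum_erase _ _ hj, hj2] at hs'
      have hs'' : ∑ i ∈ (K.erase ptZero).erase j, (u i + 2) = 0 := by linarith
      have hz := (sum_eq_zero_iff_of_nonneg fun i hi => by
        rcases hon i (mem_of_mem_erase (mem_of_mem_erase hi)) with e | e <;> omega).1 hs''
      have hj1 : j ≠ ptZero := ne_of_mem_erase hj
      rw [mem_image]
      refine ⟨⟨K, j⟩, mem_sigma.2 ⟨IsSteinerSystem.mem_above.2 ⟨hK, ?_⟩, ?_⟩, ?_⟩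
      · simp [insert_subset_iff, hK0, hK1, hK2]
      · simp only [mem_sdiff, mem_insert, mem_singleton, not_or]
        refine ⟨hjK, ?_, hj1, ?_⟩ <;> rintro rfl <;> omega
      · funext i
        simp only [Pi.sub_apply, Pi.add_apply, Pi.smul_apply]
        by_cases hi : i ∈ K
        · rw [nuZ_mem hi]
          by_cases hi0 : i = ptZero
          · subst hi0
            rw [nuZ_singleton_self, nuZ_singleton_ne (Ne.symm hj1), hzero]
            norm_num
          · rw [nuZ_singleton_ne hi0]
            by_cases hij : i = j
            · subst hij
              rw [nuZ_singleton_self, hj2]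
              norm_num
            · have := hz i (mem_erase.2 ⟨hij, mem_erase.2 ⟨hi0, hi⟩⟩)
              rw [nuZ_singleton_ne hij]
              simp only [nsmul_eq_mul]
              push_cast
              linarith
        · have hi0 : i ≠ ptZero := fun e => hi (e ▸ hK1)
          have hij : i ≠ j := fun e => hi (e ▸ hjK)
          rw [nuZ_notMem hi, nuZ_singleton_ne hi0, nuZ_singleton_ne hij, hoff i hi]
          norm_num
  · right
    obtain ⟨i, W, e, he, hW, hu'⟩ := odd_vector_exists_octad_form h hu h32 h0
    have hs := sum_eq_of_sign hu'
    have u0 := hu' ptInf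
    have u1 := hu' ptZero
    have u2 := hu' ptOne
    have w0 := nuZ_apply (K := W) (i := ptInf)
    have w1 := nuZ_apply (K := W) (i := ptZero)
    have w2 := nuZ_apply (K := W) (i := ptOne)
    -- the coordinate `±3` is at `1`
    have hi : i = ptOne := by
      by_contra hi
      rw [nuZ_singleton_ne (Ne.symm hi)] at u2
      by_cases hi0 : i = ptInf
      · subst hi0
        rw [nuZ_singleton_ne ptInf_ne_ptZero.symm] at u1
        rw [nuZ_singleton_self] at u0
        rcases he with he | he <;> rcases w0 with w0 | w0 <;> rcases w1 with w1 | w1 <;> omega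
      · rw [nuZ_singleton_ne (Ne.symm hi0)] at u0
        rcases w0 with w0 | w0 <;> rcases w2 with w2 | w2 <;> omega
    subst hi
    rw [nuZ_singleton_ne ptInf_ne_ptOne] at u0
    rw [nuZ_singleton_ne ptZero_ne_ptOne] at u1
    rw [nuZ_singleton_self] at u2
    have he' : e = -1 ∧ ptOne ∉ W := by
      rcases he with he | he
      · exfalso
        rcases w0 with w0 | w0 <;> rcases w2 with w2 | w2 <;> omega
      · exact he
    obtain ⟨rfl, hW2⟩ := he'
    rw [nuZ_notMem hW2] at u2
    have hW0 : ptInf ∈ W := by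
      rcases w0 with w0 | w0
      · exact w0.2
      · exfalso; omega
    have hW1 : ptZero ∉ W := by
      rcases w1 with w1 | w1
      · exfalso; rcases w0 with w0 | w0 <;> omega
      · exact w1.2
    have h16 : W.card = 16 := by
      rw [nuZ_mem hW0] at u0
      omega
    -- `W` has sixteen points and meets octads in even sets; its complement is an octad
    have hc : Wᶜ ∈ 𝒮 := by
      refine h.mem_of_even (by rw [card_compl, h16, IsSteinerSystem.card_omega]) fun K hK => ?_
      have e : K ∩ Wᶜ = K \ W := by ext; simp
      have h1 := card_sdiff_add_card_inter K W
      obtain ⟨r, hr⟩ := hW K hK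
      rw [h.1 K hK] at h1
      rw [e, Nat.even_iff]
      omega
    rw [mem_image]
    refine ⟨Wᶜ, mem_filter.2 ⟨mem_univ _, hc, mem_compl.2 hW1, mem_compl.2 hW2, ?_⟩, ?_⟩
    · simpa using hW0
    · funext j
      rw [hu' j]
      simp only [Pi.sub_apply, Pi.smul_apply, nuZ_mem (mem_univ j)]
      rcases nuZ_apply (K := W) (i := j) with ⟨e1, e2⟩ | ⟨e1, e2⟩
      · rw [e1, nuZ_notMem (K := Wᶜ) (by simpa using e2)]; simp only [nsmul_eq_mul]; push_cast; ring
      · rw [e1, nuZ_mem (K := Wᶜ) (by simpa using e2)]; simp only [nsmul_eq_mul]; push_cast; ring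

/-- The vectors of norm `-4` with coordinate `4` at a point. -/
theorem four_coordinate (h : IsSteinerSystem 𝒮) {u : Omega → ℤ} (hu : u ∈ congruenceLattice 𝒮)
    (h32 : u ⬝ᵥ u = 32) (hinf : u ptInf = 4) : ∃ j, j ≠ ptInf ∧
      (u = 4 • nuZ {ptInf} + 4 • nuZ {j} ∨ u = 4 • nuZ {ptInf} - 4 • nuZ {j}) := by
  rcases even_vector_cases h hu h32 (by rw [hinf]; norm_num) with h4 | ⟨K, hK, hon, hoff⟩
  · have hs : u ptInf * u ptInf + ∑ i ∈ univ.erase ptInf, u i * u i = 32 := by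
      rw [add_sum_erase _ (fun i => u i * u i) (mem_univ ptInf)]; exact h32
    rw [hinf] at hs
    obtain ⟨j, hj, hj0⟩ : ∃ j ∈ univ.erase ptInf, u j * u j ≠ 0 := by
      by_contra! hall
      rw [sum_eq_zero hall] at hs
      norm_num at hs
    have hj1 := ne_of_mem_erase hj
    rw [← add_sum_erase _ _ hj] at hs
    have hnn : 0 ≤ ∑ i ∈ (univ.erase ptInf).erase j, u i * u i :=
      sum_nonneg fun i _ => mul_self_nonneg _
    have hj4 : u j = 4 ∨ u j = -4 := by
      obtain ⟨t, ht⟩ := h4 j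
      have : t ≠ 0 := by rintro rfl; simp [ht] at hj0
      have h16 : u j * u j ≤ 16 := by linarith
      rw [ht] at h16 ⊢
      have : -1 ≤ t ∧ t ≤ 1 := by constructor <;> nlinarith
      omega
    have hjj : u j * u j = 16 := by rcases hj4 with e | e <;> rw [e] <;> norm_num
    have hz := (sum_eq_zero_iff_of_nonneg fun i _ => mul_self_nonneg (u i)).1
      (show ∑ i ∈ (univ.erase ptInf).erase j, u i * u i = 0 by linarith)
    have hrest : ∀ i, i ≠ ptInf → i ≠ j → u i = 0 := fun i hi hij =>
      mul_self_eq_zero.1 (hz i (mem_erase.2 ⟨hij, mem_erase.2 ⟨hi, mem_univ _⟩⟩))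
    refine ⟨j, hj1, hj4.imp (fun e => ?_) fun e => ?_⟩
    all_goals
      funext i
      simp only [Pi.sub_apply, Pi.add_apply, Pi.smul_apply]
      by_cases hi : i = ptInf
      · subst hi
        rw [nuZ_singleton_self, nuZ_singleton_ne (Ne.symm hj1), hinf]
        norm_num
      · rw [nuZ_singleton_ne hi]
        by_cases hij : i = j
        · subst hij
          rw [nuZ_singleton_self, e]
          norm_num
        · rw [nuZ_singleton_ne hij, hrest i hi hij]
          norm_num
  · exfalso
    by_cases hi : ptInf ∈ K
    · rcases hon _ hi with e | e <;> omega
    · have := hoff _ hi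
      omega

/-! ### The action of the stabilizer of `R` on the Leech lattice -/

/-- The component of a linear map of `(U ⊕ Λ) ⊗ ℝ` from the Leech part to the Leech part. -/
def leechPart (g : LorentzSpace ≃ₗ[ℝ] LorentzSpace) : (Omega → ℝ) →ₗ[ℝ] (Omega → ℝ) :=
  LinearMap.snd ℝ ℝ (Omega → ℝ) ∘ₗ LinearMap.snd ℝ ℝ (ℝ × (Omega → ℝ)) ∘ₗ g.toLinearMap ∘ₗ
    LinearMap.inr ℝ ℝ (ℝ × (Omega → ℝ)) ∘ₗ LinearMap.inr ℝ ℝ (Omega → ℝ)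

theorem autFixR_rootBasis {g : LorentzSpace ≃ₗ[ℝ] LorentzSpace} (hg : g ∈ autFixR 𝒮)
    (i : Fin 2 ⊕ Fin 2) : g (rootBasis i) = rootBasis i :=
  (mem_fixingSubgroup_iff _).1 hg.2 _ (AddSubgroup.subset_closure ⟨i, rfl⟩)

/-- The Weyl vector and `z` span the hyperbolic plane `U`, so that the stabilizer of `R` acts on its
complement alone. -/
theorem autFixR_apply (h : IsSteinerSystem 𝒮) {g : LorentzSpace ≃ₗ[ℝ] LorentzSpace}
    (hg : g ∈ autFixR 𝒮) (a b : ℝ) (v : Omega → ℝ) : g (a, b, v) = (a, b, leechPart g v) := by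
  have h1 : g (1, 0, 0) = (1, 0, 0) := autChamber_weylVector h hg.1
  have hz : g (-1, 1, 0) = (-1, 1, 0) := autFixR_rootBasis hg (Sum.inl 1)
  have h2 : g (0, 1, 0) = (0, 1, 0) := by
    have : ((0, 1, 0) : LorentzSpace) = (1, 0, 0) + (-1, 1, 0) := by simp
    rw [this, map_add, h1, hz]
  have f1 := autChamber_form hg.1 (0, 0, v) (1, 0, 0)
  have f2 := autChamber_form hg.1 (0, 0, v) (0, 1, 0)
  rw [h1] at f1
  rw [h2] at f2
  simp only [lorentzForm, leechForm_eq, dotProduct_zero] at f1 f2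
  have h3 : g (0, 0, v) = (0, 0, leechPart g v) := by
    refine Prod.ext ?_ (Prod.ext ?_ rfl)
    · simpa using f2
    · simpa using f1
  have : ((a, b, v) : LorentzSpace) = a • (1, 0, 0) + b • (0, 1, 0) + (0, 0, v) := by simp
  rw [this, map_add, map_add, map_smul, map_smul, h1, h2, h3]
  simp

theorem leechPart_dotProduct (h : IsSteinerSystem 𝒮) {g : LorentzSpace ≃ₗ[ℝ] LorentzSpace}
    (hg : g ∈ autFixR 𝒮) (v w : Omega → ℝ) : leechPart g v ⬝ᵥ leechPart g w = v ⬝ᵥ w := by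
  have := autChamber_form hg.1 (0, 0, v) (0, 0, w)
  rw [autFixR_apply h hg, autFixR_apply h hg] at this
  simp only [lorentzForm, leechForm_eq] at this
  linarith

theorem leechPart_mem {g : LorentzSpace ≃ₗ[ℝ] LorentzSpace}
    (hg : g ∈ autFixR 𝒮) {v : Omega → ℝ} (hv : v ∈ leechLattice 𝒮) :
    leechPart g v ∈ leechLattice 𝒮 :=
  (autChamber_mem_latticeII hg.1 (v := (0, 0, v)) ⟨⟨0, by simp⟩, ⟨0, by simp⟩, hv⟩).2.2

theorem leechPart_rootVec (h : IsSteinerSystem 𝒮) {g : LorentzSpace ≃ₗ[ℝ] LorentzSpace}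
    (hg : g ∈ autFixR 𝒮) (i : Fin 2 ⊕ Fin 2) : leechPart g (rootVec i) = rootVec i := by
  have := autFixR_rootBasis hg i
  rw [rootBasis_eq, leechRootOf, autFixR_apply h hg] at this
  exact congrArg (fun v : LorentzSpace => v.2.2) this

theorem autFixR_leechRootOf (h : IsSteinerSystem 𝒮) {g : LorentzSpace ≃ₗ[ℝ] LorentzSpace}
    (hg : g ∈ autFixR 𝒮) (l : Omega → ℝ) :
    g (leechRootOf l) = leechRootOf (leechPart g l) := by
  rw [leechRootOf, autFixR_apply h hg, leechRootOf, leechForm_eq, leechForm_eq,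
    leechPart_dotProduct h hg]

theorem autFixR_mem_leechRootsPerpR (h : IsSteinerSystem 𝒮) {g : LorentzSpace ≃ₗ[ℝ] LorentzSpace}
    (hg : g ∈ autFixR 𝒮) {r : LorentzSpace} (hr : r ∈ leechRootsPerpR 𝒮) :
    g r ∈ leechRootsPerpR 𝒮 := by
  refine ⟨autChamber_mem_leechRoots h hg.1 hr.1, (perp_iff _).2 fun i => ?_⟩
  rw [← autFixR_rootBasis hg i, autChamber_form hg.1]
  exact (perp_iff _).1 hr.2 i

/-! ### The stabilizer of a coordinate frame -/

/-- The real vector `4 ν_0 - 4 ν_∞`. -/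
def frameVec : Omega → ℝ := (4 : ℝ) • nu {ptZero} - (4 : ℝ) • nu {ptInf}

theorem frameVec_mem (h : IsSteinerSystem 𝒮) : frameVec ∈ leechLattice 𝒮 := four_sub_four_mem h _ _

/-- The images of `4 ν_0 - 4 ν_∞` have the same norm and the same products with `X`, `P`, `Q`. -/
theorem leechPart_frameVec_mem (h : IsSteinerSystem 𝒮) {g : LorentzSpace ≃ₗ[ℝ] LorentzSpace}
    (hg : g ∈ autFixR 𝒮) : leechPart g frameVec ∈ ofInt '' (frameVecs 𝒮 : Set (Omega → ℤ)) := by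
  obtain ⟨u, hu, e⟩ := exists_ofInt h (leechPart_mem hg (frameVec_mem h))
  refine ⟨u, ?_, e.symm⟩
  have key : ∀ i, leechPart g frameVec ⬝ᵥ rootVec i = frameVec ⬝ᵥ rootVec i := fun i => by
    nth_rw 1 [← leechPart_rootVec h hg i]
    exact leechPart_dotProduct h hg _ _
  have hsq := leechPart_dotProduct h hg frameVec frameVec
  have e1 := ptInf_ne_ptZero
  have e2 := ptInf_ne_ptOne
  have e3 := ptZero_ne_ptOne
  have f0 : frameVec ptInf = -4 := by simp [frameVec, nu, e1]
  have f1 : frameVec ptZero = 4 := by simp [frameVec, nu, e1.symm]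
  have f2 : frameVec ptOne = 0 := by simp [frameVec, nu, e2.symm, e3.symm]
  have fs : ∑ i, frameVec i = 0 := by
    simp only [frameVec, Pi.sub_apply, Pi.smul_apply, smul_eq_mul, sum_sub_distrib, ← mul_sum,
      sum_nu, card_singleton]
    norm_num
  have fsq : frameVec ⬝ᵥ frameVec = 32 := by
    nth_rw 2 [frameVec]
    rw [dotProduct_sub, dotProduct_smul, dotProduct_smul, dotProduct_nu, dotProduct_nu,
      sum_singleton, sum_singleton, f0, f1]
    norm_num
  have kx := key (Sum.inl 0)
  have kp := key (Sum.inr 0)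
  have kq := key (Sum.inr 1)
  rw [dotProduct_rootVec_x, dotProduct_rootVec_x, e, sum_ofInt, fs, f0] at kx
  rw [dotProduct_rootVec_p, dotProduct_rootVec_p, e, f0, f1] at kp
  rw [dotProduct_rootVec_q, dotProduct_rootVec_q, e, sum_ofInt, fs, f2] at kq
  rw [e, fsq, ofInt_dotProduct] at hsq
  simp only [ofInt] at kx kp kq
  have kx' : ((4 * u ptInf + ∑ i, u i : ℤ) : ℝ) = ((-16 : ℤ) : ℝ) := by
    push_cast at kx ⊢; linarith
  have kp' : ((u ptInf + u ptZero : ℤ) : ℝ) = ((0 : ℤ) : ℝ) := by push_cast; linarith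
  have kq' : ((∑ i, u i - 4 * u ptOne : ℤ) : ℝ) = ((0 : ℤ) : ℝ) := by
    push_cast at kq ⊢; linarith
  exact mem_frameVecs h hu (by exact_mod_cast hsq) (by exact_mod_cast kp') (by exact_mod_cast kx')
    (by exact_mod_cast kq')

/-- The vectors `ν_∞`, `ν_0`, `ν_1`, `ν_Ω` are combinations of `X`, `P`, `Q` and `4 ν_0 - 4 ν_∞`. -/
theorem leechPart_nu_special (h : IsSteinerSystem 𝒮) {g : LorentzSpace ≃ₗ[ℝ] LorentzSpace}
    (hg : g ∈ autFixR 𝒮) (hf : leechPart g frameVec = frameVec) :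
    leechPart g (nu {ptInf}) = nu {ptInf} ∧ leechPart g (nu {ptZero}) = nu {ptZero} ∧
      leechPart g (nu {ptOne}) = nu {ptOne} ∧ leechPart g (nu univ) = nu univ := by
  have hX := leechPart_rootVec h hg (Sum.inl 0)
  have hP := leechPart_rootVec h hg (Sum.inr 0)
  have hQ := leechPart_rootVec h hg (Sum.inr 1)
  have eX : rootVec (Sum.inl 0) = (4 : ℝ) • nu {ptInf} + nu univ := rfl
  have eP : rootVec (Sum.inr 0) = (4 : ℝ) • nu {ptInf} + (4 : ℝ) • nu {ptZero} := rfl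
  have eQ : rootVec (Sum.inr 1) = nu univ - (4 : ℝ) • nu {ptOne} := rfl
  have h0 : nu {ptInf} = (8⁻¹ : ℝ) • (rootVec (Sum.inr 0) - frameVec) := by
    rw [eP, frameVec]; module
  have h1 : nu {ptZero} = (8⁻¹ : ℝ) • (rootVec (Sum.inr 0) + frameVec) := by
    rw [eP, frameVec]; module
  have g0 : leechPart g (nu {ptInf}) = nu {ptInf} := by rw [h0, map_smul, map_sub, hP, hf]
  have hu : nu univ = rootVec (Sum.inl 0) - (4 : ℝ) • nu {ptInf} := by rw [eX]; module
  have gu : leechPart g (nu univ) = nu univ := by rw [hu, map_sub, map_smul, hX, g0]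
  have h2 : nu {ptOne} = (4⁻¹ : ℝ) • (nu univ - rootVec (Sum.inr 1)) := by rw [eQ]; module
  refine ⟨g0, ?_, ?_, gu⟩
  · rw [h1, map_smul, map_add, hP, hf]
  · rw [h2, map_smul, map_sub, hQ, gu]

theorem nu_singleton_dotProduct (i : Omega) (v : Omega → ℝ) : nu {i} ⬝ᵥ v = v i := by
  rw [dotProduct_comm, dotProduct_nu, sum_singleton]

theorem ofInt_four_nuZ (i : Omega) : ofInt (4 • nuZ {i}) = (4 : ℝ) • nu {i} := by
  funext j
  simp only [ofInt, nu, nuZ, Pi.smul_apply]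
  split_ifs <;> norm_num

/-- The stabilizer of `4 ν_0 - 4 ν_∞` permutes the coordinate vectors: the image of `4 ν_∞ + 4 ν_i` is a
vector of norm `-4` with coordinate `4` at `∞`, and the sign of the other nonzero coordinate is
determined by the product with `ν_Ω`. -/
theorem leechPart_nu_singleton (h : IsSteinerSystem 𝒮) {g : LorentzSpace ≃ₗ[ℝ] LorentzSpace}
    (hg : g ∈ autFixR 𝒮) (hf : leechPart g frameVec = frameVec) (i : Omega) :
    ∃ j, leechPart g (nu {i}) = nu {j} := by
  obtain ⟨g0, -, -, gu⟩ := leechPart_nu_special h hg hf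
  by_cases hi : i = ptInf
  · exact ⟨ptInf, by rw [hi, g0]⟩
  obtain ⟨u, hu, e⟩ := exists_ofInt h (leechPart_mem hg (four_add_four_mem h ptInf i))
  have hi0 : nu {i} ptInf = 0 := nu_apply_ne (Ne.symm hi)
  have hsq := leechPart_dotProduct h hg ((4 : ℝ) • nu {ptInf} + (4 : ℝ) • nu {i})
    ((4 : ℝ) • nu {ptInf} + (4 : ℝ) • nu {i})
  have hco := leechPart_dotProduct h hg (nu {ptInf}) ((4 : ℝ) • nu {ptInf} + (4 : ℝ) • nu {i})
  rw [e, ofInt_dotProduct] at hsq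
  rw [g0, e, nu_singleton_dotProduct, nu_singleton_dotProduct] at hco
  simp only [dotProduct_add, add_dotProduct, smul_dotProduct, dotProduct_smul,
    nu_singleton_dotProduct, nu_apply_self, hi0, nu_apply_ne hi, smul_eq_mul] at hsq
  simp only [Pi.add_apply, Pi.smul_apply, nu_apply_self, hi0, smul_eq_mul, ofInt] at hco
  have hsq' : ((u ⬝ᵥ u : ℤ) : ℝ) = ((32 : ℤ) : ℝ) := by push_cast; linarith
  have hco' : ((u ptInf : ℤ) : ℝ) = ((4 : ℤ) : ℝ) := by push_cast; linarith
  obtain ⟨j, -, huj⟩ := four_coordinate h hu (by exact_mod_cast hsq') (by exact_mod_cast hco')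
  rw [map_add, map_smul, map_smul, g0] at e
  rcases huj with rfl | rfl
  · rw [ofInt_add, ofInt_four_nuZ, ofInt_four_nuZ] at e
    refine ⟨j, ?_⟩
    have := add_left_cancel e
    exact smul_right_injective _ (by norm_num : (4 : ℝ) ≠ 0) this
  · exfalso
    rw [sub_eq_add_neg, ofInt_add, ofInt_neg, ofInt_four_nuZ, ofInt_four_nuZ, ← smul_neg] at e
    have := smul_right_injective _ (by norm_num : (4 : ℝ) ≠ 0) (add_left_cancel e)
    have hs := leechPart_dotProduct h hg (nu {i}) (nu univ)
    rw [gu, this, neg_dotProduct, nu_singleton_dotProduct, nu_singleton_dotProduct, nu_univ_apply,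
      nu_univ_apply] at hs
    norm_num at hs

theorem nu_eq_sum (K : Finset Omega) : nu K = ∑ i ∈ K, nu {i} := by
  funext j
  rw [Finset.sum_apply]
  simp [nu]

theorem nu_injective : Function.Injective nu := by
  intro K L hKL
  refine vecI_injective ?_
  rw [vecI, vecI, hKL]

theorem leechPart_injective (h : IsSteinerSystem 𝒮) {g : LorentzSpace ≃ₗ[ℝ] LorentzSpace}
    (hg : g ∈ autFixR 𝒮) : Function.Injective (leechPart g) := by
  refine (injective_iff_map_eq_zero _).2 fun v hv => ?_
  have := leechPart_dotProduct h hg v v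
  rw [hv, zero_dotProduct] at this
  exact dotProduct_self_eq_zero.1 this.symm

/-- The elements that fix `4 ν_0 - 4 ν_∞` are given by automorphisms of the Steiner system. -/
theorem exists_perm (h : IsSteinerSystem 𝒮) {g : LorentzSpace ≃ₗ[ℝ] LorentzSpace}
    (hg : g ∈ autFixR 𝒮) (hf : leechPart g frameVec = frameVec) :
    ∃ σ : Equiv.Perm Omega, (∀ K, leechPart g (nu K) = nu (K.map σ.toEmbedding)) ∧
      σ ptInf = ptInf ∧ σ ptZero = ptZero ∧ σ ptOne = ptOne ∧
      ∀ K ∈ 𝒮, K.map σ.toEmbedding ∈ 𝒮 := by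
  choose f hfn using leechPart_nu_singleton h hg hf
  have hinj : Function.Injective f := by
    intro i j hij
    have : leechPart g (nu {i}) = leechPart g (nu {j}) := by rw [hfn, hfn, hij]
    exact singleton_injective (nu_injective (leechPart_injective h hg this))
  let σ : Equiv.Perm Omega := Equiv.ofBijective f (Finite.injective_iff_bijective.1 hinj)
  have hσ : ∀ i, σ i = f i := fun i => rfl
  have hK : ∀ K, leechPart g (nu K) = nu (K.map σ.toEmbedding) := by
    intro K
    rw [nu_eq_sum, map_sum, nu_eq_sum, sum_map]
    exact sum_congr rfl fun i _ => hfn i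
  have hfix : ∀ i, leechPart g (nu {i}) = nu {i} → σ i = i := by
    intro i hi
    rw [hfn] at hi
    exact singleton_injective (nu_injective hi)
  obtain ⟨g0, g1, g2, -⟩ := leechPart_nu_special h hg hf
  refine ⟨σ, hK, hfix _ g0, hfix _ g1, hfix _ g2, fun K hKS => ?_⟩
  refine h.mem_of_even (by rw [card_map, h.1 K hKS]) fun L hL => ?_
  obtain ⟨u, hu, e⟩ := exists_ofInt h (leechPart_mem hg (two_nu_mem hKS))
  rw [map_smul, hK, ← ofInt_two_nuZ] at e
  have := hu.2.2 L hL
  rw [← ofInt_injective e] at this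
  simp only [Pi.smul_apply, ← smul_sum] at this
  rw [sum_nuZ, nsmul_eq_mul] at this
  rw [Nat.even_iff]
  push_cast at this
  omega

theorem eq_one_of_leechPart (h : IsSteinerSystem 𝒮) {g : LorentzSpace ≃ₗ[ℝ] LorentzSpace}
    (hg : g ∈ autFixR 𝒮) (hid : ∀ v, leechPart g v = v) : g = 1 := by
  refine LinearEquiv.ext fun v => ?_
  obtain ⟨a, b, l⟩ := v
  rw [autFixR_apply h hg, hid]
  rfl

theorem eq_one_of_nu (h : IsSteinerSystem 𝒮) {g : LorentzSpace ≃ₗ[ℝ] LorentzSpace}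
    (hg : g ∈ autFixR 𝒮) (hid : ∀ i, leechPart g (nu {i}) = nu {i}) : g = 1 := by
  refine eq_one_of_leechPart h hg fun v => ?_
  have : v = ∑ i, v i • nu {i} := by
    funext j
    rw [Finset.sum_apply]
    simp [nu]
  rw [this, map_sum]
  exact sum_congr rfl fun i _ => by rw [map_smul, hid]

/-! ### The order of the stabilizer of `R` -/

/-- The orbit bound; the second part keeps track of finiteness, as infinite groups have cardinality
zero here. -/
theorem card_le_mul_card_stabilizer {G X : Type*} [Group G] [MulAction G X] (x : X) {T : Set X}
    (hT : T.Finite) (hGT : ∀ g : G, g • x ∈ T) :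
    Nat.card G ≤ T.ncard * Nat.card (MulAction.stabilizer G x) ∧
      (Nat.card (MulAction.stabilizer G x) ≠ 0 → Nat.card G ≠ 0) := by
  have hsub : MulAction.orbit G x ⊆ T := by rintro _ ⟨g, rfl⟩; exact hGT g
  have h1 := Subgroup.card_mul_index (MulAction.stabilizer G x)
  rw [MulAction.index_stabilizer] at h1
  have h2 := Set.ncard_le_ncard hsub hT
  constructor
  · rw [← h1, mul_comm]
    exact Nat.mul_le_mul_right _ h2
  · intro h0
    rw [← h1]
    refine mul_ne_zero h0 ?_
    exact Set.ncard_ne_zero_of_mem (MulAction.mem_orbit_self x) (hT.subset hsub)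

/-- An orbit of at most 162 frames, the stabilizer of a frame acting on 56 octads, and the stabilizer of
one of these octads acting on six points: together a bound for the order of the stabilizer of `R`. -/
theorem card_autFixR_le (h : IsSteinerSystem 𝒮) {O : Finset Omega} (hO : O ∈ octadsI 𝒮)
    (p : Fin 4 ↪ Omega) (hp : ∀ k, p k ∈ O \ {ptInf, ptZero})
    (hrigid : ∀ σ : Equiv.Perm Omega, (∀ K ∈ 𝒮, K.map σ.toEmbedding ∈ 𝒮) → σ ptInf = ptInf →
      σ ptZero = ptZero → σ ptOne = ptOne → O.map σ.toEmbedding = O → (∀ k, σ (p k) = p k) →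
      σ = 1) :
    Finite (autFixR 𝒮) ∧ Nat.card (autFixR 𝒮) ≤ 3265920 := by
  set G := autFixR 𝒮 with hG
  have hsmul : ∀ (g : G) (l : Omega → ℝ), g • leechRootOf l = leechRootOf (leechPart g.1 l) :=
    fun g l => autFixR_leechRootOf h g.2 l
  obtain ⟨a1, b1⟩ := card_le_mul_card_stabilizer (G := G) (leechRootOf frameVec)
    (T := leechRootOf '' (ofInt '' (frameVecs 𝒮 : Set (Omega → ℤ))))
    (((finite_toSet _).image _).image _)
    (fun g => ⟨_, leechPart_frameVec_mem h g.2, (hsmul g _).symm⟩)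
  -- `G1` is the stabilizer of the frame vector, `G2` below that of the frame vector and the octad `O`
  set G1 := MulAction.stabilizer G (leechRootOf frameVec) with hG1
  have hfr : ∀ g : G1, leechPart g.1.1 frameVec = frameVec := fun g =>
    leechRootOf_injective ((hsmul g.1 _).symm.trans g.2)
  have hfin : (leechRootOf '' (vecI '' octadsI 𝒮)).Finite :=
    ((Set.toFinite _).image _).image _
  obtain ⟨a2, b2⟩ := card_le_mul_card_stabilizer (G := G1) (leechRootOf (vecI O))
    (T := leechRootOf '' (vecI '' octadsI 𝒮)) hfin (fun g => by
      obtain ⟨σ, hσ, s0, s1, s2, hS⟩ := exists_perm h g.1.2 (hfr g)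
      refine ⟨vecI (O.map σ.toEmbedding), ⟨_, ⟨hS O hO.1, ?_, ?_, ?_⟩, rfl⟩, ?_⟩
      · rw [mem_map_equiv, σ.symm_apply_eq.2 s0.symm]; exact hO.2.1
      · rw [mem_map_equiv, σ.symm_apply_eq.2 s1.symm]; exact hO.2.2.1
      · rw [mem_map_equiv, σ.symm_apply_eq.2 s2.symm]; exact hO.2.2.2
      · refine Eq.trans ?_ (hsmul g.1 _).symm
        rw [vecI, vecI, map_smul, hσ])
  set G2 := MulAction.stabilizer G1 (leechRootOf (vecI O)) with hG2
  have hperm : ∀ g : G2, ∃ σ : Equiv.Perm Omega,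
      (∀ K, leechPart g.1.1.1 (nu K) = nu (K.map σ.toEmbedding)) ∧
      σ ptInf = ptInf ∧ σ ptZero = ptZero ∧ σ ptOne = ptOne ∧
      (∀ K ∈ 𝒮, K.map σ.toEmbedding ∈ 𝒮) ∧ O.map σ.toEmbedding = O := by
    intro g
    obtain ⟨σ, hσ, s0, s1, s2, hS⟩ := exists_perm h g.1.1.2 (hfr g.1)
    refine ⟨σ, hσ, s0, s1, s2, hS, ?_⟩
    have e : leechPart g.1.1.1 (vecI O) = vecI O :=
      leechRootOf_injective ((hsmul g.1.1 _).symm.trans g.2)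
    rw [vecI, map_smul, hσ] at e
    exact nu_injective (smul_right_injective _ (by norm_num : (2 : ℝ) ≠ 0) e)
  choose s hs s0 s1 s2 hsS hsO using hperm
  have hmem : ∀ g k, s g (p k) ∈ O \ {ptInf, ptZero} := by
    intro g k
    have hk := hp k
    rw [mem_sdiff, mem_insert, mem_singleton, not_or] at hk ⊢
    refine ⟨?_, ?_, ?_⟩
    · nth_rw 1 [← hsO g]
      exact mem_map_of_mem _ hk.1
    · intro e
      exact hk.2.1 ((s g).injective (e.trans (s0 g).symm))
    · intro e
      exact hk.2.2 ((s g).injective (e.trans (s1 g).symm))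
  -- `G2` embeds into the injections of four of the six points of `O \ {∞, 0}` into these six points
  let F : G2 → (Fin 4 ↪ {x // x ∈ O \ {ptInf, ptZero}}) := fun g =>
    ⟨fun k => ⟨s g (p k), hmem g k⟩, fun k l e =>
      p.injective ((s g).injective (congrArg Subtype.val e))⟩
  have hF : Function.Injective F := by
    intro g g' e
    have hmul : ∀ (a b : G2) (x : Omega), s (a * b) x = s a (s b x) := by
      intro a b x
      have h1 := hs (a * b) {x}
      have h2 : leechPart (a * b).1.1.1 (nu {x}) = leechPart a.1.1.1 (leechPart b.1.1.1 (nu {x})) := by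
        refine leechRootOf_injective ?_
        rw [← autFixR_leechRootOf h a.1.1.2, ← autFixR_leechRootOf h b.1.1.2,
          ← autFixR_leechRootOf h (a * b).1.1.2]
        rfl
      rw [h2, hs, hs, map_singleton, map_singleton, map_singleton] at h1
      exact (singleton_injective (nu_injective h1)).symm
    set k : G2 := g⁻¹ * g' with hk
    have hgk : g' = g * k := by rw [hk, mul_inv_cancel_left]
    have hone : s k = 1 := by
      refine hrigid _ (hsS k) (s0 k) (s1 k) (s2 k) (hsO k) fun i => ?_
      have : s g (p i) = s g' (p i) := congrArg Subtype.val (DFunLike.congr_fun e i)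
      rw [hgk, hmul] at this
      exact ((s g).injective this).symm
    have hk1 : k.1.1.1 = 1 := eq_one_of_nu h k.1.1.2 fun i => by
      rw [hs, hone, map_singleton]; rfl
    have : k = 1 := Subtype.ext (Subtype.ext (Subtype.ext hk1))
    rw [hgk, this, mul_one]
  have hfin2 : Finite G2 := Finite.of_injective F hF
  have hcard2 : Nat.card G2 ≤ 360 := by
    have h1 := Nat.card_le_card_of_injective F hF
    have h2 : Nat.card (Fin 4 ↪ {x // x ∈ O \ {ptInf, ptZero}}) = 360 := by
      have h3 : (O \ {ptInf, ptZero}).card = 6 := by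
        rw [card_sdiff_of_subset (by simp [insert_subset_iff, hO.2.1, hO.2.2.1]), h.1 O hO.1,
          card_pair ptInf_ne_ptZero]
      rw [Nat.card_eq_fintype_card, Fintype.card_embedding_eq, Fintype.card_coe, h3,
        Fintype.card_fin]
      rfl
    exact h1.trans h2.le
  have c1 : (leechRootOf '' (ofInt '' (frameVecs 𝒮 : Set (Omega → ℤ)))).ncard ≤ 162 := by
    rw [Set.ncard_image_of_injective _ leechRootOf_injective,
      Set.ncard_image_of_injective _ ofInt_injective, Set.ncard_coe_finset]
    exact card_frameVecs_le h
  have c2 : (leechRootOf '' (vecI '' octadsI 𝒮)).ncard = 56 := by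
    rw [Set.ncard_image_of_injective _ leechRootOf_injective, ncard_vecI h]
  rw [c2] at a2
  have hne : Nat.card G ≠ 0 := b1 (b2 Nat.card_pos.ne')
  refine ⟨Nat.finite_of_card_ne_zero hne, ?_⟩
  calc Nat.card G ≤ 162 * Nat.card G1 := a1.trans (Nat.mul_le_mul_right _ c1)
    _ ≤ 162 * (56 * 360) :=
      Nat.mul_le_mul_left _ (a2.trans (Nat.mul_le_mul_left _ hcard2))

/-! ### Sylvester's labelling of the points by duads and synthemes -/

/-- The three common points and the two points of a duad, among nine points labelled `0, …, 8`: the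
points `∞, 0, 1` have the labels `0, 1, 2`, the six other points of an octad through `∞` and `0` the
labels `3, …, 8`. The fifteen duads are in lexicographic order. -/
def duadPts : Fin 15 → Finset (Fin 9) :=
  ![{0, 1, 2, 3, 4}, {0, 1, 2, 3, 5}, {0, 1, 2, 3, 6}, {0, 1, 2, 3, 7}, {0, 1, 2, 3, 8}, {0, 1,
    2, 4, 5}, {0, 1, 2, 4, 6}, {0, 1, 2, 4, 7}, {0, 1, 2, 4, 8}, {0, 1, 2, 5, 6}, {0, 1, 2, 5,
    7}, {0, 1, 2, 5, 8}, {0, 1, 2, 6, 7}, {0, 1, 2, 6, 8}, {0, 1, 2, 7, 8}]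

/-- The fifteen synthemes, each as the three duads that it consists of. -/
def synthemeDuads : Fin 15 → Fin 3 → Fin 15 :=
  ![![0, 9, 14], ![0, 10, 13], ![0, 11, 12], ![1, 6, 14], ![1, 7, 13], ![1, 8, 12], ![2, 5, 14],
    ![2, 7, 11], ![2, 8, 10], ![3, 5, 13], ![3, 6, 11], ![3, 8, 9], ![4, 5, 12], ![4, 6, 10],
    ![4, 7, 9]]

/-- Seventeen octads that generate the Golay code, with the points labelled `∞, 0, 1`, the six other
points of an octad through `∞` and `0`, and the fifteen synthemes of these six points. The first
fifteen octads belong to the duads. -/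
def golayBase : Fin 17 → Finset (Fin 24) :=
  ![{0, 1, 2, 3, 4, 9, 10, 11}, {0, 1, 2, 3, 5, 12, 13, 14}, {0, 1, 2, 3, 6, 15, 16, 17}, {0, 1,
    2, 3, 7, 18, 19, 20}, {0, 1, 2, 3, 8, 21, 22, 23}, {0, 1, 2, 4, 5, 15, 18, 21}, {0, 1, 2, 4,
    6, 12, 19, 22}, {0, 1, 2, 4, 7, 13, 16, 23}, {0, 1, 2, 4, 8, 14, 17, 20}, {0, 1, 2, 5, 6, 9,
    20, 23}, {0, 1, 2, 5, 7, 10, 17, 22}, {0, 1, 2, 5, 8, 11, 16, 19}, {0, 1, 2, 6, 7, 11, 14,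
    21}, {0, 1, 2, 6, 8, 10, 13, 18}, {0, 1, 2, 7, 8, 9, 12, 15}, {0, 1, 3, 4, 5, 6, 7, 8}, {0,
    2, 3, 4, 5, 16, 20, 22}]

namespace IsSteinerSystem

/-- Octads with five common points, given by a labelling of points, are equal. -/
theorem eq_of_image (h : IsSteinerSystem 𝒮) {n : ℕ} {f : Fin n → Omega}
    (hf : Function.Injective f) {K L : Finset Omega} (hK : K ∈ 𝒮) (hL : L ∈ 𝒮) (T : Finset (Fin n))
    (hT : 5 ≤ T.card) (hTK : ∀ i ∈ T, f i ∈ K) (hTL : ∀ i ∈ T, f i ∈ L) : K = L := by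
  refine h.eq_of_five hK hL (hT.trans ?_)
  rw [← card_image_of_injective T hf]
  refine card_le_card fun x hx => ?_
  obtain ⟨i, hi, rfl⟩ := mem_image.1 hx
  exact mem_inter.2 ⟨hTK i hi, hTL i hi⟩

/-- Octads with four common labelled points and a common unlabelled point `y` are equal. -/
theorem eq_of_image_insert (h : IsSteinerSystem 𝒮) {n : ℕ} {f : Fin n → Omega}
    (hf : Function.Injective f) {K L : Finset Omega} (hK : K ∈ 𝒮) (hL : L ∈ 𝒮) (T : Finset (Fin n))
    (hT : 4 ≤ T.card) {y : Omega} (hy : ∀ i, y ≠ f i) (hTK : ∀ i ∈ T, f i ∈ K)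
    (hTL : ∀ i ∈ T, f i ∈ L) (hyK : y ∈ K) (hyL : y ∈ L) : K = L := by
  have hsub : insert y (T.image f) ⊆ K ∩ L := by
    refine insert_subset (mem_inter.2 ⟨hyK, hyL⟩) fun x hx => ?_
    obtain ⟨i, hi, rfl⟩ := mem_image.1 hx
    exact mem_inter.2 ⟨hTK i hi, hTL i hi⟩
  refine h.eq_of_five hK hL (le_trans ?_ (card_le_card hsub))
  rw [card_insert_of_notMem, card_image_of_injective _ hf]
  · omega
  · rw [mem_image]; rintro ⟨i, -, hi⟩; exact hy i hi.symm

theorem inter_eq_image (h : IsSteinerSystem 𝒮) {n : ℕ} {f : Fin n → Omega}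
    (hf : Function.Injective f) {K L : Finset Omega} (hK : K ∈ 𝒮) (hL : L ∈ 𝒮) (hne : K ≠ L)
    (T : Finset (Fin n)) (hT : T.card = 4) (hTK : ∀ i ∈ T, f i ∈ K) (hTL : ∀ i ∈ T, f i ∈ L) :
    K ∩ L = T.image f := by
  refine (eq_of_subset_of_card_le (fun x hx => ?_) ?_).symm
  · obtain ⟨i, hi, rfl⟩ := mem_image.1 hx
    exact mem_inter.2 ⟨hTK i hi, hTL i hi⟩
  · rw [card_image_of_injective T hf, hT]
    rcases h.card_inter hK hL hne with e | e | e <;> omega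

theorem exists_fourth (h : IsSteinerSystem 𝒮) {n : ℕ} {f : Fin n → Omega}
    (hf : Function.Injective f) {K L : Finset Omega} (hK : K ∈ 𝒮) (hL : L ∈ 𝒮) (hne : K ≠ L)
    (T : Finset (Fin n)) (hT : T.card = 3) (hTK : ∀ i ∈ T, f i ∈ K) (hTL : ∀ i ∈ T, f i ∈ L) :
    (K ∩ L).card = 4 ∧ ∃ w, w ∈ K ∧ w ∈ L ∧ ∀ i ∈ T, w ≠ f i := by
  have hsub : T.image f ⊆ K ∩ L := fun x hx => by
    obtain ⟨i, hi, rfl⟩ := mem_image.1 hx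
    exact mem_inter.2 ⟨hTK i hi, hTL i hi⟩
  have h3 : (T.image f).card = 3 := by rw [card_image_of_injective T hf, hT]
  have h4 : (K ∩ L).card = 4 := by
    have := card_le_card hsub
    rcases h.card_inter hK hL hne with e | e | e <;> omega
  obtain ⟨w, hw, hwT⟩ := exists_mem_notMem_of_card_lt_card (s := T.image f) (t := K ∩ L) (by omega)
  exact ⟨h4, w, (mem_inter.1 hw).1, (mem_inter.1 hw).2, fun i hi e =>
    hwT (mem_image.2 ⟨i, hi, e.symm⟩)⟩

theorem symmDiff_mem (h : IsSteinerSystem 𝒮) {K L : Finset Omega} (hK : K ∈ 𝒮) (hL : L ∈ 𝒮)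
    (h4 : (K ∩ L).card = 4) : symmDiff K L ∈ 𝒮 := by
  refine h.mem_of_even ?_ fun M hM =>
    even_card_inter_symmDiff (h.even_card_inter hM hK) (h.even_card_inter hM hL)
  have e1 := card_sdiff_add_card_inter K L
  have e2 := card_sdiff_add_card_inter L K
  rw [inter_comm L K] at e2
  rw [h.1 K hK] at e1
  rw [h.1 L hL] at e2
  rw [symmDiff_def, sup_eq_union, card_union_of_disjoint disjoint_sdiff_sdiff]
  omega

/-- The three octads of a syntheme have a point in common besides `∞, 0, 1`: the sum of two of them
and `O` is an octad again, which prevents that their fourth common point misses the third one. -/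
theorem exists_syntheme_point (h : IsSteinerSystem 𝒮) {f : Fin 9 → Omega}
    (hf : Function.Injective f) {O : Finset Omega} (hO : O ∈ 𝒮) (h2 : f 2 ∉ O)
    (hfO : ∀ i, i ≠ 2 → f i ∈ O) {L : Fin 15 → Finset Omega} (hL : ∀ d, L d ∈ 𝒮)
    (hfL : ∀ d i, f i ∈ L d ↔ i ∈ duadPts d) (s : Fin 15) :
    ∃ y, (∀ i, y ≠ f i) ∧ ∀ k, y ∈ L (synthemeDuads s k) := by
  have hOimg : ∀ y ∈ O, ∃ i, y = f i := by
    have : (univ.erase (2 : Fin 9)).image f = O := by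
      refine eq_of_subset_of_card_le (fun x hx => ?_) ?_
      · obtain ⟨i, hi, rfl⟩ := mem_image.1 hx
        exact hfO i (ne_of_mem_erase hi)
      · rw [card_image_of_injective _ hf, h.1 O hO]; decide
    intro y hy
    rw [← this] at hy
    obtain ⟨i, -, rfl⟩ := mem_image.1 hy
    exact ⟨i, rfl⟩
  have hneL : ∀ k l, k ≠ l → L (synthemeDuads s k) ≠ L (synthemeDuads s l) := by
    intro k l hkl e
    have : ∀ i, i ∈ duadPts (synthemeDuads s k) ↔ i ∈ duadPts (synthemeDuads s l) := fun i => by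
      rw [← hfL, ← hfL, e]
    exact (show ∀ s k l, k ≠ l → ¬ ∀ i, i ∈ duadPts (synthemeDuads s k) ↔
      i ∈ duadPts (synthemeDuads s l) by decide +kernel) s k l hkl this
  have hin : ∀ k : Fin 3, ∀ i ∈ ({0, 1, 2} : Finset (Fin 9)), f i ∈ L (synthemeDuads s k) :=
    fun k i hi => (hfL _ _).2 ((show ∀ d, ∀ i ∈ ({0, 1, 2} : Finset (Fin 9)), i ∈ duadPts d by
      decide +kernel) _ i hi)
  obtain ⟨-, y, y0, y2, hy⟩ := h.exists_fourth hf (hL _) (hL _) (hneL 0 2 (by decide)) {0, 1, 2}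
    (by decide) (hin 0) (hin 2)
  have hyf : ∀ i, y ≠ f i := by
    rintro i rfl
    refine hy i ?_ rfl
    rw [hfL] at y0 y2
    exact (show ∀ s i, i ∈ duadPts (synthemeDuads s 0) → i ∈ duadPts (synthemeDuads s 2) →
      i ∈ ({0, 1, 2} : Finset (Fin 9)) by decide +kernel) s i y0 y2
  have hyO : y ∉ O := fun hyO => by
    obtain ⟨i, hi⟩ := hOimg y hyO
    exact hyf i hi
  refine ⟨y, hyf, ?_⟩
  suffices y1 : y ∈ L (synthemeDuads s 1) by
    intro k
    fin_cases k
    exacts [y0, y1, y2]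
  by_contra y1
  obtain ⟨c01, -⟩ := h.exists_fourth hf (hL _) (hL _) (hneL 0 1 (by decide)) {0, 1, 2}
    (by decide) (hin 0) (hin 1)
  set A := L (synthemeDuads s 0) with hA
  set B := L (synthemeDuads s 1) with hB
  set C := L (synthemeDuads s 2) with hC
  have hD := h.symmDiff_mem (hL _) (hL _) c01
  have memD : ∀ i, f i ∈ symmDiff A B ↔ i ∈ symmDiff (duadPts (synthemeDuads s 0))
      (duadPts (synthemeDuads s 1)) := fun i => by
    rw [mem_symmDiff, mem_symmDiff, hA, hB, hfL, hfL]
  have hDO : symmDiff A B ≠ O := fun e => by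
    have : f 0 ∈ symmDiff A B := by rw [e]; exact hfO 0 (by decide)
    rw [memD] at this
    exact (show ∀ s, (0 : Fin 9) ∉ symmDiff (duadPts (synthemeDuads s 0))
      (duadPts (synthemeDuads s 1)) by decide +kernel) s this
  have hcard := (show ∀ s, (symmDiff (duadPts (synthemeDuads s 0))
    (duadPts (synthemeDuads s 1))).card = 4 by decide +kernel) s
  have c4 : (symmDiff A B ∩ O).card = 4 := by
    rw [h.inter_eq_image hf hD hO hDO (symmDiff (duadPts (synthemeDuads s 0))
      (duadPts (synthemeDuads s 1)))]
    · rw [card_image_of_injective _ hf, hcard]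
    · exact hcard
    · exact fun i hi => (memD i).2 hi
    · intro i hi
      refine hfO i ?_
      rintro rfl
      exact (show ∀ s, (2 : Fin 9) ∉ symmDiff (duadPts (synthemeDuads s 0))
        (duadPts (synthemeDuads s 1)) by decide +kernel) s hi
  have hE := h.symmDiff_mem hD hO c4
  have yE : y ∈ symmDiff (symmDiff A B) O :=
    mem_symmDiff.2 (Or.inl ⟨mem_symmDiff.2 (Or.inl ⟨y0, y1⟩), hyO⟩)
  have memE : ∀ i ∈ (duadPts (synthemeDuads s 2)).erase 2, f i ∈ symmDiff (symmDiff A B) O := by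
    intro i hi
    refine mem_symmDiff.2 (Or.inr ⟨hfO i (ne_of_mem_erase hi), ?_⟩)
    rw [memD]
    exact (show ∀ s, ∀ i ∈ (duadPts (synthemeDuads s 2)).erase 2, i ∉ symmDiff
      (duadPts (synthemeDuads s 0)) (duadPts (synthemeDuads s 1)) by decide +kernel) s i hi
  -- this octad and the octad `C` of the third duad share `y`, `∞`, `0` and the points of that duad
  have hEC : symmDiff (symmDiff A B) O = C := by
    refine h.eq_of_image_insert hf hE (hL _) ((duadPts (synthemeDuads s 2)).erase 2)
      ((show ∀ s, 4 ≤ ((duadPts (synthemeDuads s 2)).erase 2).card by decide +kernel) s) hyf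
      memE (fun i hi => (hfL _ _).2 (mem_of_mem_erase hi)) yE y2
  have f2C : f 2 ∈ C := hin 2 2 (by decide)
  rw [← hEC, mem_symmDiff, memD] at f2C
  rcases f2C with ⟨h3, -⟩ | ⟨h3, -⟩
  · exact (show ∀ s, (2 : Fin 9) ∉ symmDiff (duadPts (synthemeDuads s 0))
      (duadPts (synthemeDuads s 1)) by decide +kernel) s h3
  · exact h2 h3

/-- The points of an octad through `∞` and `0` but not `1` can be labelled such that the octad through
`∞, 1` and the first three of the others contains the point of the syntheme `{03 | 14 | 25}`. -/
theorem exists_hexad_labelling (h : IsSteinerSystem 𝒮) :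
    ∃ f : Fin 9 → Omega, Function.Injective f ∧ f 0 = ptInf ∧ f 1 = ptZero ∧ f 2 = ptOne ∧
      ∃ O ∈ 𝒮, f 2 ∉ O ∧ (∀ i, i ≠ 2 → f i ∈ O) ∧
      ∃ K ∈ 𝒮, ∃ A ∈ 𝒮, ∃ B ∈ 𝒮, ∃ y, (∀ i, y ≠ f i) ∧ y ∈ K ∧ y ∈ A ∧ y ∈ B ∧
      (∀ i ∈ ({0, 2, 3, 4, 5} : Finset (Fin 9)), f i ∈ K) ∧
      (∀ i ∈ ({0, 1, 2, 3, 6} : Finset (Fin 9)), f i ∈ A) ∧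
      ∀ i ∈ ({0, 1, 2, 4, 7} : Finset (Fin 9)), f i ∈ B := by
  have hne : (octadsI 𝒮).Nonempty := by
    rw [← Set.ncard_pos (Set.toFinite _), ncard_octadsI h]; norm_num
  obtain ⟨O, hO, hOi, hO0, hO1⟩ := hne
  have h6 : (O \ {ptInf, ptZero}).card = 6 := by
    rw [card_sdiff_of_subset (by simp [insert_subset_iff, hOi, hO0]), h.1 O hO,
      card_pair ptInf_ne_ptZero]
  set e := (O \ {ptInf, ptZero}).equivFinOfCardEq h6 with he
  have hemem : ∀ i, (e.symm i : Omega) ∈ O ∧ (e.symm i : Omega) ≠ ptInf ∧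
      (e.symm i : Omega) ≠ ptZero := fun i => by
    have := (e.symm i).2
    rw [mem_sdiff, mem_insert, mem_singleton, not_or] at this
    exact this
  let g : Fin 9 → Omega := Fin.append (m := 3) ![ptInf, ptZero, ptOne] fun i => (e.symm i : Omega)
  have hg : Function.Injective g := by
    refine Fin.append_injective_iff.2 ⟨?_, fun i j hij => e.symm.injective (Subtype.ext hij), ?_⟩
    · intro i j
      fin_cases i <;> fin_cases j <;>
        simp [ptInf_ne_ptZero, ptInf_ne_ptOne, ptZero_ne_ptOne, ptInf_ne_ptZero.symm,
          ptInf_ne_ptOne.symm, ptZero_ne_ptOne.symm]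
    · intro i j
      have := hemem j
      fin_cases i
      · exact this.2.1.symm
      · exact this.2.2.symm
      · exact fun e' => hO1 (by rw [show ptOne = (e.symm j : Omega) from e']; exact this.1)
  have g2 : g 2 ∉ O := hO1
  have hgO : ∀ i, i ≠ 2 → g i ∈ O := by
    intro i hi
    rcases (show ∀ i : Fin 9, i ≠ 2 → i = 0 ∨ i = 1 ∨ ∃ j : Fin 6, i = Fin.natAdd 3 j by
      decide) i hi with rfl | rfl | ⟨j, rfl⟩
    · exact hOi
    · exact hO0
    · rw [show g (Fin.natAdd 3 j) = e.symm j from Fin.append_right _ _ j]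
      exact (hemem j).1
  have hOimg : ∀ y ∈ O, ∃ i, y = g i := by
    have : (univ.erase (2 : Fin 9)).image g = O := by
      refine eq_of_subset_of_card_le (fun x hx => ?_) ?_
      · obtain ⟨i, hi, rfl⟩ := mem_image.1 hx
        exact hgO i (ne_of_mem_erase hi)
      · rw [card_image_of_injective _ hg, h.1 O hO]; decide
    intro y hy
    rw [← this] at hy
    obtain ⟨i, -, rfl⟩ := mem_image.1 hy
    exact ⟨i, rfl⟩
  have hoct : ∀ T : Finset (Fin 9), T.card ≤ 5 → ∃ K ∈ 𝒮, ∀ i ∈ T, g i ∈ K := by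
    intro T hT
    obtain ⟨K, hK, hTK⟩ := h.exists_octad (A := T.image g) (card_image_le.trans hT)
    exact ⟨K, hK, fun i hi => hTK (mem_image_of_mem g hi)⟩
  -- an octad through the label `2` differs from `O`
  have hmeet : ∀ T : Finset (Fin 9), T.card = 4 → 2 ∉ T → ∀ L ∈ 𝒮, (∀ i ∈ insert 2 T, g i ∈ L) →
      ∀ i, i ≠ 2 → g i ∈ L → i ∈ T := by
    intro T hT h2 L hL hTL i hi hiL
    have hne : L ≠ O := fun e => g2 (e ▸ hTL 2 (mem_insert_self _ _))
    have := h.inter_eq_image hg hL hO hne T hT (fun i hi => hTL i (mem_insert_of_mem hi))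
      (fun i hi => hgO i fun e => h2 (e ▸ hi))
    have hm : g i ∈ L ∩ O := mem_inter.2 ⟨hiL, hgO i hi⟩
    rw [this] at hm
    obtain ⟨j, hj, hji⟩ := mem_image.1 hm
    exact hg hji ▸ hj
  obtain ⟨K, hK, hgK⟩ := hoct {0, 2, 3, 4, 5} (by decide)
  obtain ⟨A, hA, hgA⟩ := hoct {0, 1, 2, 3, 6} (by decide)
  have hK' := hmeet {0, 3, 4, 5} (by decide) (by decide) K hK (by
    rwa [show insert 2 ({0, 3, 4, 5} : Finset (Fin 9)) = {0, 2, 3, 4, 5} by decide])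
  have hA' := hmeet {0, 1, 3, 6} (by decide) (by decide) A hA (by
    rwa [show insert 2 ({0, 1, 3, 6} : Finset (Fin 9)) = {0, 1, 2, 3, 6} by decide])
  have hAK : A ≠ K := fun e => by
    have := hK' 1 (by decide) (e ▸ hgA 1 (by decide))
    revert this; decide
  obtain ⟨-, y, hyA, hyK, hy⟩ := h.exists_fourth hg hA hK hAK {0, 2, 3} (by decide)
    (fun i hi => hgA i ((show ∀ i ∈ ({0, 2, 3} : Finset (Fin 9)), i ∈ ({0, 1, 2, 3, 6} :
      Finset (Fin 9)) by decide) i hi))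
    (fun i hi => hgK i ((show ∀ i ∈ ({0, 2, 3} : Finset (Fin 9)), i ∈ ({0, 2, 3, 4, 5} :
      Finset (Fin 9)) by decide) i hi))
  have hyg : ∀ i, y ≠ g i := by
    rintro i rfl
    by_cases hi : i = 2
    · exact hy 2 (by decide) (by rw [hi])
    · have h1 := hA' i hi hyA
      have h2 := hK' i hi hyK
      exact hy i ((show ∀ i ∈ ({0, 1, 3, 6} : Finset (Fin 9)), i ∈ ({0, 3, 4, 5} : Finset (Fin 9)) →
        i ∈ ({0, 2, 3} : Finset (Fin 9)) by decide) i h1 h2) rfl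
  obtain ⟨B, hB, hBT⟩ := h.exists_octad (A := {g 0, g 1, g 2, g 4, y}) card_le_five
  have hgB : ∀ i ∈ ({0, 1, 2, 4} : Finset (Fin 9)), g i ∈ B := by
    intro i hi
    refine hBT ?_
    simp only [mem_insert, mem_singleton] at hi ⊢
    rcases hi with rfl | rfl | rfl | rfl <;> simp
  have hyB : y ∈ B := hBT (by simp)
  have hBO : B ≠ O := fun e => g2 (e ▸ hgB 2 (by decide))
  obtain ⟨-, w, hwB, hwO, hw⟩ := h.exists_fourth hg hB hO hBO {0, 1, 4} (by decide)
    (fun i hi => hgB i ((show ∀ i ∈ ({0, 1, 4} : Finset (Fin 9)), i ∈ ({0, 1, 2, 4} :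
      Finset (Fin 9)) by decide) i hi))
    (fun i hi => hgO i ((show ∀ i ∈ ({0, 1, 4} : Finset (Fin 9)), i ≠ 2 by decide) i hi))
  obtain ⟨j, rfl⟩ := hOimg w hwO
  have hBA : B ≠ A := fun e => by
    have := hA' 4 (by decide) (e ▸ hgB 4 (by decide))
    revert this; decide
  have hBK : B ≠ K := fun e => by
    have := hK' 1 (by decide) (e ▸ hgB 1 (by decide))
    revert this; decide
  have hjA : j ∉ ({3, 6} : Finset (Fin 9)) := fun hj => hBA <| by
    refine h.eq_of_image_insert hg hB hA (insert j {0, 1, 2}) ?_ hyg ?_ ?_ hyB hyA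
    · exact (show ∀ j ∈ ({3, 6} : Finset (Fin 9)), 4 ≤ (insert j ({0, 1, 2} :
        Finset (Fin 9))).card by decide) j hj
    · intro i hi
      rcases mem_insert.1 hi with rfl | hi
      · exact hwB
      · exact hgB i ((show ∀ i ∈ ({0, 1, 2} : Finset (Fin 9)), i ∈ ({0, 1, 2, 4} :
          Finset (Fin 9)) by decide) i hi)
    · intro i hi
      exact hgA i ((show ∀ j ∈ ({3, 6} : Finset (Fin 9)), ∀ i ∈ insert j ({0, 1, 2} :
        Finset (Fin 9)), i ∈ ({0, 1, 2, 3, 6} : Finset (Fin 9)) by decide) j hj i hi)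
  have hjK : j ≠ 5 := by
    rintro rfl
    refine hBK (h.eq_of_image_insert hg hB hK {0, 2, 4, 5} (by decide) hyg ?_ ?_ hyB hyK)
    · intro i hi
      rcases (show ∀ i ∈ ({0, 2, 4, 5} : Finset (Fin 9)), i = 5 ∨ i ∈ ({0, 1, 2, 4} :
          Finset (Fin 9)) by decide) i hi with rfl | hi
      · exact hwB
      · exact hgB i hi
    · exact fun i hi => hgK i ((show ∀ i ∈ ({0, 2, 4, 5} : Finset (Fin 9)),
        i ∈ ({0, 2, 3, 4, 5} : Finset (Fin 9)) by decide) i hi)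
  have hj2 : j ≠ 2 := fun e => g2 (e ▸ hwO)
  have hj014 : j ∉ ({0, 1, 4} : Finset (Fin 9)) := fun hj => hw j hj rfl
  -- the octad `B` through `∞, 0, 1`, the second of the six points and `y` contains one of the last two
  have hj : j = 7 ∨ j = 8 := by
    clear_value g
    clear hwB hwO hw
    revert j; decide
  -- the labels `7` and `8` are exchanged if necessary
  let τ : Equiv.Perm (Fin 9) := if j = 7 then 1 else Equiv.swap 7 8
  have hτ : (∀ i : Fin 9, i ≠ 7 → i ≠ 8 → τ i = i) ∧ τ 7 = j := by
    rcases hj with rfl | rfl <;> decide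
  refine ⟨g ∘ τ, hg.comp τ.injective, ?_, ?_, ?_, O, hO, ?_, ?_, K, hK, A, hA, B, hB, y,
    fun i => hyg _, hyK, hyA, hyB, ?_, ?_, ?_⟩
  · exact congrArg g (hτ.1 0 (by decide) (by decide))
  · exact congrArg g (hτ.1 1 (by decide) (by decide))
  · exact congrArg g (hτ.1 2 (by decide) (by decide))
  · rwa [Function.comp_apply, hτ.1 2 (by decide) (by decide)]
  · intro i hi
    refine hgO _ fun e => hi (τ.injective (e.trans (hτ.1 2 (by decide) (by decide)).symm))
  · intro i hi
    obtain ⟨h7, h8⟩ := (show ∀ i ∈ ({0, 2, 3, 4, 5} : Finset (Fin 9)), i ≠ 7 ∧ i ≠ 8 by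
      decide) i hi
    rw [Function.comp_apply, hτ.1 i h7 h8]
    exact hgK i hi
  · intro i hi
    obtain ⟨h7, h8⟩ := (show ∀ i ∈ ({0, 1, 2, 3, 6} : Finset (Fin 9)), i ≠ 7 ∧ i ≠ 8 by
      decide) i hi
    rw [Function.comp_apply, hτ.1 i h7 h8]
    exact hgA i hi
  · intro i hi
    rcases (show ∀ i ∈ ({0, 1, 2, 4, 7} : Finset (Fin 9)), i = 7 ∨ i ≠ 7 ∧ i ≠ 8 ∧
      i ∈ ({0, 1, 2, 4} : Finset (Fin 9)) by decide) i hi with rfl | ⟨h7, h8, hi⟩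
    · rw [Function.comp_apply, hτ.2]; exact hwB
    · rw [Function.comp_apply, hτ.1 i h7 h8]; exact hgB i hi

end IsSteinerSystem

/-! ### A labelling of the points in which basic octads are known -/

/-- A labelling of the points for which the seventeen basic sets are octads. -/
structure GolayLabelling (𝒮 : Set (Finset Omega)) where
  toEquiv : Fin 24 ≃ Omega
  zero : toEquiv 0 = ptInf
  one : toEquiv 1 = ptZero
  two : toEquiv 2 = ptOne
  base_mem : ∀ k, (golayBase k).map toEquiv.toEmbedding ∈ 𝒮

/-- The first fifteen basic sets consist of `∞, 0, 1`, a duad, and the synthemes that contain it. -/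
theorem golayBase_duad_iff (d : Fin 15) (i : Fin 24) :
    i ∈ golayBase (Fin.castLE (by norm_num) d) ↔
      (∃ j ∈ duadPts d, i = Fin.castLE (by norm_num) j) ∨
      ∃ s k, synthemeDuads s k = d ∧ i = Fin.natAdd 9 s := by
  revert d i; decide +kernel

/-- The octads through `∞, 0, 1` and a duad contain the points of the synthemes through this duad, so
that these points label the remaining fifteen. The last basic octad is found by parity: it contains
six known points and meets the other basic octads in even sets. -/
theorem exists_golayLabelling (h : IsSteinerSystem 𝒮) : Nonempty (GolayLabelling 𝒮) := by
  obtain ⟨f, hf, f0, f1, f2, O, hO, f2O, hfO, K, hK, A, hA, B, hB, y, hyf, hyK, hyA, hyB, hfK, hfA,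
    hfB⟩ := h.exists_hexad_labelling
  have hL : ∀ d, ∃ L ∈ 𝒮, ∀ i ∈ duadPts d, f i ∈ L := by
    intro d
    obtain ⟨L, hL, hTL⟩ := h.exists_octad (A := (duadPts d).image f)
      (card_image_le.trans ((show ∀ d, (duadPts d).card ≤ 5 by decide +kernel) d))
    exact ⟨L, hL, fun i hi => hTL (mem_image_of_mem f hi)⟩
  choose L hL hLf using hL
  have hfL : ∀ d i, f i ∈ L d ↔ i ∈ duadPts d := by
    refine fun d i => ⟨fun hi => ?_, hLf d i⟩
    by_contra hid
    have : L d = O := by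
      refine h.eq_of_image hf (hL d) hO (insert i ((duadPts d).erase 2)) ?_ ?_ ?_
      · exact (show ∀ d i, i ∉ duadPts d → 5 ≤ (insert i ((duadPts d).erase 2)).card by
          decide +kernel) d i hid
      · intro j hj
        rcases mem_insert.1 hj with rfl | hj
        · exact hi
        · exact hLf d j (mem_of_mem_erase hj)
      · intro j hj
        refine hfO j ?_
        rintro rfl
        exact (show ∀ d i, i ∉ duadPts d → 2 ∉ (insert i ((duadPts d).erase 2)) by
          decide +kernel) d i hid hj
    exact f2O (this ▸ hLf d 2 ((show ∀ d, 2 ∈ duadPts d by decide +kernel) d))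
  choose Y hYf hYL using h.exists_syntheme_point hf hO f2O hfO hL hfL
  have hYY : Function.Injective Y := by
    intro s t hst
    by_contra hne
    -- different synthemes contain two duads that share just one point
    obtain ⟨k, l, hkl, hc⟩ := (show ∀ s t, s ≠ t → ∃ k l, duadPts (synthemeDuads s k) ≠
      duadPts (synthemeDuads t l) ∧ 4 ≤ (duadPts (synthemeDuads s k) ∩
        duadPts (synthemeDuads t l)).card by decide +kernel) s t hne
    have e : L (synthemeDuads s k) = L (synthemeDuads t l) :=
      h.eq_of_image_insert hf (hL _) (hL _) _ hc (hYf s)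
        (fun i hi => hLf _ i (mem_inter.1 hi).1) (fun i hi => hLf _ i (mem_inter.1 hi).2)
        (hYL s k) (by rw [hst]; exact hYL t l)
    refine hkl (Finset.ext fun i => ?_)
    rw [← hfL, ← hfL, e]
  let F : Fin 24 → Omega := Fin.append (m := 9) (n := 15) f Y
  have hF : Function.Injective F :=
    Fin.append_injective_iff.2 ⟨hf, hYY, fun i j => (hYf j i).symm⟩
  have hFl : ∀ i : Fin 9, F (Fin.castLE (by norm_num) i) = f i := fun i =>
    Fin.append_left (m := 9) (n := 15) f Y i
  have hFr : ∀ i : Fin 15, F (Fin.natAdd 9 i) = Y i := fun i =>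
    Fin.append_right (m := 9) (n := 15) f Y i
  let φ : Fin 24 ≃ Omega := Equiv.ofBijective F
    ((Fintype.bijective_iff_injective_and_card F).2 ⟨hF, by rw [IsSteinerSystem.card_omega, Fintype.card_fin]⟩)
  have hmap : ∀ (T : Finset (Fin 24)) (M : Finset Omega), M ∈ 𝒮 → T.card = 8 →
      (∀ i ∈ T, F i ∈ M) → T.map φ.toEmbedding ∈ 𝒮 := by
    intro T M hM hT hTM
    convert hM
    refine eq_of_subset_of_card_le (fun x hx => ?_) ?_
    · obtain ⟨i, hi, rfl⟩ := mem_map.1 hx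
      exact hTM i hi
    · rw [card_map, hT, h.1 M hM]
  have hcard := (show ∀ k, (golayBase k).card = 8 by decide +kernel)
  have hbase : ∀ k : Fin 16, (golayBase (Fin.castSucc k)).map φ.toEmbedding ∈ 𝒮 := by
    intro k
    refine Fin.lastCases ?_ (fun d => ?_) k
    · refine hmap _ O hO (hcard _) fun i hi => ?_
      obtain ⟨j, hj, rfl⟩ := (show ∀ i ∈ golayBase (Fin.castSucc (Fin.last 15)), ∃ j : Fin 9,
        j ≠ 2 ∧ i = Fin.castLE (by norm_num) j by decide +kernel) i hi
      rw [hFl]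
      exact hfO j hj
    · refine hmap _ (L d) (hL d) (hcard _) fun i hi => ?_
      rcases (golayBase_duad_iff d i).1 hi with ⟨j, hj, rfl⟩ | ⟨s, k, hs, rfl⟩
      · rw [hFl]; exact hLf d j hj
      · rw [hFr, ← hs]; exact hYL s k
  -- the point `y` belongs to the syntheme `{03 | 14 | 25}`, which has the label `16`
  have hAL : A = L 2 := h.eq_of_image hf hA (hL 2) {0, 1, 2, 3, 6} (by decide) hfA
    (fun i hi => hLf 2 i hi)
  have hBL : B = L 7 := h.eq_of_image hf hB (hL 7) {0, 1, 2, 4, 7} (by decide) hfB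
    (fun i hi => hLf 7 i hi)
  have hy7 : y = Y 7 := by
    by_contra hne
    have : L 2 = L 7 := by
      let f' : Fin 10 → Omega := Fin.cons (Y 7) f
      have hf' : Function.Injective f' :=
        Fin.cons_injective_iff.2 ⟨by rintro ⟨i, hi⟩; exact hYf 7 i hi.symm, hf⟩
      refine h.eq_of_image_insert hf' (hL 2) (hL 7) {0, 1, 2, 3} (by decide) (y := y) ?_ ?_ ?_
        (hAL ▸ hyA) (hBL ▸ hyB)
      · intro i
        refine Fin.cases hne (fun j => hyf j) i
      · intro i hi
        fin_cases hi
        exacts [hYL 7 0, hLf 2 0 (by decide), hLf 2 1 (by decide), hLf 2 2 (by decide)]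
      · intro i hi
        fin_cases hi
        exacts [hYL 7 1, hLf 7 0 (by decide), hLf 7 1 (by decide), hLf 7 2 (by decide)]
    have h3 := hLf 2 3 (by decide)
    rw [this, hfL] at h3
    revert h3; decide
  have hKsub : ∀ i ∈ ({0, 2, 3, 4, 5, 16} : Finset (Fin 24)), F i ∈ K := by
    intro i hi
    rcases (show ∀ i ∈ ({0, 2, 3, 4, 5, 16} : Finset (Fin 24)), i = Fin.natAdd 9 (7 : Fin 15) ∨
      ∃ j ∈ ({0, 2, 3, 4, 5} : Finset (Fin 9)), i = Fin.castLE (by norm_num) j by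
        decide +kernel) i hi with rfl | ⟨j, hj, rfl⟩
    · rw [hFr, ← hy7]; exact hyK
    · rw [hFl]; exact hfK j hj
  set K' := K.map φ.symm.toEmbedding with hK'
  have memK' : ∀ i, i ∈ K' ↔ F i ∈ K := fun i => by
    rw [hK', mem_map_equiv]; rfl
  have hmapK : K'.map φ.toEmbedding = K := by
    ext x
    rw [mem_map_equiv, memK']
    exact iff_of_eq (congrArg (· ∈ K) (φ.apply_symm_apply x))
  have hpar : ∀ k : Fin 16, Even (K' ∩ golayBase (Fin.castSucc k)).card := by
    intro k
    have := h.even_card_inter hK (hbase k)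
    rwa [← hmapK, ← map_inter, card_map] at this
  have hK8 : K'.card = 8 := by rw [hK', card_map, h.1 K hK]
  have hsub : ({0, 2, 3, 4, 5, 16} : Finset (Fin 24)) ⊆ K' := fun i hi => (memK' i).2 (hKsub i hi)
  obtain ⟨a, b, hab, hKab⟩ : ∃ a b, a < b ∧ K' = {0, 2, 3, 4, 5, 16} ∪ {a, b} := by
    have : (K' \ {0, 2, 3, 4, 5, 16}).card = 2 := by
      rw [card_sdiff_of_subset hsub, hK8]; rfl
    obtain ⟨a, b, hab, e⟩ := card_eq_two.1 this
    have e' : K' = {0, 2, 3, 4, 5, 16} ∪ {a, b} := by rw [← e, union_sdiff_of_subset hsub]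
    rcases lt_or_gt_of_ne hab with hlt | hlt
    · exact ⟨a, b, hlt, e'⟩
    · exact ⟨b, a, hlt, by rw [e', pair_comm a b]⟩
  refine ⟨φ, f0, f1, f2, Fin.lastCases ?_ hbase⟩
  have : golayBase (Fin.last 16) = K' := by
    rw [hKab] at hK8 hpar ⊢
    exact (show ∀ a b : Fin 24, a < b → ({0, 2, 3, 4, 5, 16} ∪ {a, b} : Finset (Fin 24)).card = 8 →
      (∀ k : Fin 16, Even (({0, 2, 3, 4, 5, 16} ∪ {a, b}) ∩ golayBase (Fin.castSucc k)).card) →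
      golayBase (Fin.last 16) = {0, 2, 3, 4, 5, 16} ∪ {a, b} by decide +kernel) a b hab hK8 hpar
  rw [this, hmapK]
  exact hK

/-! ### Consequences of the labelling -/

/-- The labelled octads `{03 | 14 | 25}, …` are rigid: a permutation that respects the octads and fixes
`∞, 0, 1` and four of the six other points of the octad `O` is trivial. It cannot exchange the last two
points, because the last basic octad would not be preserved, and once all six are fixed the synthemes
are fixed as well. -/
theorem GolayLabelling.rigid (φ : GolayLabelling 𝒮) (h : IsSteinerSystem 𝒮) (σ : Equiv.Perm Omega)
    (hσ : ∀ K ∈ 𝒮, K.map σ.toEmbedding ∈ 𝒮) (s0 : σ ptInf = ptInf) (s1 : σ ptZero = ptZero)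
    (s2 : σ ptOne = ptOne)
    (hO : ((golayBase 15).map φ.toEquiv.toEmbedding).map σ.toEmbedding =
      (golayBase 15).map φ.toEquiv.toEmbedding)
    (hp : ∀ k : Fin 4, σ (φ.toEquiv (Fin.castLE (by norm_num) (Fin.natAdd 3 k))) =
      φ.toEquiv (Fin.castLE (by norm_num) (Fin.natAdd 3 k))) : σ = 1 := by
  set f : Equiv.Perm (Fin 24) := (φ.toEquiv.trans σ).trans φ.toEquiv.symm with hf
  have hfσ : ∀ i, φ.toEquiv (f i) = σ (φ.toEquiv i) := fun i => by simp [hf]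
  have fix : ∀ i, σ (φ.toEquiv i) = φ.toEquiv i → f i = i := fun i hi =>
    φ.toEquiv.injective ((hfσ i).trans hi)
  have f7 : ∀ i : Fin 24, i.val < 7 → f i = i := by
    intro i hi
    rcases (show ∀ i : Fin 24, i.val < 7 → i = 0 ∨ i = 1 ∨ i = 2 ∨ ∃ k : Fin 4,
      i = Fin.castLE (by norm_num) (Fin.natAdd 3 k) by decide +kernel) i hi with
      rfl | rfl | rfl | ⟨k, rfl⟩
    · exact fix _ (by rw [φ.zero, s0])
    · exact fix _ (by rw [φ.one, s1])
    · exact fix _ (by rw [φ.two, s2])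
    · exact fix _ (hp k)
  have hfO : ∀ i ∈ golayBase 15, f i ∈ golayBase 15 := by
    intro i hi
    have : σ (φ.toEquiv i) ∈ (golayBase 15).map φ.toEquiv.toEmbedding := by
      nth_rw 1 [← hO]
      exact mem_map_of_mem _ (mem_map_of_mem _ hi)
    rw [← hfσ] at this
    exact (mem_map' _).1 this
  have key : ∀ (k l : Fin 17) (T : Finset (Fin 24)), 5 ≤ T.card → (∀ i ∈ T, i ∈ golayBase k) →
      (∀ i ∈ T, f i ∈ golayBase l) → ∀ i ∈ golayBase k, f i ∈ golayBase l := by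
    intro k l T hT hTk hTl i hi
    have e := h.eq_of_image (f := fun i => φ.toEquiv (f i)) (φ.toEquiv.injective.comp f.injective)
      (hσ _ (φ.base_mem k)) (φ.base_mem l) T hT
      (fun i hi => by
        show φ.toEquiv (f i) ∈ _
        rw [hfσ]; exact mem_map_of_mem _ (mem_map_of_mem _ (hTk i hi)))
      (fun i hi => mem_map_of_mem _ (hTl i hi))
    have : φ.toEquiv (f i) ∈ (golayBase l).map φ.toEquiv.toEmbedding := by
      rw [← e, hfσ]
      exact mem_map_of_mem _ (mem_map_of_mem _ hi)
    exact (mem_map' _).1 this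
  have hne : ∀ i j : Fin 24, j.val < 7 → ¬ i.val < 7 → f i ≠ j := by
    intro i j hj hi e
    have : i = j := f.injective (e.trans (f7 j hj).symm)
    exact hi (this ▸ hj)
  have h78 : ∀ i ∈ golayBase 15, ¬ i.val < 7 → f i = 7 ∨ f i = 8 := by
    intro i hi h7
    have h1 := hfO i hi
    have h2 : ¬ (f i).val < 7 := fun hlt => hne i _ hlt h7 rfl
    exact (show ∀ j ∈ golayBase 15, ¬ j.val < 7 → j = 7 ∨ j = 8 by decide +kernel) _ h1 h2
  -- the remaining two points of `O` are fixed or exchanged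
  rcases h78 7 (by decide) (by decide) with h7 | h7
  · have h8 : f 8 = 8 := by
      rcases h78 8 (by decide) (by decide) with h8 | h8
      · exact absurd (f.injective (h8.trans h7.symm)) (by decide)
      · exact h8
    have f9 : ∀ i : Fin 24, i.val < 9 → f i = i := by
      intro i hi
      rcases (show ∀ i : Fin 24, i.val < 9 → i.val < 7 ∨ i = 7 ∨ i = 8 by decide +kernel) i hi with
        hi | rfl | rfl
      exacts [f7 i hi, h7, h8]
    have hline : ∀ k : Fin 15, ∀ i ∈ golayBase (Fin.castLE (by norm_num) k),
        f i ∈ golayBase (Fin.castLE (by norm_num) k) := by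
      intro k
      have hT := (show ∀ k : Fin 15, 5 ≤ ((golayBase (Fin.castLE (by norm_num) k)).filter
        fun i => i.val < 9).card by decide +kernel) k
      refine key _ _ _ hT (fun i hi => (mem_filter.1 hi).1) fun i hi => ?_
      rw [f9 i (mem_filter.1 hi).2]
      exact (mem_filter.1 hi).1
    have fall : ∀ i, f i = i := by
      intro i
      by_cases hi : i.val < 9
      · exact f9 i hi
      · rcases (show ∀ i : Fin 24, ¬ i.val < 9 → ∀ j, (∀ k : Fin 15,
          i ∈ golayBase (Fin.castLE (by norm_num) k) → j ∈ golayBase (Fin.castLE (by norm_num) k)) →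
          j = i ∨ j.val < 7 by decide +kernel) i hi (f i) (fun k hk => hline k i hk) with e | e
        · exact e
        · exact absurd rfl (hne i (f i) e (by omega))
    refine Equiv.ext fun x => ?_
    obtain ⟨i, rfl⟩ := φ.toEquiv.surjective x
    rw [← hfσ, fall]; rfl
  · exfalso
    have h8 : f 8 = 7 := by
      rcases h78 8 (by decide) (by decide) with h8 | h8
      · exact h8
      · exact absurd (f.injective (h8.trans h7.symm)) (by decide)
    have step : ∀ (k l : Fin 17) (T : Finset (Fin 24)), 5 ≤ T.card → (∀ i ∈ T, i ∈ golayBase k) →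
        (∀ i ∈ T, (if i = 7 then 8 else if i = 8 then 7 else i) ∈ golayBase l) →
        (∀ i ∈ T, i.val < 9) → 16 ∈ golayBase k → f 16 ∈ golayBase l := by
      intro k l T hT hk hl h9 h16
      refine key k l T hT hk (fun i hi => ?_) 16 h16
      have := hl i hi
      split_ifs at this with e e
      · rw [e, h7]; exact this
      · rw [e, h8]; exact this
      · rwa [f7 i]
        rcases (show ∀ i : Fin 24, i.val < 9 → i.val < 7 ∨ i = 7 ∨ i = 8 by decide +kernel) i
          (h9 i hi) with hi | rfl | rfl
        exacts [hi, absurd rfl ‹¬ (7 : Fin 24) = 7›, absurd rfl ‹¬ (8 : Fin 24) = 8›]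
    -- if they are exchanged, the image of the point `16` lies in the octads with the numbers `16`, `2`
    -- and `8`, the last being the image of the octad with the number `7`, and there is no such point
    have a1 := step 16 16 {0, 2, 3, 4, 5} (by decide) (by decide) (by decide) (by decide) (by decide)
    have a2 := step 2 2 {0, 1, 2, 3, 6} (by decide) (by decide) (by decide) (by decide) (by decide)
    have a3 := step 7 8 {0, 1, 2, 4, 7} (by decide) (by decide) (by decide) (by decide) (by decide)
    have a4 : ¬ (f 16).val < 7 := fun hlt => hne 16 _ hlt (by decide) rfl
    exact a4 ((show ∀ j, j ∈ golayBase 16 → j ∈ golayBase 2 → j ∈ golayBase 8 → j.val < 7 by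
      decide +kernel) _ a1 a2 a3)

theorem card_autFixR_le_order (h : IsSteinerSystem 𝒮) :
    Finite (autFixR 𝒮) ∧ Nat.card (autFixR 𝒮) ≤ 3265920 := by
  obtain ⟨φ⟩ := exists_golayLabelling h
  refine card_autFixR_le h (O := (golayBase 15).map φ.toEquiv.toEmbedding) ⟨φ.base_mem 15, ?_, ?_, ?_⟩
    (⟨fun k => φ.toEquiv (Fin.castLE (by norm_num) (Fin.natAdd 3 k)), fun k l e => by
      simpa [Fin.ext_iff] using φ.toEquiv.injective e⟩) (fun k => ?_) (φ.rigid h)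
  · rw [← φ.zero]; exact mem_map_of_mem _ (by decide)
  · rw [← φ.one]; exact mem_map_of_mem _ (by decide)
  · rw [← φ.two]; exact fun hm => absurd ((mem_map' _).1 hm) (by decide)
  · rw [mem_sdiff, mem_insert, mem_singleton, not_or, ← φ.zero, ← φ.one]
    refine ⟨mem_map_of_mem _ ?_, fun e => ?_, fun e => ?_⟩
    · revert k; decide
    · exact absurd (φ.toEquiv.injective e) ((show ∀ k : Fin 4, Fin.castLE (by norm_num) (Fin.natAdd 3 k) ≠ (0 : Fin 24) by decide) k)
    · exact absurd (φ.toEquiv.injective e) ((show ∀ k : Fin 4, Fin.castLE (by norm_num) (Fin.natAdd 3 k) ≠ (1 : Fin 24) by decide) k)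

/-! ### The Leech lattice in the labelled coordinates -/

/-- The Leech lattice in labelled coordinates, described by the congruences of the seventeen basic
octads alone. -/
def golayLattice : AddSubgroup (Fin 24 → ℤ) where
  carrier := {u | (∀ i, 2 ∣ u i - u 0) ∧ 8 ∣ ∑ i, u i - 4 * u 0 ∧
    ∀ k, 4 ∣ ∑ i ∈ golayBase k, u i}
  zero_mem' := by simp
  add_mem' := by
    rintro u w ⟨h1, h2, h3⟩ ⟨k1, k2, k3⟩
    refine ⟨fun i => ?_, ?_, fun k => ?_⟩
    · have := dvd_add (h1 i) (k1 i)
      simpa [add_sub_add_comm] using this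
    · have := dvd_add h2 k2
      simpa [sum_add_distrib, mul_add, add_sub_add_comm] using this
    · simpa [sum_add_distrib] using dvd_add (h3 k) (k3 k)
  neg_mem' := by
    rintro u ⟨h1, h2, h3⟩
    refine ⟨fun i => ?_, ?_, fun k => ?_⟩
    · have e : (-u) i - (-u) 0 = -(u i - u 0) := by simp only [Pi.neg_apply]; ring
      rw [e]
      exact (h1 i).neg_right
    · have e : ∑ i, (-u) i - 4 * (-u) 0 = -(∑ i, u i - 4 * u 0) := by
        simp only [Pi.neg_apply, sum_neg_distrib]; ring
      rw [e]
      exact h2.neg_right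
    · simpa using h3 k

theorem mem_golayLattice {u : Fin 24 → ℤ} : u ∈ golayLattice ↔ (∀ i, 2 ∣ u i - u 0) ∧
    8 ∣ ∑ i, u i - 4 * u 0 ∧ ∀ k, 4 ∣ ∑ i ∈ golayBase k, u i := Iff.rfl

instance (u : Fin 24 → ℤ) : Decidable (u ∈ golayLattice) :=
  decidable_of_iff' _ mem_golayLattice

/-- Generators of the Leech lattice in labelled coordinates: `ν - 4 e₀`, the `2 ν_K` for the basic
octads, the `4 e_i - 4 e₀`, and `8 e₀`. -/
def golayGens : Unit ⊕ Fin 17 ⊕ Fin 24 ⊕ Unit → Fin 24 → ℤ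
  | Sum.inl _ => fun i => if i = 0 then -3 else 1
  | Sum.inr (Sum.inl k) => fun i => if i ∈ golayBase k then 2 else 0
  | Sum.inr (Sum.inr (Sum.inl j)) => fun i => (if i = j then 4 else 0) - if i = 0 then 4 else 0
  | Sum.inr (Sum.inr (Sum.inr _)) => fun i => if i = 0 then 8 else 0

/-- Rows of a matrix `P` over `𝔽₂`, as binary numbers. If `B` denotes the incidence matrix of the
basic octads, then `Bᵀ P + Q B = 1`. -/
def golayP : Fin 17 → ℕ :=
  ![1567, 12335, 9333, 4789, 254, 13833, 8239, 4143, 0, 1055, 543, 0, 0, 0, 0, 5, 3]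

/-- Rows of a matrix `Q` over `𝔽₂`, as binary numbers. If `B` denotes the incidence matrix of the
basic octads, then `Bᵀ P + Q B = 1`. -/
def golayQ : Fin 24 → ℕ :=
  ![0, 0, 0, 0, 0, 0, 0, 0, 32768, 0, 0, 1, 0, 0, 2, 33400, 99580, 67200, 33972, 66240, 99964,
    1772, 66176, 99452]

/-- The incidence matrix of the basic octads. -/
def golayB (k : Fin 17) (i : Fin 24) : ℤ := if i ∈ golayBase k then 1 else 0

/-- The coefficient with index `i` in the binary expansion of `n`. -/
def bitZ (n i : ℕ) : ℤ := if n.testBit i then 1 else 0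

/-- A certificate that the vectors orthogonal to the basic octads over `𝔽₂` are their combinations. -/
theorem golay_duality (i j : Fin 24) :
    2 ∣ (∑ k, golayB k i * bitZ (golayP k) j + ∑ k : Fin 17, bitZ (golayQ i) k * golayB k j) -
      if i = j then 1 else 0 := by
  revert i j; decide +kernel

theorem golayGens_mem (a) : golayGens a ∈ golayLattice := by
  rcases a with a | a | a | a
  · revert a; decide +kernel
  · revert a; decide +kernel
  · revert a; decide +kernel
  · revert a; decide +kernel

/-- A vector with coordinates divisible by four and of even quarter sum is a combination of the
generators `4 e_i - 4 e₀` and `8 e₀`. -/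
theorem four_smul_mem_closure (t : Fin 24 → ℤ) (ht : 2 ∣ ∑ i, t i) :
    (fun i => 4 * t i) ∈ AddSubgroup.closure (Set.range golayGens) := by
  obtain ⟨c, hc⟩ := ht
  have : (fun i => 4 * t i) = ∑ j, t j • golayGens (Sum.inr (Sum.inr (Sum.inl j))) +
      c • golayGens (Sum.inr (Sum.inr (Sum.inr ()))) := by
    funext i
    simp only [Pi.add_apply, Finset.sum_apply, Pi.smul_apply, smul_eq_mul, golayGens, mul_sub,
      sum_sub_distrib, ← sum_mul, hc]
    simp only [mul_ite, mul_zero, sum_ite_eq, mem_univ, if_true]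
    split_ifs <;> ring
  rw [this]
  exact add_mem (sum_mem fun j _ => zsmul_mem (AddSubgroup.subset_closure (Set.mem_range_self _)) _)
    (zsmul_mem (AddSubgroup.subset_closure (Set.mem_range_self _)) _)

/-- The even vectors of the lattice: by the duality of the Golay code, subtracting a combination of the
`2 ν_K` for basic octads leaves coordinates divisible by four. -/
theorem two_smul_mem_closure (w : Fin 24 → ℤ) (hw : (fun i => 2 * w i) ∈ golayLattice) :
    (fun i => 2 * w i) ∈ AddSubgroup.closure (Set.range golayGens) := by
  have hw3 := hw.2.2
  have hw3' : ∀ k, 2 ∣ ∑ j, golayB k j * w j := by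
    intro k
    have : ∑ i ∈ golayBase k, 2 * w i = 2 * ∑ j, golayB k j * w j := by
      rw [← mul_sum]
      simp [golayB]
    have h4 := hw3 k
    rw [this, show (4 : ℤ) = 2 * 2 by norm_num] at h4
    exact Int.dvd_of_mul_dvd_mul_left (by norm_num) h4
  set c : Fin 17 → ℤ := fun k => ∑ j : Fin 24, bitZ (golayP k) j * w j with hc
  have hdvd : ∀ i, 2 ∣ ∑ k, golayB k i * c k - w i := by
    intro i
    have h1 : 2 ∣ ∑ j : Fin 24, ((∑ k, golayB k i * bitZ (golayP k) j +
        ∑ k : Fin 17, bitZ (golayQ i) k * golayB k j) - if i = j then 1 else 0) * w j :=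
      dvd_sum fun j _ => (golay_duality i j).mul_right _
    have h2 : 2 ∣ ∑ k : Fin 17, bitZ (golayQ i) k * ∑ j, golayB k j * w j :=
      dvd_sum fun k _ => (hw3' k).mul_left _
    have e : ∑ j : Fin 24, ((∑ k, golayB k i * bitZ (golayP k) j +
        ∑ k : Fin 17, bitZ (golayQ i) k * golayB k j) - if i = j then 1 else 0) * w j =
        (∑ k, golayB k i * c k - w i) +
          ∑ k : Fin 17, bitZ (golayQ i) k * ∑ j, golayB k j * w j := by
      simp only [hc, sub_mul, add_mul, sum_sub_distrib, sum_add_distrib, sum_mul, mul_sum, ite_mul,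
        one_mul, zero_mul, sum_ite_eq, mem_univ, if_true]
      rw [sum_comm, sum_comm (f := fun (j : Fin 24) (k : Fin 17) => bitZ (golayQ i) k * golayB k j * w j)]
      simp only [mul_assoc]
      ring
    rw [e] at h1
    exact (dvd_add_left h2).1 h1
  choose t ht using hdvd
  have key : (fun i => 2 * w i) = ∑ k, c k • golayGens (Sum.inr (Sum.inl k)) +
      fun i => 4 * (-t) i := by
    funext i
    have h1 := ht i
    have h2 : (∑ k, c k • golayGens (Sum.inr (Sum.inl k))) i = 2 * ∑ k, golayB k i * c k := by
      rw [Finset.sum_apply, mul_sum]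
      refine sum_congr rfl fun k _ => ?_
      simp only [Pi.smul_apply, smul_eq_mul, golayGens, golayB]
      split_ifs <;> ring
    rw [Pi.add_apply, h2, Pi.neg_apply]
    linarith
  have hmem : ∑ k, c k • golayGens (Sum.inr (Sum.inl k)) ∈ golayLattice :=
    sum_mem fun k _ => zsmul_mem (golayGens_mem _) _
  have hmem' : (fun i => 4 * (-t) i) ∈ golayLattice := by
    rw [key] at hw
    exact (add_mem_cancel_left hmem).1 hw
  rw [key]
  refine add_mem (sum_mem fun k _ => zsmul_mem (AddSubgroup.subset_closure (Set.mem_range_self _)) _)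
    (four_smul_mem_closure _ ?_)
  have h8 := hmem'.2.1
  rw [← mul_sum] at h8
  have h0 : (fun i => 4 * (-t) i) 0 = 4 * (-t) 0 := rfl
  rw [h0] at h8
  omega

/-- The congruences of the basic octads already define the Leech lattice. -/
theorem golayLattice_le_closure {u : Fin 24 → ℤ} (hu : u ∈ golayLattice) :
    u ∈ AddSubgroup.closure (Set.range golayGens) := by
  have even_case : ∀ u ∈ golayLattice, 2 ∣ u 0 →
      u ∈ AddSubgroup.closure (Set.range golayGens) := by
    intro u hu h0
    have : ∀ i, 2 ∣ u i := fun i => by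
      have := dvd_add (hu.1 i) h0
      rwa [sub_add_cancel] at this
    choose w hw using this
    have e : u = fun i => 2 * w i := funext hw
    rw [e] at hu ⊢
    exact two_smul_mem_closure w hu
  by_cases h0 : 2 ∣ u 0
  · exact even_case u hu h0
  · have h1 := even_case (u - golayGens (Sum.inl ())) (sub_mem hu (golayGens_mem _)) (by
      rw [Pi.sub_apply, show golayGens (Sum.inl ()) 0 = -3 from rfl]; omega)
    have h2 := add_mem h1 (AddSubgroup.subset_closure (Set.mem_range_self (Sum.inl ())))
    rwa [sub_add_cancel] at h2

namespace GolayLabelling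

/-- The vector with given integral coordinates with respect to a labelling. -/
def vec (φ : GolayLabelling 𝒮) : (Fin 24 → ℤ) →+ (Omega → ℝ) where
  toFun u := ofInt (u ∘ φ.toEquiv.symm)
  map_zero' := by funext i; simp [ofInt]
  map_add' u w := by funext i; simp [ofInt]

theorem vec_apply (φ : GolayLabelling 𝒮) (u : Fin 24 → ℤ) (i : Fin 24) :
    φ.vec u (φ.toEquiv i) = u i := by simp [vec, ofInt]

theorem vec_eq (φ : GolayLabelling 𝒮) {u : Fin 24 → ℤ} {v : Omega → ℝ}
    (huv : ∀ i, v (φ.toEquiv i) = u i) : φ.vec u = v := by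
  funext x
  obtain ⟨i, rfl⟩ := φ.toEquiv.surjective x
  rw [vec_apply, huv]

theorem vec_gens_mem (φ : GolayLabelling 𝒮) (h : IsSteinerSystem 𝒮) (a) :
    φ.vec (golayGens a) ∈ leechLattice 𝒮 := by
  have hinj : ∀ i j, φ.toEquiv i = φ.toEquiv j ↔ i = j := fun i j => φ.toEquiv.injective.eq_iff
  rcases a with a | k | j | a
  · rw [φ.vec_eq (v := ofInt oddGen)]
    · exact ofInt_oddGen_mem
    · intro i
      rw [ofInt_oddGen, ← φ.zero]
      simp only [nu, golayGens, Pi.sub_apply, Pi.smul_apply, mem_univ, mem_singleton, hinj]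
      split_ifs <;> norm_num
  · rw [φ.vec_eq (v := (2 : ℝ) • nu ((golayBase k).map φ.toEquiv.toEmbedding))]
    · exact two_nu_mem (φ.base_mem k)
    · intro i
      have : φ.toEquiv i ∈ (golayBase k).map φ.toEquiv.toEmbedding ↔ i ∈ golayBase k :=
        mem_map' φ.toEquiv.toEmbedding
      simp only [nu, golayGens, Pi.smul_apply, this]
      split_ifs <;> norm_num
  · rw [φ.vec_eq (v := (4 : ℝ) • nu {φ.toEquiv j} - (4 : ℝ) • nu {φ.toEquiv 0})]
    · exact four_sub_four_mem h _ _
    · intro i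
      simp only [nu, golayGens, Pi.sub_apply, Pi.smul_apply, mem_singleton, hinj]
      split_ifs <;> norm_num
  · rw [φ.vec_eq (v := (8 : ℝ) • nu {φ.toEquiv 0})]
    · exact eight_mem h _
    · intro i
      simp only [nu, golayGens, Pi.smul_apply, mem_singleton, hinj]
      split_ifs <;> norm_num

theorem vec_mem (φ : GolayLabelling 𝒮) (h : IsSteinerSystem 𝒮) {u : Fin 24 → ℤ}
    (hu : u ∈ golayLattice) : φ.vec u ∈ leechLattice 𝒮 := by
  have hle : AddSubgroup.closure (Set.range golayGens) ≤ (leechLattice 𝒮).comap φ.vec := by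
    rw [AddSubgroup.closure_le]
    rintro _ ⟨a, rfl⟩
    exact φ.vec_gens_mem h a
  exact hle (golayLattice_le_closure hu)

theorem exists_vec (φ : GolayLabelling 𝒮) (h : IsSteinerSystem 𝒮) {v : Omega → ℝ}
    (hv : v ∈ leechLattice 𝒮) : ∃ u ∈ golayLattice, φ.vec u = v := by
  obtain ⟨w, ⟨w1, w2, w3⟩, rfl⟩ := exists_ofInt h hv
  refine ⟨w ∘ φ.toEquiv, ⟨fun i => ?_, ?_, fun k => ?_⟩, φ.vec_eq fun i => rfl⟩
  · rw [Function.comp_apply, Function.comp_apply, φ.zero]; exact w1 _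
  · rw [Function.comp_apply, φ.zero]
    convert w2 using 2
    exact φ.toEquiv.sum_comp w
  · have := w3 _ (φ.base_mem k)
    rwa [sum_map] at this

end GolayLabelling

/-! ### Isometries from matrices in labelled coordinates -/

/-- The Leech lattice is self-dual for the form `x · y / 8`; the generators test membership. -/
theorem exists_golayLattice_of_dvd (x : Fin 24 → ℤ) (hx : ∀ b, 32 ∣ golayGens b ⬝ᵥ x) :
    ∃ u ∈ golayLattice, x = 4 • u := by
  have h0 : 4 ∣ x 0 := by
    have := hx (Sum.inr (Sum.inr (Sum.inr ())))
    simp only [golayGens, dotProduct, ite_mul, zero_mul, sum_ite_eq', mem_univ, if_true] at this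
    omega
  have hj : ∀ j, 8 ∣ x j - x 0 := by
    intro j
    have := hx (Sum.inr (Sum.inr (Sum.inl j)))
    simp only [golayGens, dotProduct, sub_mul, ite_mul, zero_mul, sum_sub_distrib, sum_ite_eq',
      mem_univ, if_true] at this
    omega
  have h4 : ∀ j, ∃ c, x j = 4 * c := fun j => by
    have := hj j
    exact (show 4 ∣ x j by omega)
  choose u hu using h4
  have hxu : x = 4 • u := funext hu
  refine ⟨u, ⟨fun i => ?_, ?_, fun k => ?_⟩, hxu⟩
  · have := hj i
    rw [hu i, hu 0] at this
    omega
  · have := hx (Sum.inl ())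
    have e : golayGens (Sum.inl ()) ⬝ᵥ x = 4 * (∑ i, u i - 4 * u 0) := by
      have : ∀ i, golayGens (Sum.inl ()) i * x i = 4 * u i - if i = 0 then 16 * u i else 0 := by
        intro i
        rw [hu i]
        simp only [golayGens]
        split_ifs <;> ring
      rw [dotProduct, sum_congr rfl fun i _ => this i, sum_sub_distrib, sum_ite_eq', ← mul_sum]
      simp only [mem_univ, if_true]
      ring
    rw [e] at this
    omega
  · have := hx (Sum.inr (Sum.inl k))
    have e : golayGens (Sum.inr (Sum.inl k)) ⬝ᵥ x = 8 * ∑ i ∈ golayBase k, u i := by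
      simp only [golayGens, dotProduct, ite_mul, zero_mul]
      rw [← sum_filter, filter_mem_eq_inter, univ_inter, mul_sum]
      exact sum_congr rfl fun i _ => by rw [hu i]; ring
    rw [e] at this
    omega

/-- Four times an isometry of the labelled Leech lattice that fixes the Leech vectors of `R`. -/
structure IsLabelledIsometry (W : Matrix (Fin 24) (Fin 24) ℤ) : Prop where
  mul_transpose : W * Wᵀ = 16
  dvd : ∀ a b, 32 ∣ golayGens b ⬝ᵥ W *ᵥ golayGens a
  fix : ∀ u ∈ ({fun i => if i = 0 then 5 else 1, fun i => if i = 0 ∨ i = 1 then 4 else 0,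
    fun i => if i = 2 then -3 else 1} : Set (Fin 24 → ℤ)), W *ᵥ u = 4 • u

theorem IsLabelledIsometry.exists_image {W : Matrix (Fin 24) (Fin 24) ℤ}
    (hW : IsLabelledIsometry W) {u : Fin 24 → ℤ} (hu : u ∈ golayLattice) :
    ∃ u' ∈ golayLattice, W *ᵥ u = 4 • u' := by
  refine exists_golayLattice_of_dvd _ fun b => ?_
  replace hu := golayLattice_le_closure hu
  induction hu using AddSubgroup.closure_induction with
  | mem x hx => obtain ⟨a, rfl⟩ := hx; exact hW.dvd a b
  | zero => simp
  | add x y _ _ hx hy =>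
    rw [Matrix.mulVec_add, dotProduct_add]
    exact dvd_add hx hy
  | neg x _ hx => rw [Matrix.mulVec_neg, dotProduct_neg]; exact hx.neg_right

theorem IsLabelledIsometry.transpose {W : Matrix (Fin 24) (Fin 24) ℤ}
    (hW : IsLabelledIsometry W) : Wᵀ * W = 16 ∧ IsLabelledIsometry Wᵀ := by
  -- over `ℚ`, a right inverse of a square matrix is a left inverse
  have h1 : Wᵀ * W = 16 := by
    set M : Matrix (Fin 24) (Fin 24) ℚ := (1 / 4 : ℚ) • W.map (Int.castRingHom ℚ) with hM
    have e : ∀ A B : Matrix (Fin 24) (Fin 24) ℤ,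
        ((1 / 4 : ℚ) • A.map (Int.castRingHom ℚ)) * ((1 / 4 : ℚ) • B.map (Int.castRingHom ℚ)) =
          (1 / 16 : ℚ) • (A * B).map (Int.castRingHom ℚ) := by
      intro A B
      rw [Matrix.smul_mul, Matrix.mul_smul, smul_smul, Matrix.map_mul]
      norm_num
    have h16 : (1 / 16 : ℚ) • (16 : Matrix (Fin 24) (Fin 24) ℤ).map (Int.castRingHom ℚ) = 1 := by
      ext i j
      by_cases hij : i = j <;> simp [Matrix.ofNat_apply, Matrix.one_apply, hij]
    have h2 : ((1 / 4 : ℚ) • W.map (Int.castRingHom ℚ)) *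
        ((1 / 4 : ℚ) • Wᵀ.map (Int.castRingHom ℚ)) = 1 := by
      rw [e, hW.mul_transpose, h16]
    rw [mul_eq_one_comm, e, ← h16] at h2
    have h3 := smul_right_injective _ (by norm_num : (1 / 16 : ℚ) ≠ 0) h2
    exact Matrix.map_injective Int.cast_injective h3
  refine ⟨h1, ⟨by rw [Matrix.transpose_transpose]; exact h1, fun a b => ?_, fun u hu => ?_⟩⟩
  · rw [Matrix.mulVec_transpose, dotProduct_comm, ← Matrix.dotProduct_mulVec]
    exact hW.dvd b a
  · have h2 : Wᵀ *ᵥ (W *ᵥ u) = 16 • u := by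
      rw [Matrix.mulVec_mulVec, h1]
      exact Matrix.ofNat_mulVec 16 u
    rw [hW.fix u hu, Matrix.mulVec_smul] at h2
    refine smul_right_injective _ (by norm_num : (4 : ℕ) ≠ 0) (h2.trans ?_)
    simp only [smul_smul]
    norm_num

namespace GolayLabelling

/-- A quarter of an integral matrix in labelled coordinates, as an endomorphism of `ℝ^Ω`. -/
def lin (φ : GolayLabelling 𝒮) (W : Matrix (Fin 24) (Fin 24) ℤ) :
    (Omega → ℝ) →ₗ[ℝ] (Omega → ℝ) :=
  (1 / 4 : ℝ) • LinearMap.funLeft ℝ ℝ φ.toEquiv.symm ∘ₗ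
    (W.map (Int.castRingHom ℝ)).mulVecLin ∘ₗ LinearMap.funLeft ℝ ℝ φ.toEquiv

theorem lin_apply (φ : GolayLabelling 𝒮) (W : Matrix (Fin 24) (Fin 24) ℤ) (v : Omega → ℝ) :
    φ.lin W v = (1 / 4 : ℝ) •
      ((W.map (Int.castRingHom ℝ) *ᵥ (v ∘ φ.toEquiv)) ∘ φ.toEquiv.symm) := rfl

theorem lin_vec (φ : GolayLabelling 𝒮) {W : Matrix (Fin 24) (Fin 24) ℤ} {u u' : Fin 24 → ℤ}
    (hu : W *ᵥ u = 4 • u') : φ.lin W (φ.vec u) = φ.vec u' := by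
  refine (φ.vec_eq fun i => ?_).symm
  have h1 : φ.vec u ∘ φ.toEquiv = fun i => ((u i : ℤ) : ℝ) := funext fun i => φ.vec_apply u i
  have h2 : (W.map (Int.castRingHom ℝ) *ᵥ fun i => ((u i : ℤ) : ℝ)) i = ((W *ᵥ u) i : ℤ) := by
    simp [Matrix.mulVec, dotProduct]
  rw [lin_apply, h1, Pi.smul_apply, Function.comp_apply, Equiv.symm_apply_apply, h2, hu]
  simp

theorem lin_lin (φ : GolayLabelling 𝒮) {W W' : Matrix (Fin 24) (Fin 24) ℤ} (hW : W * W' = 16)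
    (v : Omega → ℝ) : φ.lin W (φ.lin W' v) = v := by
  have h1 : W.map (Int.castRingHom ℝ) * W'.map (Int.castRingHom ℝ) = 16 := by
    rw [← Matrix.map_mul, hW]
    ext i j
    by_cases hij : i = j <;> simp [Matrix.ofNat_apply, hij]
  rw [lin_apply, lin_apply]
  have h2 : ((1 / 4 : ℝ) • ((W'.map (Int.castRingHom ℝ) *ᵥ (v ∘ φ.toEquiv)) ∘ φ.toEquiv.symm)) ∘
      φ.toEquiv = (1 / 4 : ℝ) • (W'.map (Int.castRingHom ℝ) *ᵥ (v ∘ φ.toEquiv)) := by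
    funext i; simp
  rw [h2, Matrix.mulVec_smul, Matrix.mulVec_mulVec, h1]
  funext x
  simp [Matrix.ofNat_mulVec]
  ring

theorem lin_dotProduct (φ : GolayLabelling 𝒮) {W : Matrix (Fin 24) (Fin 24) ℤ} (v w : Omega → ℝ) :
    φ.lin W v ⬝ᵥ w = v ⬝ᵥ φ.lin Wᵀ w := by
  have e : ∀ x y : Omega → ℝ, x ⬝ᵥ y = (x ∘ φ.toEquiv) ⬝ᵥ (y ∘ φ.toEquiv) := fun x y =>
    (φ.toEquiv.sum_comp fun i => x i * y i).symm
  have e2 : ∀ (W : Matrix (Fin 24) (Fin 24) ℤ) v, φ.lin W v ∘ φ.toEquiv =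
      (1 / 4 : ℝ) • (W.map (Int.castRingHom ℝ) *ᵥ (v ∘ φ.toEquiv)) := by
    intro W v; funext i; simp [lin_apply]
  rw [e, e v, e2, e2, smul_dotProduct, dotProduct_smul, Matrix.transpose_map, Matrix.mulVec_transpose,
    dotProduct_comm, Matrix.dotProduct_mulVec, dotProduct_comm (v ∘ _)]

/-- The linear automorphism of `(U ⊕ Λ) ⊗ ℝ` that extends an isometry in labelled coordinates by the
identity of `U`. -/
def lorentzEquiv (φ : GolayLabelling 𝒮) {W : Matrix (Fin 24) (Fin 24) ℤ}
    (hW : IsLabelledIsometry W) : LorentzSpace ≃ₗ[ℝ] LorentzSpace :=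
  (LinearEquiv.refl ℝ ℝ).prodCongr ((LinearEquiv.refl ℝ ℝ).prodCongr
    (LinearEquiv.ofLinearMap (φ.lin W) (φ.lin Wᵀ)
      (LinearMap.ext fun v => φ.lin_lin hW.mul_transpose v)
      (LinearMap.ext fun v => φ.lin_lin hW.transpose.1 v)))

theorem lorentzEquiv_apply (φ : GolayLabelling 𝒮) {W : Matrix (Fin 24) (Fin 24) ℤ}
    (hW : IsLabelledIsometry W) (a b : ℝ) (v : Omega → ℝ) :
    φ.lorentzEquiv hW (a, b, v) = (a, b, φ.lin W v) := rfl

theorem rootVec_eq_vec (φ : GolayLabelling 𝒮) (i : Fin 2 ⊕ Fin 2) : rootVec i = 0 ∨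
    ∃ u ∈ ({fun i => if i = 0 then 5 else 1, fun i => if i = 0 ∨ i = 1 then 4 else 0,
      fun i => if i = 2 then -3 else 1} : Set (Fin 24 → ℤ)), φ.vec u = rootVec i := by
  have hinj : ∀ i j, φ.toEquiv i = φ.toEquiv j ↔ i = j := fun i j => φ.toEquiv.injective.eq_iff
  rcases i with i | i <;> fin_cases i
  · refine Or.inr ⟨_, Or.inl rfl, φ.vec_eq fun i => ?_⟩
    simp only [rootVec, nu, ← φ.zero, Sum.elim_inl, Pi.add_apply, Pi.smul_apply,
      mem_univ, mem_singleton, hinj, Fin.zero_eta, Matrix.cons_val_zero]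
    split_ifs <;> norm_num
  · exact Or.inl rfl
  · refine Or.inr ⟨_, Or.inr (Or.inl rfl), φ.vec_eq fun i => ?_⟩
    simp only [rootVec, nu, ← φ.zero, ← φ.one, Sum.elim_inr, Pi.add_apply, Pi.smul_apply,
      mem_singleton, hinj, Fin.zero_eta, Matrix.cons_val_zero]
    by_cases h0 : i = 0
    · subst h0; norm_num
    · by_cases h1 : i = 1
      · subst h1; norm_num
      · simp [h0, h1]
  · refine Or.inr ⟨_, Or.inr (Or.inr rfl), φ.vec_eq fun i => ?_⟩
    simp only [rootVec, nu, ← φ.two, Sum.elim_inr, Pi.sub_apply, Pi.smul_apply,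
      mem_univ, mem_singleton, hinj, Fin.mk_one, Matrix.cons_val_one, Matrix.cons_val_fin_one]
    split_ifs <;> norm_num

theorem lorentzEquiv_mem (φ : GolayLabelling 𝒮) (h : IsSteinerSystem 𝒮)
    {W : Matrix (Fin 24) (Fin 24) ℤ} (hW : IsLabelledIsometry W) :
    φ.lorentzEquiv hW ∈ autFixR 𝒮 := by
  have hlat : ∀ {W : Matrix (Fin 24) (Fin 24) ℤ}, IsLabelledIsometry W → ∀ v ∈ leechLattice 𝒮,
      φ.lin W v ∈ leechLattice 𝒮 := by
    intro W hW v hv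
    obtain ⟨u, hu, rfl⟩ := φ.exists_vec h hv
    obtain ⟨u', hu', e⟩ := hW.exists_image hu
    rw [φ.lin_vec e]
    exact φ.vec_mem h hu'
  have hdot : ∀ v w, φ.lin W v ⬝ᵥ φ.lin W w = v ⬝ᵥ w := fun v w => by
    rw [lin_dotProduct, φ.lin_lin hW.transpose.1]
  refine mem_autFixR ⟨fun v w => ?_, ?_⟩ ?_ fun i => ?_
  · obtain ⟨a, b, v⟩ := v
    obtain ⟨c, d, w⟩ := w
    simp only [lorentzEquiv_apply, lorentzForm, leechForm_eq, hdot]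
  · refine Set.Subset.antisymm ?_ ?_
    · rintro _ ⟨⟨a, b, v⟩, ⟨ha, hb, hv⟩, rfl⟩
      exact ⟨ha, hb, hlat hW v hv⟩
    · rintro ⟨a, b, v⟩ ⟨ha, hb, hv⟩
      refine ⟨(a, b, φ.lin Wᵀ v), ⟨ha, hb, hlat hW.transpose.2 v hv⟩, ?_⟩
      exact congrArg (fun v => (a, b, v)) (φ.lin_lin hW.mul_transpose v)
  · exact congrArg (fun v => ((1 : ℝ), (0 : ℝ), v)) (map_zero (φ.lin W))
  · rw [rootBasis_eq, leechRootOf]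
    refine congrArg (fun w : Omega → ℝ => ((-1 - leechForm (rootVec i) (rootVec i) / 2, 1, w) :
      LorentzSpace)) (?_ : φ.lin W (rootVec i) = rootVec i)
    rcases φ.rootVec_eq_vec i with e | ⟨u, hu, e⟩
    · rw [e, map_zero]
    · rw [← e, φ.lin_vec (hW.fix u hu)]

theorem lorentzEquiv_leechRootOf (φ : GolayLabelling 𝒮) (h : IsSteinerSystem 𝒮)
    {W : Matrix (Fin 24) (Fin 24) ℤ} (hW : IsLabelledIsometry W) {u u' : Fin 24 → ℤ}
    (hu : W *ᵥ u = 4 • u') :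
    φ.lorentzEquiv hW (leechRootOf (φ.vec u)) = leechRootOf (φ.vec u') := by
  rw [autFixR_leechRootOf h (φ.lorentzEquiv_mem h hW)]
  exact congrArg leechRootOf (φ.lin_vec hu)

end GolayLabelling

/-! ### The roots orthogonal to `R` span its complement -/

/-- A vector orthogonal to `R` and to the Leech roots orthogonal to `R` vanishes. The octads through
`∞`, `0` and a further point, but not `1`, contain this point 16 times and each other point four
times, so that the coordinates outside `∞, 0, 1` are equal, and then zero. -/
theorem eq_zero_of_dotProduct_eq_zero (h : IsSteinerSystem 𝒮) {y : Omega → ℝ}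
    (hR : ∀ i, rootVec i ⬝ᵥ y = 0) (hy : ∀ K ∈ octadsI 𝒮, ∑ i ∈ K, y i = 0) : y = 0 := by
  have hX := hR (Sum.inl 0)
  have hP := hR (Sum.inr 0)
  have hQ := hR (Sum.inr 1)
  rw [dotProduct_comm, dotProduct_rootVec_x] at hX
  rw [dotProduct_comm, dotProduct_rootVec_p] at hP
  rw [dotProduct_comm, dotProduct_rootVec_q] at hQ
  have count : ∀ B : Finset Omega, ∑ K ∈ IsSteinerSystem.above 𝒮 B, ∑ i ∈ K, y i =
      ∑ i, ((IsSteinerSystem.above 𝒮 (insert i B)).card : ℝ) * y i := by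
    intro B
    have e : ∀ K : Finset Omega, ∑ i ∈ K, y i = ∑ i, if i ∈ K then y i else 0 := fun K => by simp
    rw [sum_congr rfl fun K _ => e K, sum_comm]
    refine sum_congr rfl fun i _ => ?_
    rw [← sum_filter, sum_const, IsSteinerSystem.filter_above, nsmul_eq_mul]
  have hsplit : ∀ B : Finset Omega, ptInf ∈ B → ptZero ∈ B →
      ∑ K ∈ IsSteinerSystem.above 𝒮 B, ∑ i ∈ K, y i =
        ∑ K ∈ IsSteinerSystem.above 𝒮 (insert ptOne B), ∑ i ∈ K, y i := by
    intro B h0 h1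
    refine (sum_subset (fun K hK => ?_) fun K hK hK' => ?_).symm
    · rw [IsSteinerSystem.mem_above] at hK ⊢
      exact ⟨hK.1, (subset_insert _ _).trans hK.2⟩
    · rw [IsSteinerSystem.mem_above] at hK hK'
      refine hy K ⟨hK.1, hK.2 h0, hK.2 h1, fun h2 => hK' ⟨hK.1, insert_subset h2 hK.2⟩⟩
  set T : Finset Omega := {ptInf, ptZero, ptOne} with hT
  have hS : ∑ i, y i = ∑ i ∈ univ \ T, y i + (y ptInf + y ptZero + y ptOne) := by
    rw [← sum_sdiff (subset_univ T)]
    congr 1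
    rw [hT, sum_insert (by simp [ptInf_ne_ptZero, ptInf_ne_ptOne]), sum_pair ptZero_ne_ptOne]
    ring
  set S := ∑ i ∈ univ \ T, y i with hSdef
  have hx : ∀ x ∉ T, 12 * y x = -4 * S := by
    intro x hxT
    have hx' : x ≠ ptInf ∧ x ≠ ptZero ∧ x ≠ ptOne := by simpa [hT] using hxT
    obtain ⟨x0, x1, x2⟩ := hx'
    have key := hsplit {ptInf, ptZero, x} (by simp) (by simp)
    rw [count, count, ← sub_eq_zero, ← sum_sub_distrib] at key
    have c3 : ({ptInf, ptZero, x} : Finset Omega).card = 3 :=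
      card_eq_three.2 ⟨_, _, _, ptInf_ne_ptZero, x0.symm, x1.symm, rfl⟩
    have c4 : (insert ptOne {ptInf, ptZero, x} : Finset Omega).card = 4 := by
      rw [card_insert_of_notMem, c3]
      simp [ptInf_ne_ptOne.symm, ptZero_ne_ptOne.symm, x2.symm]
    have term : ∀ i, ((IsSteinerSystem.above 𝒮 (insert i {ptInf, ptZero, x})).card : ℝ) * y i -
        ((IsSteinerSystem.above 𝒮 (insert i (insert ptOne {ptInf, ptZero, x}))).card : ℝ) * y i =
        4 * y i + (if i = ptInf then 12 * y i else 0) + (if i = ptZero then 12 * y i else 0) +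
          (if i = x then 12 * y i else 0) - (if i = ptOne then 4 * y i else 0) := by
      intro i
      by_cases i2 : i = ptOne
      · have m1 : i ∈ insert ptOne ({ptInf, ptZero, x} : Finset Omega) := by simp [i2]
        have e1 : insert i ({ptInf, ptZero, x} : Finset Omega) = insert ptOne {ptInf, ptZero, x} := by
          rw [i2]
        rw [insert_eq_of_mem m1, e1, if_neg (by rw [i2]; exact ptInf_ne_ptOne.symm),
          if_neg (by rw [i2]; exact ptZero_ne_ptOne.symm), if_neg (by rw [i2]; exact x2.symm),
          if_pos i2]
        ring
      · by_cases m : i ∈ ({ptInf, ptZero, x} : Finset Omega)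
        · rw [insert_eq_of_mem m, insert_eq_of_mem (mem_insert_of_mem m), h.card_above_three c3,
            h.card_above_four c4, if_neg i2]
          have m' : i = ptInf ∨ i = ptZero ∨ i = x := by simpa using m
          rcases m' with rfl | rfl | rfl
          · rw [if_pos rfl, if_neg ptInf_ne_ptZero, if_neg x0.symm]; push_cast; ring
          · rw [if_neg ptInf_ne_ptZero.symm, if_pos rfl, if_neg x1.symm]; push_cast; ring
          · rw [if_neg x0, if_neg x1, if_pos rfl]; push_cast; ring
        · have m' : i ≠ ptInf ∧ i ≠ ptZero ∧ i ≠ x := by simpa using m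
          have d4 : (insert i ({ptInf, ptZero, x} : Finset Omega)).card = 4 := by
            rw [card_insert_of_notMem m, c3]
          have d5 : (insert i (insert ptOne {ptInf, ptZero, x} : Finset Omega)).card = 5 := by
            rw [card_insert_of_notMem, c4]
            rw [mem_insert, not_or]
            exact ⟨i2, m⟩
          rw [h.card_above_four d4, h.card_above_five d5, if_neg i2, if_neg m'.1, if_neg m'.2.1,
            if_neg m'.2.2]
          push_cast; ring
    rw [sum_congr rfl fun i _ => term i] at key
    simp only [sum_sub_distrib, sum_add_distrib, sum_ite_eq', mem_univ, if_true, ← mul_sum] at key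
    linarith
  have hcard : (univ \ T).card = 21 := by
    rw [card_sdiff_of_subset (subset_univ _), card_univ, IsSteinerSystem.card_omega,
      card_eq_three.2 ⟨_, _, _, ptInf_ne_ptZero, ptInf_ne_ptOne, ptZero_ne_ptOne, hT⟩]
  have hS0 : S = 0 := by
    have e : ∑ x ∈ univ \ T, 12 * y x = ∑ x ∈ univ \ T, -4 * S :=
      sum_congr rfl fun x hx' => hx x (mem_sdiff.1 hx').2
    rw [← mul_sum, sum_const, hcard, nsmul_eq_mul] at e
    push_cast at e
    linarith
  funext x
  by_cases hxT : x ∈ T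
  · have : x = ptInf ∨ x = ptZero ∨ x = ptOne := by simpa [hT] using hxT
    rcases this with rfl | rfl | rfl <;> simp only [Pi.zero_apply] <;> linarith
  · have := hx x hxT
    rw [hS0] at this
    simp only [Pi.zero_apply]
    linarith

/-- The stabilizer of `R` acts faithfully on the 112 roots. -/
theorem eq_one_of_fix_leechRootsPerpR (h : IsSteinerSystem 𝒮)
    {g : LorentzSpace ≃ₗ[ℝ] LorentzSpace} (hg : g ∈ autFixR 𝒮)
    (hfix : ∀ r ∈ leechRootsPerpR 𝒮, g r = r) : g = 1 := by
  refine eq_one_of_leechPart h hg fun v => ?_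
  rw [← sub_eq_zero]
  have key : ∀ m, leechPart g m = m → m ⬝ᵥ (leechPart g v - v) = 0 := by
    intro m hm
    rw [dotProduct_sub]
    nth_rw 1 [← hm]
    rw [leechPart_dotProduct h hg, sub_self]
  refine eq_zero_of_dotProduct_eq_zero h (fun i => key _ (leechPart_rootVec h hg i)) fun K hK => ?_
  have hm : leechPart g (vecI K) = vecI K := by
    refine leechRootOf_injective ?_
    rw [← autFixR_leechRootOf h hg]
    refine hfix _ ?_
    rw [leechRootsPerpR_eq h]
    exact ⟨_, Or.inl ⟨K, hK, rfl⟩, rfl⟩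
  have := key _ hm
  rw [vecI, smul_dotProduct, dotProduct_comm, dotProduct_nu, smul_eq_mul] at this
  linarith

/-! ### A computable model of the field with nine elements -/

/-- The field `𝔽₃(i)` with `i² = -1`. -/
abbrev GF9 : Type := QuadraticAlgebra (ZMod 3) (-1) 0

instance : Fintype GF9 := Fintype.ofEquiv _ (QuadraticAlgebra.equivProd (-1 : ZMod 3) 0).symm

instance : Fact (∀ r : ZMod 3, r ^ 2 ≠ -1 + 0 * r) := ⟨by decide⟩

theorem GF9.star_eq_pow : ∀ a : GF9, star a = a ^ 3 := by decide +kernel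

theorem GF9.nonempty_ringEquiv : Nonempty (GF9 ≃+* F9) := by
  let _ := Fintype.ofFinite F9
  have h9 : Fintype.card GF9 = 9 := by decide +kernel
  refine ⟨FiniteField.ringEquivOfCardEq (h9.trans ?_)⟩
  rw [Fintype.card_eq_nat_card, GaloisField.card 3 2 (by norm_num)]
  norm_num

/-- The special unitary group over the computable model. -/
abbrev SU4 : Type := Matrix.specialUnitaryGroup (Fin 4) GF9

theorem map_mem_specialUnitaryGroup {F F' : Type*} [Field F] [StarRing F] [Field F'] [StarRing F']
    (e : F →+* F') (he : ∀ a, e (star a) = star (e a)) {A : Matrix (Fin 4) (Fin 4) F}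
    (hA : A ∈ Matrix.specialUnitaryGroup (Fin 4) F) :
    e.mapMatrix A ∈ Matrix.specialUnitaryGroup (Fin 4) F' := by
  rw [Matrix.mem_specialUnitaryGroup_iff, Matrix.mem_unitaryGroup_iff] at hA ⊢
  have hs : star (e.mapMatrix A) = e.mapMatrix (star A) := by
    ext i j; exact (he _).symm
  rw [hs, ← map_mul, hA.1, map_one, ← RingHom.map_det, hA.2, map_one]
  exact ⟨rfl, rfl⟩

theorem nonempty_SU4_equiv : Nonempty (SU4 ≃* Matrix.specialUnitaryGroup (Fin 4) F9) := by
  obtain ⟨e⟩ := GF9.nonempty_ringEquiv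
  have he : ∀ a, e (star a) = star (e a) := fun a => by
    rw [GF9.star_eq_pow, map_pow]; rfl
  have he' : ∀ a, e.symm (star a) = star (e.symm a) := fun a => by
    rw [GF9.star_eq_pow, ← map_pow]; rfl
  exact ⟨{
    toFun A := ⟨_, map_mem_specialUnitaryGroup e.toRingHom he A.2⟩
    invFun A := ⟨_, map_mem_specialUnitaryGroup e.symm.toRingHom he' A.2⟩
    left_inv A := Subtype.ext (Matrix.ext fun _ _ => e.symm_apply_apply _)
    right_inv A := Subtype.ext (Matrix.ext fun _ _ => e.apply_symm_apply _)
    map_mul' A B := Subtype.ext (map_mul e.toRingHom.mapMatrix A.1 B.1) }⟩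

/-! ### Elimination in the special unitary group -/

/-- The norm `a ↦ a ā`. -/
def GF9.nm (a : GF9) : GF9 := a * star a

/-- The pairs of norm one, which stand for the elements `[a, -b̄; b, ā]` of `SU(2)`. -/
def IsUnitPair (p : GF9 × GF9) : Prop := GF9.nm p.1 + GF9.nm p.2 = 1

instance (p : GF9 × GF9) : Decidable (IsUnitPair p) := inferInstanceAs (Decidable (_ = _))

/-- The action of the matrix `[a, -b̄; b, ā]` on pairs. -/
def pairAct (p v : GF9 × GF9) : GF9 × GF9 :=
  (p.1 * v.1 - star p.2 * v.2, p.2 * v.1 + star p.1 * v.2)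

theorem nm_pairAct {p : GF9 × GF9} (hp : IsUnitPair p) (v : GF9 × GF9) :
    GF9.nm (pairAct p v).1 + GF9.nm (pairAct p v).2 = GF9.nm v.1 + GF9.nm v.2 := by
  simp only [IsUnitPair, GF9.nm, pairAct, star_sub, star_add, star_mul', star_star] at hp ⊢
  linear_combination (v.1 * star v.1 + v.2 * star v.2) * hp

theorem exists_pairAct_eq {x y : GF9} (hxy : GF9.nm x + GF9.nm y = 1) :
    ∃ p, IsUnitPair p ∧ pairAct p (x, y) = (0, 1) := by
  refine ⟨(y, star x), ?_, ?_⟩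
  · simp only [IsUnitPair, GF9.nm, star_star] at hxy ⊢
    linear_combination hxy
  · simp only [GF9.nm] at hxy
    ext1
    · simp only [pairAct, star_star]; ring
    · simp only [pairAct]; linear_combination hxy

theorem exists_pairAct_fst_eq_zero {x y : GF9} (hxy : GF9.nm x + GF9.nm y ≠ 0) :
    ∃ p, IsUnitPair p ∧ (pairAct p (x, y)).1 = 0 := by
  have h1 : GF9.nm x + GF9.nm y = 1 ∨ GF9.nm x + GF9.nm y = -1 := by
    revert hxy; revert x y; decide +kernel
  rcases h1 with h1 | h1
  · obtain ⟨p, hp, e⟩ := exists_pairAct_eq h1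
    exact ⟨p, hp, by rw [e]⟩
  · refine ⟨(⟨1, 1⟩ * y, star (⟨1, 1⟩ * x)), ?_, ?_⟩
    · have h2 : (⟨1, 1⟩ : GF9) * star ⟨1, 1⟩ = -1 := by decide
      simp only [IsUnitPair, GF9.nm, star_star, star_mul'] at h1 ⊢
      linear_combination (-1 : GF9) * h1 + (x * star x + y * star y) * h2
    · simp only [pairAct, star_star]; ring

/-- Isotropic pairs cannot be cleared; `SU(2)` on the other coordinates makes the pair anisotropic. -/
theorem exists_nm_add_ne_zero : ∀ n ∈ ({0, 1, -1} : Finset GF9), ∀ y z : GF9,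
    n + GF9.nm y + GF9.nm z = 1 →
    ∃ q, IsUnitPair q ∧ n + GF9.nm (pairAct q (y, z)).1 ≠ 0 := by
  decide +kernel

theorem nm_mem (x : GF9) : GF9.nm x ∈ ({0, 1, -1} : Finset GF9) := by
  revert x; decide +kernel

theorem exists_pairAct_eq_one_zero {x y : GF9} (hxy : GF9.nm x + GF9.nm y = 1) :
    ∃ p, IsUnitPair p ∧ pairAct p (x, y) = (1, 0) := by
  refine ⟨(star x, -y), ?_, ?_⟩
  · simp only [IsUnitPair, GF9.nm, star_star, star_neg] at hxy ⊢
    linear_combination hxy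
  · simp only [GF9.nm] at hxy
    ext1
    · simp only [pairAct, star_neg]; linear_combination hxy
    · simp only [pairAct, star_star]; ring

/-- The same for a vector of length four, with `SU(2)` on the last two and then the middle coordinates. -/
theorem exists_nm_add_ne_zero_of_four {n y z u : GF9}
    (h : n + GF9.nm y + (GF9.nm z + GF9.nm u) = 1) :
    ∃ d, IsUnitPair d ∧ ∃ q, IsUnitPair q ∧
      n + GF9.nm (pairAct q (y, (pairAct d (z, u)).1)).1 ≠ 0 := by
  have hone : IsUnitPair (1, 0) := by decide
  by_cases hny : n + GF9.nm y = 0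
  · have hzu : GF9.nm z + GF9.nm u = 1 := by linear_combination h - hny
    by_cases hn0 : n = 0
    · obtain ⟨d, hd, e⟩ := exists_pairAct_eq_one_zero hzu
      refine ⟨d, hd, (0, 1), by decide, ?_⟩
      rw [e, hn0]
      simp only [pairAct, zero_mul, zero_add, zero_sub]
      decide
    · obtain ⟨d, hd, e⟩ := exists_pairAct_eq hzu
      refine ⟨d, hd, (0, 1), by decide, ?_⟩
      rw [e]
      simpa [pairAct, GF9.nm] using hn0
  · exact ⟨(1, 0), hone, (1, 0), hone, by simpa [pairAct] using hny⟩

/-- Reduction of a unit vector of length three by `SU(2)` acting on the last two, the first two, and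
again the last two coordinates. -/
theorem exists_reduction_three {x y z : GF9} (h : GF9.nm x + GF9.nm y + GF9.nm z = 1) :
    ∃ q p r, IsUnitPair q ∧ IsUnitPair p ∧ IsUnitPair r ∧
      (pairAct p (x, (pairAct q (y, z)).1)).1 = 0 ∧
      pairAct r ((pairAct p (x, (pairAct q (y, z)).1)).2, (pairAct q (y, z)).2) = (0, 1) := by
  obtain ⟨q, hq, hne⟩ := exists_nm_add_ne_zero _ (nm_mem x) y z h
  obtain ⟨p, hp, hp0⟩ := exists_pairAct_fst_eq_zero hne
  have h1 := nm_pairAct hq (y, z)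
  have h2 := nm_pairAct hp (x, (pairAct q (y, z)).1)
  rw [hp0] at h2
  have h0 : GF9.nm 0 = 0 := by decide
  rw [h0, zero_add] at h2
  obtain ⟨r, hr, hr1⟩ := exists_pairAct_eq (x := (pairAct p (x, (pairAct q (y, z)).1)).2)
    (y := (pairAct q (y, z)).2) (by rw [h2]; linear_combination h1 + h)
  exact ⟨q, p, r, hq, hp, hr, hp0, hr1⟩

/-- The first coordinate of a unit vector of length four can be cleared. -/
theorem exists_reduction_four {x y z u : GF9}
    (h : GF9.nm x + GF9.nm y + (GF9.nm z + GF9.nm u) = 1) :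
    ∃ d q p, IsUnitPair d ∧ IsUnitPair q ∧ IsUnitPair p ∧
      (pairAct p (x, (pairAct q (y, (pairAct d (z, u)).1)).1)).1 = 0 := by
  obtain ⟨d, hd, q, hq, hne⟩ := exists_nm_add_ne_zero_of_four h
  obtain ⟨p, hp, hp0⟩ := exists_pairAct_fst_eq_zero hne
  exact ⟨d, q, p, hd, hq, hp, hp0⟩

/-! ### Generators of the special unitary group -/

/-- The matrix of the cyclic permutation of the first three coordinates. -/
def matS : Matrix (Fin 4) (Fin 4) GF9 := !![0, 0, 1, 0; 1, 0, 0, 0; 0, 1, 0, 0; 0, 0, 0, 1]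

/-- The matrix that reverses the order of the coordinates. -/
def matT : Matrix (Fin 4) (Fin 4) GF9 := !![0, 0, 0, 1; 0, 0, 1, 0; 0, 1, 0, 0; 1, 0, 0, 0]

/-- The block `[a, -b̄; b, ā]` in the first two coordinates. -/
def matB12 (p : GF9 × GF9) : Matrix (Fin 4) (Fin 4) GF9 :=
  !![p.1, -star p.2, 0, 0; p.2, star p.1, 0, 0; 0, 0, 1, 0; 0, 0, 0, 1]

/-- The block `[a, -b̄; b, ā]` in the middle coordinates. -/
def matB23 (p : GF9 × GF9) : Matrix (Fin 4) (Fin 4) GF9 :=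
  !![1, 0, 0, 0; 0, p.1, -star p.2, 0; 0, p.2, star p.1, 0; 0, 0, 0, 1]

/-- The block `[a, -b̄; b, ā]` in the last two coordinates. -/
def matB34 (p : GF9 × GF9) : Matrix (Fin 4) (Fin 4) GF9 :=
  !![1, 0, 0, 0; 0, 1, 0, 0; 0, 0, p.1, -star p.2; 0, 0, p.2, star p.1]

theorem mem_SU4_iff {A : Matrix (Fin 4) (Fin 4) GF9} :
    A ∈ Matrix.specialUnitaryGroup (Fin 4) GF9 ↔ A * Aᴴ = 1 ∧ A.det = 1 := by
  rw [Matrix.mem_specialUnitaryGroup_iff, Matrix.mem_unitaryGroup_iff, Matrix.star_eq_conjTranspose]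

theorem det_fin_four {R : Type*} [CommRing R] (A : Matrix (Fin 4) (Fin 4) R) : A.det =
    A 0 0 * (A 1 1 * (A 2 2 * A 3 3 - A 2 3 * A 3 2) - A 1 2 * (A 2 1 * A 3 3 - A 2 3 * A 3 1) +
      A 1 3 * (A 2 1 * A 3 2 - A 2 2 * A 3 1)) -
    A 0 1 * (A 1 0 * (A 2 2 * A 3 3 - A 2 3 * A 3 2) - A 1 2 * (A 2 0 * A 3 3 - A 2 3 * A 3 0) +
      A 1 3 * (A 2 0 * A 3 2 - A 2 2 * A 3 0)) +
    A 0 2 * (A 1 0 * (A 2 1 * A 3 3 - A 2 3 * A 3 1) - A 1 1 * (A 2 0 * A 3 3 - A 2 3 * A 3 0) +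
      A 1 3 * (A 2 0 * A 3 1 - A 2 1 * A 3 0)) -
    A 0 3 * (A 1 0 * (A 2 1 * A 3 2 - A 2 2 * A 3 1) - A 1 1 * (A 2 0 * A 3 2 - A 2 2 * A 3 0) +
      A 1 2 * (A 2 0 * A 3 1 - A 2 1 * A 3 0)) := by
  rw [Matrix.det_succ_row_zero, Fin.sum_univ_four]
  simp only [Matrix.det_fin_three, Matrix.submatrix_apply]
  simp [Fin.succAbove, Fin.lt_def]
  ring

theorem matS_mem : matS ∈ Matrix.specialUnitaryGroup (Fin 4) GF9 := by
  rw [mem_SU4_iff, det_fin_four]; constructor <;> decide +kernel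

theorem matT_mem : matT ∈ Matrix.specialUnitaryGroup (Fin 4) GF9 := by
  rw [mem_SU4_iff, det_fin_four]; constructor <;> decide +kernel

theorem matB23_mem {p : GF9 × GF9} (hp : IsUnitPair p) :
    matB23 p ∈ Matrix.specialUnitaryGroup (Fin 4) GF9 := by
  rw [IsUnitPair, GF9.nm, GF9.nm] at hp
  rw [mem_SU4_iff, det_fin_four]
  constructor
  · ext i j : 1
    rw [Matrix.mul_apply, Fin.sum_univ_four]
    simp only [Matrix.conjTranspose_apply]
    fin_cases i <;> fin_cases j <;> simp [matB23] <;> first | linear_combination hp | ring1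
  · simp [matB23]; linear_combination hp

theorem matB23_mul (p q : GF9 × GF9) : matB23 p * matB23 q = matB23 (pairAct p q) := by
  ext i j : 1
  rw [Matrix.mul_apply, Fin.sum_univ_four]
  fin_cases i <;> fin_cases j <;> simp [matB23, pairAct] <;> ring

theorem matT_conj (p : GF9 × GF9) : matT * matB12 p * matT = matB34 (star p.1, -star p.2) := by
  ext i j : 1
  simp only [Matrix.mul_apply, Fin.sum_univ_four]
  fin_cases i <;> fin_cases j <;> simp [matB12, matB34, matT]

theorem matT_conj_matB23 (p : GF9 × GF9) : matT * matB23 p * matT = matB23 (star p.1, -star p.2) := by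
  ext i j : 1
  simp only [Matrix.mul_apply, Fin.sum_univ_four]
  fin_cases i <;> fin_cases j <;> simp [matB23, matT]

theorem matS_conj (p : GF9 × GF9) : matS * matB12 p = matB23 p * matS := by
  ext i j : 1
  rw [Matrix.mul_apply, Matrix.mul_apply, Fin.sum_univ_four, Fin.sum_univ_four]
  fin_cases i <;> fin_cases j <;> simp [matB12, matB23, matS]

/-- An element of order six of `SU(2)`, which generates `SU(2)` together with its conjugate under the
reversal of the coordinates. -/
def pairW : GF9 × GF9 := (⟨2, 1⟩, ⟨1, 1⟩)

theorem isUnitPair_pairW : IsUnitPair pairW := by decide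

/-- Each of the 24 elements of `SU(2)` is a word in `pairW` and its conjugate. -/
theorem exists_word (p : GF9 × GF9) (hp : IsUnitPair p) : ∃ i j k : Fin 6,
    p = (pairAct pairW)^[i] ((pairAct (star pairW.1, -star pairW.2))^[j]
      ((pairAct pairW)^[k] (1, 0))) := by
  revert p; decide +kernel

/-! ### The generators generate the special unitary group -/

/-- The cyclic permutation of the first three coordinates as an element of the group. -/
def suS : SU4 := ⟨matS, matS_mem⟩

/-- The reversal of the coordinates as an element of the group. -/
def suT : SU4 := ⟨matT, matT_mem⟩

/-- The element of order six in the middle block as an element of the group. -/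
def suW : SU4 := ⟨matB23 pairW, matB23_mem isUnitPair_pairW⟩

theorem exists_matB23 {H : Subgroup SU4} (hT : suT ∈ H) (hW : suW ∈ H) {p : GF9 × GF9}
    (hp : IsUnitPair p) : ∃ A ∈ H, A.1 = matB23 p := by
  have hW' : ∃ A ∈ H, A.1 = matB23 (star pairW.1, -star pairW.2) :=
    ⟨suT * suW * suT, mul_mem (mul_mem hT hW) hT, matT_conj_matB23 pairW⟩
  have step : ∀ q, (∃ A ∈ H, A.1 = matB23 q) → ∀ (n : ℕ) (x : GF9 × GF9), (∃ A ∈ H, A.1 = matB23 x) →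
      ∃ A ∈ H, A.1 = matB23 ((pairAct q)^[n] x) := by
    rintro q ⟨B, hB, hBq⟩ n
    induction n with
    | zero => exact fun x hx => hx
    | succ n ih =>
      rintro x ⟨A, hA, hAx⟩
      refine ih _ ⟨B * A, mul_mem hB hA, ?_⟩
      rw [← matB23_mul, ← hBq, ← hAx]; rfl
  have h1 : ∃ A ∈ H, A.1 = matB23 (1, 0) := by
    refine ⟨1, one_mem H, ?_⟩
    show (1 : Matrix (Fin 4) (Fin 4) GF9) = _
    ext i j : 1
    fin_cases i <;> fin_cases j <;> simp [matB23]
  obtain ⟨i, j, k, e⟩ := exists_word p hp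
  rw [e]
  exact step _ ⟨suW, hW, rfl⟩ _ _ (step _ hW' _ _ (step _ ⟨suW, hW, rfl⟩ _ _ h1))

theorem exists_matB12 {H : Subgroup SU4} (hS : suS ∈ H) (hT : suT ∈ H) (hW : suW ∈ H)
    {p : GF9 × GF9} (hp : IsUnitPair p) : ∃ A ∈ H, A.1 = matB12 p := by
  obtain ⟨A, hA, e⟩ := exists_matB23 hT hW hp
  refine ⟨suS⁻¹ * A * suS, mul_mem (mul_mem (inv_mem hS) hA) hS, ?_⟩
  have h1 : (suS⁻¹ : SU4).1 * matS = 1 := congrArg Subtype.val (inv_mul_cancel suS)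
  calc (suS⁻¹ * A * suS : SU4).1 = (suS⁻¹ : SU4).1 * (matB23 p * matS) := by
        rw [← e, ← mul_assoc]; rfl
    _ = matB12 p := by rw [← matS_conj, ← mul_assoc, h1, one_mul]

theorem exists_matB34 {H : Subgroup SU4} (hS : suS ∈ H) (hT : suT ∈ H) (hW : suW ∈ H)
    {p : GF9 × GF9} (hp : IsUnitPair p) : ∃ A ∈ H, A.1 = matB34 p := by
  have hp' : IsUnitPair (star p.1, -star p.2) := by
    simp only [IsUnitPair, GF9.nm, star_neg, star_star] at hp ⊢
    linear_combination hp
  obtain ⟨A, hA, e⟩ := exists_matB12 hS hT hW hp'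
  refine ⟨suT * A * suT, mul_mem (mul_mem hT hA) hT, ?_⟩
  have := matT_conj (star p.1, -star p.2)
  simp only [star_star, star_neg, neg_neg] at this
  rw [← e] at this
  exact this

theorem matB12_mulVec (p : GF9 × GF9) (x y z u : GF9) :
    matB12 p *ᵥ ![x, y, z, u] = ![(pairAct p (x, y)).1, (pairAct p (x, y)).2, z, u] := by
  funext i
  rw [Matrix.mulVec, dotProduct, Fin.sum_univ_four]
  fin_cases i <;> simp [matB12, pairAct, sub_eq_add_neg]

theorem matB23_mulVec (p : GF9 × GF9) (x y z u : GF9) :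
    matB23 p *ᵥ ![x, y, z, u] = ![x, (pairAct p (y, z)).1, (pairAct p (y, z)).2, u] := by
  funext i
  rw [Matrix.mulVec, dotProduct, Fin.sum_univ_four]
  fin_cases i <;> simp [matB23, pairAct, sub_eq_add_neg]

theorem matB34_mulVec (p : GF9 × GF9) (x y z u : GF9) :
    matB34 p *ᵥ ![x, y, z, u] = ![x, y, (pairAct p (z, u)).1, (pairAct p (z, u)).2] := by
  funext i
  rw [Matrix.mulVec, dotProduct, Fin.sum_univ_four]
  fin_cases i <;> simp [matB34, pairAct, sub_eq_add_neg]

/-- Every unit vector is moved to the last basis vector. -/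
theorem exists_mulVec_eq_four {H : Subgroup SU4} (hS : suS ∈ H) (hT : suT ∈ H) (hW : suW ∈ H)
    {x y z u : GF9} (h : GF9.nm x + GF9.nm y + (GF9.nm z + GF9.nm u) = 1) :
    ∃ A ∈ H, A.1 *ᵥ ![x, y, z, u] = ![0, 0, 0, 1] := by
  obtain ⟨d, q, p, hd, hq, hp, h0⟩ := exists_reduction_four h
  obtain ⟨D, hD, eD⟩ := exists_matB34 hS hT hW hd
  obtain ⟨Q, hQ, eQ⟩ := exists_matB23 hT hW hq
  obtain ⟨P, hP, eP⟩ := exists_matB12 hS hT hW hp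
  -- the first coordinate is cleared, and the remaining vector of length three is reduced
  set z1 := (pairAct d (z, u)).1 with hz1
  set u1 := (pairAct d (z, u)).2 with hu1
  set y1 := (pairAct q (y, z1)).1 with hy1
  set z2 := (pairAct q (y, z1)).2 with hz2
  set y2 := (pairAct p (x, y1)).2 with hy2
  have e1 := nm_pairAct hd (z, u)
  have e2 := nm_pairAct hq (y, z1)
  have e3 := nm_pairAct hp (x, y1)
  rw [h0, show GF9.nm 0 = 0 by decide] at e3
  have h3 : GF9.nm y2 + GF9.nm z2 + GF9.nm u1 = 1 := by
    simp only at e1 e2 e3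
    linear_combination e1 + e2 + e3 + h
  obtain ⟨q', p', r', hq', hp', hr', h0', h1'⟩ := exists_reduction_three h3
  obtain ⟨Q', hQ', eQ'⟩ := exists_matB34 hS hT hW hq'
  obtain ⟨P', hP', eP'⟩ := exists_matB23 hT hW hp'
  obtain ⟨R', hR', eR'⟩ := exists_matB34 hS hT hW hr'
  refine ⟨R' * P' * Q' * P * Q * D, mul_mem (mul_mem (mul_mem (mul_mem (mul_mem hR' hP') hQ') hP)
    hQ) hD, ?_⟩
  have : (R' * P' * Q' * P * Q * D : SU4).1 *ᵥ ![x, y, z, u] =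
      R'.1 *ᵥ (P'.1 *ᵥ (Q'.1 *ᵥ (P.1 *ᵥ (Q.1 *ᵥ (D.1 *ᵥ ![x, y, z, u]))))) := by
    simp only [Matrix.mulVec_mulVec, mul_assoc]; rfl
  rw [this, eD, matB34_mulVec, eQ, matB23_mulVec, eP, matB12_mulVec, h0, eQ', matB34_mulVec, eP',
    matB23_mulVec, h0', eR', matB34_mulVec, h1']

/-- Every unit vector in the span of the first three basis vectors is moved to the third one by an
element that fixes the fourth one. -/
theorem exists_mulVec_eq_three {H : Subgroup SU4} (hS : suS ∈ H) (hT : suT ∈ H) (hW : suW ∈ H)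
    {x y z : GF9} (h : GF9.nm x + GF9.nm y + GF9.nm z = 1) :
    ∃ A ∈ H, A.1 *ᵥ ![x, y, z, 0] = ![0, 0, 1, 0] ∧ A.1 *ᵥ ![0, 0, 0, 1] = ![0, 0, 0, 1] := by
  obtain ⟨q, p, r, hq, hp, hr, h0, h1⟩ := exists_reduction_three h
  obtain ⟨Q, hQ, eQ⟩ := exists_matB23 hT hW hq
  obtain ⟨P, hP, eP⟩ := exists_matB12 hS hT hW hp
  obtain ⟨R, hR, eR⟩ := exists_matB23 hT hW hr
  have hmul : ∀ v, (R * P * Q : SU4).1 *ᵥ v = R.1 *ᵥ (P.1 *ᵥ (Q.1 *ᵥ v)) := fun v => by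
    simp only [Matrix.mulVec_mulVec, mul_assoc]; rfl
  have hzero : ∀ p, pairAct p (0, 0) = (0, 0) := fun p => by simp [pairAct]
  refine ⟨R * P * Q, mul_mem (mul_mem hR hP) hQ, ?_, ?_⟩
  · rw [hmul, eQ, matB23_mulVec, eP, matB12_mulVec, h0, eR, matB23_mulVec, h1]
  · rw [hmul, eQ, matB23_mulVec, hzero, eP, matB12_mulVec, hzero, eR, matB23_mulVec, hzero]

theorem SU4_star_mul (A : SU4) : A.1ᴴ * A.1 = 1 := by
  have := mem_SU4_iff.1 A.2
  exact mul_eq_one_comm.1 this.1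

/-- The columns are orthonormal. -/
theorem SU4_col (A : SU4) (i j : Fin 4) : star (A.1 0 i) * A.1 0 j + star (A.1 1 i) * A.1 1 j +
    star (A.1 2 i) * A.1 2 j + star (A.1 3 i) * A.1 3 j = if i = j then 1 else 0 := by
  have := congrFun (congrFun (SU4_star_mul A) i) j
  rw [Matrix.mul_apply, Fin.sum_univ_four, Matrix.one_apply] at this
  exact this

theorem mulVec_e3 (A : SU4) : A.1 *ᵥ ![0, 0, 0, 1] = ![A.1 0 3, A.1 1 3, A.1 2 3, A.1 3 3] := by
  funext i
  rw [Matrix.mulVec, dotProduct, Fin.sum_univ_four]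
  fin_cases i <;> simp

theorem mulVec_e2 (A : SU4) : A.1 *ᵥ ![0, 0, 1, 0] = ![A.1 0 2, A.1 1 2, A.1 2 2, A.1 3 2] := by
  funext i
  rw [Matrix.mulVec, dotProduct, Fin.sum_univ_four]
  fin_cases i <;> simp

/-- An element of `SU(4)` that fixes the last two basis vectors is a block of `SU(2)`. -/
theorem eq_matB12_of_fix (A : SU4) (h3 : A.1 *ᵥ ![0, 0, 0, 1] = ![0, 0, 0, 1])
    (h2 : A.1 *ᵥ ![0, 0, 1, 0] = ![0, 0, 1, 0]) :
    IsUnitPair (A.1 0 0, A.1 1 0) ∧ A.1 = matB12 (A.1 0 0, A.1 1 0) := by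
  rw [mulVec_e3] at h3
  rw [mulVec_e2] at h2
  have a03 : A.1 0 3 = 0 := congrFun h3 0
  have a13 : A.1 1 3 = 0 := congrFun h3 1
  have a23 : A.1 2 3 = 0 := congrFun h3 2
  have a33 : A.1 3 3 = 1 := congrFun h3 3
  have a02 : A.1 0 2 = 0 := congrFun h2 0
  have a12 : A.1 1 2 = 0 := congrFun h2 1
  have a22 : A.1 2 2 = 1 := congrFun h2 2
  have a32 : A.1 3 2 = 0 := congrFun h2 3
  have r : ∀ j : Fin 4, j ≠ 2 → j ≠ 3 → A.1 2 j = 0 ∧ A.1 3 j = 0 := by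
    intro j hj2 hj3
    have e2 := SU4_col A 2 j
    have e3 := SU4_col A 3 j
    rw [if_neg hj2.symm, a02, a12, a22, a32] at e2
    rw [if_neg hj3.symm, a03, a13, a23, a33] at e3
    simp only [star_zero, star_one, zero_mul, one_mul, zero_add, add_zero] at e2 e3
    exact ⟨e2, e3⟩
  obtain ⟨a20, a30⟩ := r 0 (by decide) (by decide)
  obtain ⟨a21, a31⟩ := r 1 (by decide) (by decide)
  have e00 := SU4_col A 0 0
  have e01 := SU4_col A 0 1
  have hdet := (mem_SU4_iff.1 A.2).2
  rw [det_fin_four, a03, a13, a23, a33, a02, a12, a22, a32, a20, a30, a21, a31] at hdet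
  rw [a20, a30, if_pos rfl] at e00
  rw [a20, a30, a21, a31, if_neg (by decide)] at e01
  simp only [star_zero, zero_mul, add_zero] at e00 e01
  have hc : A.1 0 1 = -star (A.1 1 0) := by
    linear_combination (-A.1 0 1) * e00 + A.1 0 0 * e01 - star (A.1 1 0) * hdet
  have hd : A.1 1 1 = star (A.1 0 0) := by
    linear_combination (-A.1 1 1) * e00 + A.1 1 0 * e01 + star (A.1 0 0) * hdet
  refine ⟨?_, ?_⟩
  · simp only [IsUnitPair, GF9.nm]
    linear_combination e00
  · ext i j : 1
    fin_cases i <;> fin_cases j <;> simp [matB12, *]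

theorem SU4_mul_mulVec (A B : SU4) (v : Fin 4 → GF9) : (A * B).1 *ᵥ v = A.1 *ᵥ (B.1 *ᵥ v) :=
  (Matrix.mulVec_mulVec v A.1 B.1).symm

theorem SU4_inv_mulVec (A : SU4) {v w : Fin 4 → GF9} (h : A.1 *ᵥ v = w) :
    (A⁻¹ : SU4).1 *ᵥ w = v := by
  rw [← h, ← SU4_mul_mulVec, inv_mul_cancel]
  exact Matrix.one_mulVec v

/-- The group `SU(4, 𝔽₃)` is generated by two permutation matrices and a block of `SU(2)`: elements of
the subgroup move the last two columns to the last two basis vectors, which leaves a block. -/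
theorem eq_top_of_generators_mem {H : Subgroup SU4} (hS : suS ∈ H) (hT : suT ∈ H) (hW : suW ∈ H) :
    H = ⊤ := by
  refine (Subgroup.eq_top_iff' H).2 fun A => ?_
  have e33 := SU4_col A 3 3
  rw [if_pos rfl] at e33
  obtain ⟨P, hP, eP⟩ := exists_mulVec_eq_four hS hT hW (x := A.1 0 3) (y := A.1 1 3) (z := A.1 2 3)
    (u := A.1 3 3) (by simp only [GF9.nm]; linear_combination e33)
  set B := P * A with hB
  have hB3 : B.1 *ᵥ ![0, 0, 0, 1] = ![0, 0, 0, 1] := by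
    rw [hB, SU4_mul_mulVec, mulVec_e3, eP]
  have hB3' := hB3
  rw [mulVec_e3] at hB3'
  have b03 : B.1 0 3 = 0 := congrFun hB3' 0
  have b13 : B.1 1 3 = 0 := congrFun hB3' 1
  have b23 : B.1 2 3 = 0 := congrFun hB3' 2
  have b33 : B.1 3 3 = 1 := congrFun hB3' 3
  have e32 := SU4_col B 3 2
  have e22 := SU4_col B 2 2
  rw [b03, b13, b23, b33, if_neg (by decide)] at e32
  simp only [star_zero, star_one, zero_mul, one_mul, zero_add] at e32
  rw [e32, if_pos rfl] at e22
  obtain ⟨Q, hQ, eQ, eQ'⟩ := exists_mulVec_eq_three hS hT hW (x := B.1 0 2) (y := B.1 1 2)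
    (z := B.1 2 2) (by simp only [GF9.nm, star_zero, zero_mul] at e22 ⊢; linear_combination e22)
  have hC := eq_matB12_of_fix (Q * B) (by rw [SU4_mul_mulVec, hB3, eQ'])
    (by rw [SU4_mul_mulVec, mulVec_e2, e32, eQ])
  obtain ⟨D, hD, eD⟩ := exists_matB12 hS hT hW hC.1
  have hQB : Q * B ∈ H := by
    rwa [show Q * B = D from Subtype.ext (hC.2.trans eD.symm)]
  have := mul_mem (inv_mem hP) ((H.mul_mem_cancel_left hQ).1 hQB)
  rwa [hB, inv_mul_cancel_left] at this

/-! ### Order and centre of the special unitary group -/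

theorem exists_SU4_matB12 {p : GF9 × GF9} (hp : IsUnitPair p) : ∃ A : SU4, A.1 = matB12 p := by
  obtain ⟨A, -, e⟩ := exists_matB12 (H := ⊤) trivial trivial trivial hp
  exact ⟨A, e⟩

theorem exists_SU4_matB34 {p : GF9 × GF9} (hp : IsUnitPair p) : ∃ A : SU4, A.1 = matB34 p := by
  obtain ⟨A, -, e⟩ := exists_matB34 (H := ⊤) trivial trivial trivial hp
  exact ⟨A, e⟩

/-- The number of pairs of given norm. -/
theorem card_nm_add (c : GF9) (hc : c ∈ ({0, 1, -1} : Finset GF9)) :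
    (univ.filter fun v : GF9 × GF9 => GF9.nm v.1 + GF9.nm v.2 = c).card =
      if c = 0 then 33 else 24 := by
  revert c; decide +kernel

theorem card_unit_four : Fintype.card {v : (GF9 × GF9) × GF9 × GF9 //
    GF9.nm v.1.1 + GF9.nm v.1.2 + (GF9.nm v.2.1 + GF9.nm v.2.2) = 1} = 2160 := by
  rw [Fintype.card_subtype, card_filter, Fintype.sum_prod_type]
  have : ∀ v : GF9 × GF9, ∑ w : GF9 × GF9,
      (if GF9.nm v.1 + GF9.nm v.2 + (GF9.nm w.1 + GF9.nm w.2) = 1 then 1 else 0) =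
      if GF9.nm v.1 + GF9.nm v.2 = 1 then 33 else 24 := by
    intro v
    have h1 := card_nm_add (1 - (GF9.nm v.1 + GF9.nm v.2)) (by revert v; decide +kernel)
    rw [card_filter] at h1
    simp only [sub_eq_zero, eq_comm (a := (1 : GF9)), eq_sub_iff_add_eq'] at h1
    exact h1
  rw [sum_congr rfl fun v _ => this v]
  decide +kernel

theorem card_unit_three : Fintype.card {v : GF9 × GF9 × GF9 //
    GF9.nm v.1 + GF9.nm v.2.1 + GF9.nm v.2.2 = 1} = 252 := by
  rw [Fintype.card_subtype, card_filter, Fintype.sum_prod_type]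
  have : ∀ x : GF9, ∑ w : GF9 × GF9,
      (if GF9.nm x + GF9.nm w.1 + GF9.nm w.2 = 1 then 1 else 0) =
      if GF9.nm x = 1 then 33 else 24 := by
    intro x
    have h1 := card_nm_add (1 - GF9.nm x) (by revert x; decide +kernel)
    rw [card_filter] at h1
    simp only [sub_eq_zero, eq_comm (a := (1 : GF9)), eq_sub_iff_add_eq', ← add_assoc] at h1
    exact h1
  rw [sum_congr rfl fun v _ => this v]
  decide +kernel

theorem card_unit_two : Fintype.card {p : GF9 × GF9 // IsUnitPair p} = 24 := by
  decide +kernel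

instance : Finite SU4 := Finite.of_injective (fun A : SU4 => A.1) Subtype.val_injective

/-- There are 2160 unit vectors of length four, 252 of length three and 24 of length two. Let `a` move
the last basis vector to a given unit vector, let `b` fix it and move the third one to a given unit
vector of length three, and let `c` be a given block of `SU(2)`; then `a b c` determines these data. -/
theorem le_card_SU4 : 2160 * (252 * 24) ≤ Nat.card SU4 := by
  have H4 : ∀ v : {v : (GF9 × GF9) × GF9 × GF9 //
      GF9.nm v.1.1 + GF9.nm v.1.2 + (GF9.nm v.2.1 + GF9.nm v.2.2) = 1},
      ∃ A : SU4, A.1 *ᵥ ![0, 0, 0, 1] = ![v.1.1.1, v.1.1.2, v.1.2.1, v.1.2.2] := fun v => by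
    obtain ⟨A, -, e⟩ := exists_mulVec_eq_four (H := ⊤) trivial trivial trivial v.2
    exact ⟨A⁻¹, SU4_inv_mulVec A e⟩
  have H3 : ∀ v : {v : GF9 × GF9 × GF9 // GF9.nm v.1 + GF9.nm v.2.1 + GF9.nm v.2.2 = 1},
      ∃ A : SU4, A.1 *ᵥ ![0, 0, 1, 0] = ![v.1.1, v.1.2.1, v.1.2.2, 0] ∧
        A.1 *ᵥ ![0, 0, 0, 1] = ![0, 0, 0, 1] := fun v => by
    obtain ⟨A, -, e, e'⟩ := exists_mulVec_eq_three (H := ⊤) trivial trivial trivial v.2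
    exact ⟨A⁻¹, SU4_inv_mulVec A e, SU4_inv_mulVec A e'⟩
  have H2 : ∀ p : {p : GF9 × GF9 // IsUnitPair p}, ∃ A : SU4, A.1 = matB12 p.1 := fun p =>
    exists_SU4_matB12 p.2
  choose a ha using H4
  choose b hb hb' using H3
  choose c hc using H2
  have hpair : ∀ p, pairAct p (0, 0) = (0, 0) := fun p => by simp [pairAct]
  have c3 : ∀ p, (c p).1 *ᵥ ![0, 0, 0, 1] = ![0, 0, 0, 1] := fun p => by
    rw [hc, matB12_mulVec, hpair]
  have c2 : ∀ p, (c p).1 *ᵥ ![0, 0, 1, 0] = ![0, 0, 1, 0] := fun p => by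
    rw [hc, matB12_mulVec, hpair]
  have c0 : ∀ p, (c p).1 *ᵥ ![1, 0, 0, 0] = ![p.1.1, p.1.2, 0, 0] := fun p => by
    rw [hc, matB12_mulVec]; simp [pairAct]
  have hinj : Function.Injective fun x : {v : (GF9 × GF9) × GF9 × GF9 //
      GF9.nm v.1.1 + GF9.nm v.1.2 + (GF9.nm v.2.1 + GF9.nm v.2.2) = 1} ×
      {v : GF9 × GF9 × GF9 // GF9.nm v.1 + GF9.nm v.2.1 + GF9.nm v.2.2 = 1} ×
      {p : GF9 × GF9 // IsUnitPair p} => a x.1 * (b x.2.1 * c x.2.2) := by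
    rintro ⟨u, v, p⟩ ⟨u', v', p'⟩ e
    simp only at e
    have e3 := congrArg (fun A : SU4 => A.1 *ᵥ ![0, 0, 0, 1]) e
    simp only [SU4_mul_mulVec, c3, hb', ha] at e3
    have hu : u = u' := Subtype.ext (Prod.ext (Prod.ext (congrFun e3 0) (congrFun e3 1))
      (Prod.ext (congrFun e3 2) (congrFun e3 3)))
    rw [hu] at e
    replace e := mul_left_cancel e
    have e2 := congrArg (fun A : SU4 => A.1 *ᵥ ![0, 0, 1, 0]) e
    simp only [SU4_mul_mulVec, c2, hb] at e2
    have hv : v = v' := Subtype.ext (Prod.ext (congrFun e2 0)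
      (Prod.ext (congrFun e2 1) (congrFun e2 2)))
    rw [hv] at e
    replace e := mul_left_cancel e
    have e0 := congrArg (fun A : SU4 => A.1 *ᵥ ![1, 0, 0, 0]) e
    simp only [c0] at e0
    have hp : p = p' := Subtype.ext (Prod.ext (congrFun e0 0) (congrFun e0 1))
    rw [hu, hv, hp]
  have := Nat.card_le_card_of_injective _ hinj
  rwa [Nat.card_prod, Nat.card_prod, Nat.card_eq_fintype_card, Nat.card_eq_fintype_card,
    Nat.card_eq_fintype_card, card_unit_four, card_unit_three, card_unit_two] at this

theorem mem_center_of_scalar {A : SU4} {c : GF9} (hA : A.1 = c • 1) : A ∈ Subgroup.center SU4 := by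
  refine Subgroup.mem_center_iff.2 fun B => Subtype.ext ?_
  show B.1 * A.1 = A.1 * B.1
  rw [hA, mul_smul_comm, smul_mul_assoc, mul_one, one_mul]

/-- Commuting with the blocks `diag(i, -i)` makes a matrix diagonal, and commuting with the permutation
matrices makes the diagonal constant. -/
theorem scalar_of_mem_center {A : SU4} (hA : A ∈ Subgroup.center SU4) :
    A.1 = A.1 0 0 • (1 : Matrix (Fin 4) (Fin 4) GF9) := by
  have comm : ∀ B : SU4, ∀ i j, (B.1 * A.1) i j = (A.1 * B.1) i j := fun B i j =>
    congrFun (congrFun (congrArg Subtype.val (Subgroup.mem_center_iff.1 hA B)) i) j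
  have hp : IsUnitPair ((⟨0, 1⟩ : GF9), 0) := by decide
  obtain ⟨D, hD⟩ := exists_SU4_matB12 hp
  obtain ⟨E, hE⟩ := exists_SU4_matB34 hp
  have hne : ∀ a : GF9, ((⟨0, 1⟩ : GF9) * a = a * ⟨0, -1⟩ → a = 0) ∧
      ((⟨0, 1⟩ : GF9) * a = a → a = 0) ∧ ((⟨0, -1⟩ : GF9) * a = a → a = 0) ∧
      ((⟨0, -1⟩ : GF9) * a = a * ⟨0, 1⟩ → a = 0) ∧
      (a = a * (⟨0, 1⟩ : GF9) → a = 0) ∧ (a = a * (⟨0, -1⟩ : GF9) → a = 0) := by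
    decide +kernel
  have hd := fun i j => comm D i j
  have he := fun i j => comm E i j
  have hs := fun i j => comm suS i j
  have ht := fun i j => comm suT i j
  simp only [Matrix.mul_apply, Fin.sum_univ_four, hD, hE] at hd he
  simp only [Matrix.mul_apply, Fin.sum_univ_four, suS, suT] at hs ht
  have d01 := hd 0 1
  have d02 := hd 0 2
  have d03 := hd 0 3
  have d10 := hd 1 0
  have d12 := hd 1 2
  have d13 := hd 1 3
  have d20 := hd 2 0
  have d21 := hd 2 1
  have d30 := hd 3 0
  have d31 := hd 3 1
  have e23 := he 2 3
  have e32 := he 3 2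
  have s10 := hs 1 0
  have s21 := hs 2 1
  have t30 := ht 3 0
  simp [matB12] at d01 d02 d03 d10 d12 d13 d20 d21 d30 d31
  simp [matB34] at e23 e32
  simp [matS] at s10 s21
  simp [matT] at t30
  ext i j : 1
  rw [Matrix.smul_apply, smul_eq_mul]
  fin_cases i <;> fin_cases j
  · simp
  · simpa using (hne _).1 d01
  · simpa using (hne _).2.1 d02
  · simpa using (hne _).2.1 d03
  · simpa using (hne _).2.2.2.1 d10
  · simpa using s10.symm
  · simpa using (hne _).2.2.1 d12
  · simpa using (hne _).2.2.1 d13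
  · simpa using (hne _).2.2.2.2.1 d20
  · simpa using (hne _).2.2.2.2.2 d21
  · simpa using (s10.trans s21).symm
  · simpa using (hne _).1 e23
  · simpa using (hne _).2.2.2.2.1 d30
  · simpa using (hne _).2.2.2.2.2 d31
  · simpa using (hne _).2.2.2.1 e32
  · simpa using t30.symm

theorem card_center_SU4_le : Nat.card (Subgroup.center SU4) ≤ 4 := by
  have hunit : ∀ A : Subgroup.center SU4, GF9.nm (A.1.1 0 0) = 1 := by
    intro A
    have h0 := SU4_col A.1 0 0
    rw [scalar_of_mem_center A.2] at h0
    simpa [GF9.nm, mul_comm] using h0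
  have hinj : Function.Injective fun A : Subgroup.center SU4 =>
      (⟨A.1.1 0 0, hunit A⟩ : {c : GF9 // GF9.nm c = 1}) := by
    intro A B e
    have e' : A.1.1 0 0 = B.1.1 0 0 := congrArg Subtype.val e
    exact Subtype.ext (Subtype.ext ((scalar_of_mem_center A.2).trans
      ((congrArg (· • 1) e').trans (scalar_of_mem_center B.2).symm)))
  have h4 : Fintype.card {c : GF9 // GF9.nm c = 1} = 4 := by decide +kernel
  have := Nat.card_le_card_of_injective _ hinj
  rwa [Nat.card_eq_fintype_card (α := {c : GF9 // GF9.nm c = 1}), h4] at this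

/-! ### The isotropic lines of the Hermitian space and the 112 roots -/

/-- The element of `GF9` with a given number from `0` to `8`. -/
def gfDigit (n : ℕ) : GF9 := ⟨(n % 3 : ℕ), (n / 3 % 3 : ℕ)⟩

/-- The number of an element of `GF9`. -/
def gfCode (a : GF9) : ℕ := a.re.val + 3 * a.im.val

/-- The vector whose coordinates are numbered by the digits to the base nine. -/
def gfVec (n : ℕ) (k : Fin 4) : GF9 := gfDigit (n / 9 ^ k.val)

/-- The reduced echelon forms of the 112 totally isotropic lines of the Hermitian space. The last four
digits to the base nine number the first row, and the digits before them the second row. -/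
def lineCodes : List ℕ :=
  [4316410, 38323369, 3784240, 2722087, 38795266, 17598223, 33540481, 38323126, 2189917,
    2190646, 34012288, 16004953, 6438043, 8031637, 10161289, 12815335, 38795239, 23974462,
    17601463, 33540238, 4315681, 38323207, 2721358, 11223766, 29289520, 30353617, 15472054,
    5909761, 16003171, 5907331, 10158859, 14941747, 16003819, 29824201, 19191331, 5378077,
    17597413, 29292841, 19663381, 24446359, 8033014, 15472540, 31950127, 10157239, 34012261,
    19191574, 12815902, 33540400, 3784969, 38795230, 19191493, 33540157, 10689409, 29821690,
    23974300, 29820718, 12818170, 29290006, 19663354, 12814849, 15475375, 30352807, 34012297,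
    31947049, 15473107, 29290573, 6437557, 11220283, 14943853, 23974219, 3782053, 30351997,
    4314223, 14941342, 6440878, 14940370, 19663390, 5374351, 38323450, 24446350, 16006897,
    31946401, 34012270, 23974543, 24446332, 24446323, 19191250, 8035120, 11221660, 2187730,
    10692487, 8032609, 29822095, 11221255, 19663363, 10690543, 2719900, 6438610, 5906521,
    4313494, 30356047, 38795257, 17599033, 3782782, 5376133, 2188459, 31948183, 10688761,
    2719171, 5905711, 10158049, 5374999]

/-- The octads that belong to the 112 Leech roots, as binary numbers, in an order that corresponds to
the order of the isotropic lines. -/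
def rootCodes : List ℕ :=
  [507, 5260363, 5509411, 1595907, 40035, 2363979, 9474075, 690323, 2703387, 541365, 4293907,
    3278891, 10617939, 7340691, 6317077, 313611, 4743555, 897027, 332005, 7080963, 5308477,
    4868109, 2904325, 2115363, 2139275, 1123083, 108069, 6365283, 12596739, 4403461, 6475779,
    141429, 6298149, 153157, 10749573, 9440643, 1163427, 4328259, 933987, 9175827, 8560931,
    8667229, 4458901, 1740837, 11014307, 591555, 120853, 4494349, 1055053, 539781, 1663045,
    12060693, 565533, 1476099, 8536715, 8474947, 394029, 2264325, 10698789, 201267, 8717355,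
    1323541, 8394037, 2111763, 57939, 4203213, 2232477, 2163541, 1192131, 450693, 8923211,
    83341, 14352387, 12601395, 12651589, 13652101, 821829, 5768965, 1082581, 984085, 9577485,
    10530885, 6914181, 8983053, 8416005, 224259, 11821059, 3154341, 1378387, 2435085, 4595739,
    12747285, 9797893, 1330213, 10586627, 7733317, 1247877, 4266123, 2622573, 9044421, 283795,
    4243813, 3195405, 13377573, 8423597, 273059, 12878019, 3703107, 2556291, 660747, 1582131,
    4751915]

/-- The action on the 112 lines of the cyclic permutation of three coordinates. -/
def imageS : List ℕ :=
  [1, 4, 6, 7, 0, 12, 10, 16, 19, 21, 2, 24, 27, 30, 32, 35, 3, 39, 41, 44, 47, 49, 51, 11, 23,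
    53, 56, 5, 59, 61, 63, 65, 66, 31, 58, 36, 15, 68, 70, 72, 25, 74, 75, 52, 8, 38, 42, 62,
    78, 9, 76, 82, 77, 40, 85, 88, 80, 87, 89, 90, 60, 91, 20, 13, 37, 33, 14, 95, 64, 84, 45,
    93, 17, 97, 18, 46, 99, 43, 101, 103, 26, 67, 22, 79, 96, 105, 94, 102, 106, 34, 28, 29, 92,
    104, 108, 81, 69, 100, 98, 50, 73, 48, 57, 83, 71, 54, 55, 107, 86, 110, 111, 109]

/-- The action on the 112 lines of the reversal of the coordinates. -/
def imageT : List ℕ :=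
  [2, 1, 0, 8, 10, 13, 6, 17, 3, 22, 4, 25, 28, 5, 33, 36, 38, 7, 42, 45, 48, 50, 9, 23, 53, 11,
    57, 37, 12, 31, 64, 29, 67, 14, 34, 60, 15, 27, 16, 44, 40, 75, 18, 52, 39, 19, 46, 78, 20,
    79, 21, 83, 43, 24, 86, 73, 87, 26, 84, 63, 35, 66, 62, 59, 30, 95, 61, 32, 90, 69, 72, 93,
    70, 55, 74, 41, 82, 98, 47, 49, 80, 91, 76, 51, 58, 85, 54, 56, 97, 96, 68, 81, 104, 71, 94,
    65, 89, 88, 77, 103, 100, 101, 102, 99, 92, 108, 106, 111, 105, 110, 109, 107]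

/-- The action on the 112 lines of the element of order six of `SU(2)`. -/
def imageW : List ℕ :=
  [3, 5, 2, 9, 11, 14, 15, 18, 20, 0, 23, 26, 29, 31, 34, 37, 28, 40, 43, 46, 22, 36, 8, 52, 54,
    55, 58, 44, 60, 62, 50, 51, 64, 16, 63, 1, 30, 69, 71, 66, 73, 76, 77, 45, 67, 42, 57, 56,
    48, 80, 81, 59, 84, 49, 87, 4, 24, 17, 25, 65, 38, 92, 93, 35, 94, 83, 27, 90, 6, 91, 70,
    33, 96, 19, 98, 47, 100, 7, 102, 97, 41, 104, 88, 13, 74, 12, 106, 75, 107, 99, 39, 68, 101,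
    95, 61, 85, 105, 109, 10, 108, 53, 32, 110, 103, 21, 72, 111, 79, 89, 82, 86, 78]

/-- The permutation of the labels that acts on the roots as `matS` acts on the lines. -/
def labelS : List ℕ :=
  [0, 1, 2, 10, 22, 3, 6, 14, 20, 17, 5, 7, 4, 9, 11, 8, 18, 13, 23, 19, 15, 21, 12, 16]

/-- The permutation of the labels that acts on the roots as `matT` acts on the lines. -/
def labelT : List ℕ :=
  [0, 1, 2, 20, 12, 8, 22, 18, 5, 21, 10, 16, 4, 17, 14, 15, 11, 13, 7, 19, 3, 9, 6, 23]

/-- The columns of four times the isometry that acts on the roots as the element of order six acts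
on the lines. The entries, increased by one, are the digits to the base 512. -/
def colsW : List ℕ :=
  [0x40201008040202008040401008040201010040202008080404,
    0x10040201008040200008040001008040201000040200008000802,
    0x10040201008040200008040001008040201000040200008100002,
    0x8000000010080401000080202010000402008080001010040201,
    0x8000402010080001010080200010080402008000001000040201,
    0x8080402010080401000080202010000000008000401000040201,
    0x8000402010000001010000202010000400008080401010040201,
    0x8080002010000401010080202000080400008000001010040201,
    0x8080002000000001000080202010080402008080401000040201,
    0x10040201008040204008040001008040201000040200008000002,
    0x8000402000080401000080200000080400008080401010040201,
    0x8080402010000401000000200010080002008080001010040201,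
    0x8000002000080401010000202010080002008000401010040201,
    0x20040201008040202008040401008040201010040202008080400,
    0x8080400000080401010000202010080400008080001000040201,
    0x8080400000000401010080200010000402008000401010040201,
    0x8000400010000401010080202000080002008080401000040201,
    0x10040201008040200008040001008040201000040204008000002,
    0x8080002010080401010000200000000402008080401000040201,
    0x10040201008040200008040801008040201000040200008000002,
    0x8080402000080001010080202000000002008080001010040201,
    0x10040201008040200008040001008040201020040200008000002,
    0x8080400010080001000000202000080402008000401010040201,
    0x8080000010080001010080200010080000008080401010040201]

/-- The first basis vector of a line. -/
def lineU (i : Fin 112) : Fin 4 → GF9 := gfVec (lineCodes.getD i 0)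

/-- The second basis vector of a line. -/
def lineV (i : Fin 112) : Fin 4 → GF9 := gfVec (lineCodes.getD i 0 / 9 ^ 4)

/-- The second pivot of the reduced echelon form; the first pivot is always `0`. -/
def linePivot (i : Fin 112) : Fin 4 := if lineCodes.getD i 0 / 9 ^ 5 % 9 = 0 then 2 else 1

/-- A vector lies on a line if and only if it is the combination of the basis vectors with the
coordinates at the pivots as coefficients. -/
def OnLine (i : Fin 112) (x : Fin 4 → GF9) : Prop :=
  ∀ k, x k = x 0 * lineU i k + x (linePivot i) * lineV i k

instance (i : Fin 112) (x : Fin 4 → GF9) : Decidable (OnLine i x) :=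
  inferInstanceAs (Decidable (∀ _, _))

/-- The Leech vectors of the 112 roots in labelled coordinates. The label `1` belongs to the octads of
the first of the two types and not to the octads of the second. -/
def rootZ (i : Fin 112) (k : Fin 24) : ℤ :=
  if (rootCodes.getD i 0).testBit 1 then (if (rootCodes.getD i 0).testBit k then 2 else 0)
  else if k = 0 then 3 else if (rootCodes.getD i 0).testBit k then -1 else 1

/-- The columns of four times the isometries of the Leech lattice that correspond to the three
generators. The entries, increased by one, are the digits to the base 512. -/
def isoCol (a : Fin 3) (j : Fin 24) : ℕ :=
  match a with
  | 0 => 4 * 512 ^ labelS.getD j 0 + (512 ^ 24 - 1) / 511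
  | 1 => 4 * 512 ^ labelT.getD j 0 + (512 ^ 24 - 1) / 511
  | 2 => colsW.getD j 0

/-- Four times the isometries of the Leech lattice that correspond to the three generators. -/
def isoMat (a : Fin 3) : Matrix (Fin 24) (Fin 24) ℤ :=
  fun i j => (isoCol a j / 512 ^ i.val % 512 : ℕ) - 1

/-- The generators of the special unitary group. -/
def suGen : Fin 3 → SU4 := ![suS, suT, suW]

/-- The action of the generators on the 112 lines and roots. -/
def imageGen (a : Fin 3) (i : Fin 112) : Fin 112 :=
  Fin.ofNat 112 ((match a with | 0 => imageS | 1 => imageT | 2 => imageW).getD i 0)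

theorem matS_mulVec (x : Fin 4 → GF9) : matS *ᵥ x = ![x 2, x 0, x 1, x 3] := by
  funext k
  fin_cases k <;> simp [matS, Matrix.mulVec, dotProduct, Fin.sum_univ_four]

theorem matT_mulVec (x : Fin 4 → GF9) : matT *ᵥ x = ![x 3, x 2, x 1, x 0] := by
  funext k
  fin_cases k <;> simp [matT, Matrix.mulVec, dotProduct, Fin.sum_univ_four]

theorem matB23_mulVec_eq (p : GF9 × GF9) (x : Fin 4 → GF9) :
    matB23 p *ᵥ x = ![x 0, (pairAct p (x 1, x 2)).1, (pairAct p (x 1, x 2)).2, x 3] := by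
  rw [← matB23_mulVec]
  congr 1
  funext k
  fin_cases k <;> rfl

theorem suGen_onLine (a : Fin 3) (i : Fin 112) :
    OnLine (imageGen a i) ((suGen a).1 *ᵥ lineU i) ∧
      OnLine (imageGen a i) ((suGen a).1 *ᵥ lineV i) := by
  fin_cases a
  · change OnLine (imageGen 0 i) (matS *ᵥ _) ∧ OnLine (imageGen 0 i) (matS *ᵥ _)
    rw [matS_mulVec, matS_mulVec]
    revert i
    decide +kernel
  · change OnLine (imageGen 1 i) (matT *ᵥ _) ∧ OnLine (imageGen 1 i) (matT *ᵥ _)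
    rw [matT_mulVec, matT_mulVec]
    revert i
    decide +kernel
  · change OnLine (imageGen 2 i) (matB23 pairW *ᵥ _) ∧
      OnLine (imageGen 2 i) (matB23 pairW *ᵥ _)
    rw [matB23_mulVec_eq, matB23_mulVec_eq]
    revert i
    decide +kernel

theorem line_injective {i j : Fin 112} (hU : lineU i = lineU j) (hV : lineV i = lineV j) :
    i = j := by
  have h : ∀ i, lineCodes.idxOf (∑ k, gfCode (lineU i k) * 9 ^ k.val +
      9 ^ 4 * ∑ k, gfCode (lineV i k) * 9 ^ k.val) = i.val := by decide +kernel
  rw [Fin.ext_iff, ← h i, ← h j, hU, hV]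

theorem line_pivots : ∀ i, lineU i 0 = 1 ∧ lineV i 0 = 0 ∧ lineU i (linePivot i) = 0 ∧
    lineV i (linePivot i) = 1 ∧ (linePivot i = 1 ∨ linePivot i = 2 ∧ lineV i 1 = 0) := by
  decide +kernel

/-- The action on the roots is transitive. -/
theorem exists_imageGen_eq (i : Fin 112) (hi : i ≠ 0) : ∃ j < i, ∃ a, imageGen a j = i := by
  revert i; decide +kernel

theorem rootZ_mem : ∀ i, rootZ i ∈ golayLattice := by decide +kernel

theorem rootZ_perp : ∀ i, ∑ k, rootZ i k * rootZ i k = 32 ∧ 4 * rootZ i 0 + ∑ k, rootZ i k = 24 ∧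
    4 * rootZ i 0 + 4 * rootZ i 1 = 16 ∧ ∑ k, rootZ i k - 4 * rootZ i 2 = 16 := by decide +kernel

theorem rootZ_injective : Function.Injective rootZ := by
  have h : ∀ i, rootCodes.idxOf (∑ k : Fin 24,
      if k = 0 ∨ rootZ i k = 2 ∨ rootZ i k = -1 then 2 ^ k.val else 0) = i.val := by decide +kernel
  intro i j hij
  rw [Fin.ext_iff, ← h i, ← h j, hij]

/-! ### Vectors with small coordinates as integers -/

/-- The integer with the coordinates of a vector as digits to the base 512. -/
def pack {n : ℕ} (y : Fin n → ℤ) : ℤ := ∑ k, y k * 512 ^ k.val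

theorem pack_injective {n : ℕ} {y z : Fin n → ℤ} (hy : ∀ k, |y k| < 256) (hz : ∀ k, |z k| < 256)
    (h : pack y = pack z) : y = z := by
  induction n with
  | zero => exact Subsingleton.elim _ _
  | succ n ih =>
    have e : ∀ y : Fin (n + 1) → ℤ, pack y = y 0 + 512 * pack (fun k => y k.succ) := by
      intro y
      simp only [pack, Fin.sum_univ_succ, Fin.val_zero, pow_zero, mul_one, mul_sum, Fin.val_succ]
      exact congrArg _ (sum_congr rfl fun k _ => by ring)
    rw [e, e z] at h
    have h1 := abs_lt.1 (hy 0)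
    have h2 := abs_lt.1 (hz 0)
    have h0 : y 0 = z 0 := by omega
    have hs := ih (fun k => hy k.succ) (fun k => hz k.succ) (by omega)
    funext k
    refine Fin.cases h0 (fun k => congrFun hs k) k

/-- The columns of the matrices as single integers, the offset of the digits in `isoCol` being removed. -/
def packedCol (a : Fin 3) (j : Fin 24) : ℤ := (isoCol a j : ℤ) - ((512 ^ 24 - 1) / 511 : ℕ)

theorem pack_isoMat : ∀ a j, pack (fun i => isoMat a i j) = packedCol a j := by decide +kernel

theorem pack_isoMat_mulVec (a : Fin 3) (x : Fin 24 → ℤ) :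
    pack (isoMat a *ᵥ x) = ∑ j, x j * packedCol a j := by
  simp only [← pack_isoMat, pack, Matrix.mulVec, dotProduct, sum_mul, mul_sum]
  rw [sum_comm]
  exact sum_congr rfl fun j _ => sum_congr rfl fun i _ => by ring

theorem abs_isoMat_le : ∀ a i j, |isoMat a i j| ≤ 4 := by decide +kernel

theorem sum_abs_isoMat_le : ∀ a i, ∑ j, |isoMat a i j| ≤ 24 := by decide +kernel

theorem abs_mulVec_lt {M : Matrix (Fin 24) (Fin 24) ℤ} (hM : ∀ i, ∑ j, |M i j| ≤ 24)
    {x : Fin 24 → ℤ} (hx : ∀ j, |x j| ≤ 8) (i : Fin 24) : |(M *ᵥ x) i| < 256 := by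
  have h1 : |(M *ᵥ x) i| ≤ ∑ j, |M i j * x j| :=
    abs_sum_le_sum_abs (fun j => M i j * x j) univ
  have h2 : ∑ j, |M i j * x j| ≤ ∑ j, |M i j| * 8 := by
    refine sum_le_sum fun j _ => ?_
    rw [abs_mul]
    exact mul_le_mul_of_nonneg_left (hx j) (abs_nonneg (M i j))
  rw [← sum_mul] at h2
  have h3 := hM i
  linarith

theorem isoMat_mulVec_eq {a : Fin 3} {x y : Fin 24 → ℤ} (hx : ∀ j, |x j| ≤ 8) (hy : ∀ j, |y j| < 64)
    (h : ∑ j, x j * packedCol a j = 4 * pack y) : isoMat a *ᵥ x = 4 • y := by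
  refine pack_injective (abs_mulVec_lt (sum_abs_isoMat_le a) hx) (fun k => ?_) ?_
  · have := hy k
    simp only [Pi.smul_apply, nsmul_eq_mul, abs_mul]
    norm_num
    linarith
  · rw [pack_isoMat_mulVec, h]
    simp [pack, mul_sum, mul_assoc]

theorem abs_rootZ_le (i : Fin 112) (k : Fin 24) : |rootZ i k| ≤ 3 := by
  unfold rootZ
  split_ifs <;> norm_num

theorem isoMat_rootZ (a : Fin 3) (i : Fin 112) : isoMat a *ᵥ rootZ i = 4 • rootZ (imageGen a i) := by
  refine isoMat_mulVec_eq (fun j => (abs_rootZ_le i j).trans (by norm_num))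
    (fun j => (abs_rootZ_le _ j).trans_lt (by norm_num)) ?_
  revert a i
  decide +kernel

theorem isoMat_mul_transpose (a : Fin 3) : isoMat a * (isoMat a)ᵀ = 16 := by
  ext i j
  have h : isoMat a *ᵥ isoMat a j = 4 • fun k => if k = j then 4 else 0 := by
    refine isoMat_mulVec_eq (fun k => (abs_isoMat_le a j k).trans (by norm_num)) (fun k => ?_) ?_
    · split_ifs <;> norm_num
    · revert a j
      decide +kernel
  have := congrFun h i
  simp only [Pi.smul_apply, nsmul_eq_mul] at this
  rw [Matrix.ofNat_apply]
  refine this.trans ?_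
  split_ifs <;> norm_num

/-- The product with a generator of the lattice. -/
def pairGen : Unit ⊕ Fin 17 ⊕ Fin 24 ⊕ Unit → (Fin 24 → ℤ) → ℤ
  | Sum.inl _, x => ∑ i, x i - 4 * x 0
  | Sum.inr (Sum.inl k), x => 2 * ∑ i ∈ golayBase k, x i
  | Sum.inr (Sum.inr (Sum.inl j)), x => 4 * x j - 4 * x 0
  | Sum.inr (Sum.inr (Sum.inr _)), x => 8 * x 0

theorem golayGens_dotProduct (b) (x : Fin 24 → ℤ) : golayGens b ⬝ᵥ x = pairGen b x := by
  rcases b with b | b | b | b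
  · have : ∀ i, golayGens (Sum.inl ()) i * x i = x i - if i = 0 then 4 * x i else 0 := by
      intro i
      simp only [golayGens]
      split_ifs <;> ring
    rw [dotProduct, sum_congr rfl fun i _ => this i, sum_sub_distrib, sum_ite_eq']
    simp [pairGen]
  · simp only [golayGens, dotProduct, ite_mul, zero_mul, pairGen]
    rw [← sum_filter, filter_mem_eq_inter, univ_inter, mul_sum]
  · simp [golayGens, dotProduct, pairGen, sub_mul]
  · simp [golayGens, dotProduct, pairGen]

theorem isoMat_dvd (a : Fin 3) (b c) : 32 ∣ golayGens c ⬝ᵥ isoMat a *ᵥ golayGens b := by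
  have e : isoMat a *ᵥ golayGens b = fun i => pairGen b (isoMat a i) := by
    funext i
    rw [← golayGens_dotProduct, dotProduct_comm]
    rfl
  rw [e, golayGens_dotProduct]
  revert a b c
  decide +kernel

theorem isLabelledIsometry_isoMat (a : Fin 3) : IsLabelledIsometry (isoMat a) where
  mul_transpose := isoMat_mul_transpose a
  dvd := isoMat_dvd a
  fix := by
    rintro u (rfl | rfl | rfl)
    all_goals
      refine isoMat_mulVec_eq (fun j => ?_) (fun j => ?_) ?_
      · split_ifs <;> norm_num
      · split_ifs <;> norm_num
      · revert a
        decide +kernel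

/-! ### The action of the special unitary group on the roots -/

theorem onLine_lineU (i : Fin 112) : OnLine i (lineU i) := fun k => by
  obtain ⟨h1, -, h2, -⟩ := line_pivots i
  rw [h1, h2]
  ring

theorem onLine_lineV (i : Fin 112) : OnLine i (lineV i) := fun k => by
  obtain ⟨-, h1, -, h2, -⟩ := line_pivots i
  rw [h1, h2]
  ring

theorem OnLine.add {i : Fin 112} {x y : Fin 4 → GF9} (hx : OnLine i x) (hy : OnLine i y) :
    OnLine i (x + y) := fun k => by
  simp only [Pi.add_apply]
  linear_combination hx k + hy k

theorem OnLine.smul {i : Fin 112} {x : Fin 4 → GF9} (c : GF9) (hx : OnLine i x) :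
    OnLine i (c • x) := fun k => by
  simp only [Pi.smul_apply, smul_eq_mul]
  linear_combination c * hx k

theorem OnLine.eq_add {i : Fin 112} {x : Fin 4 → GF9} (hx : OnLine i x) :
    x = x 0 • lineU i + x (linePivot i) • lineV i := funext hx

theorem OnLine.mulVec {i j : Fin 112} {A : Matrix (Fin 4) (Fin 4) GF9}
    (hU : OnLine j (A *ᵥ lineU i)) (hV : OnLine j (A *ᵥ lineV i)) {x : Fin 4 → GF9}
    (hx : OnLine i x) : OnLine j (A *ᵥ x) := by
  rw [hx.eq_add, Matrix.mulVec_add, Matrix.mulVec_smul, Matrix.mulVec_smul]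
  exact (hU.smul _).add (hV.smul _)

/-- Distinct reduced echelon forms belong to distinct lines. -/
theorem line_eq_of_le {i j : Fin 112} (h : ∀ x, OnLine i x → OnLine j x) : i = j := by
  have hU := h _ (onLine_lineU i)
  have hV := h _ (onLine_lineV i)
  obtain ⟨i1, i2, i3, i4, i5⟩ := line_pivots i
  obtain ⟨j1, j2, j3, j4, j5⟩ := line_pivots j
  have hp : linePivot i = linePivot j := by
    rcases i5 with i5 | ⟨i5, i6⟩ <;> rcases j5 with j5 | ⟨j5, j6⟩
    · rw [i5, j5]
    · have := hV 1
      rw [i2, j6, ← i5, i4] at this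
      simp at this
    · have := hV (linePivot i)
      rw [i4, i2, j5, i6] at this
      simp at this
    · rw [i5, j5]
  refine line_injective (funext fun k => ?_) (funext fun k => ?_)
  · rw [hU k, i1, ← hp, i3]
    ring
  · rw [hV k, i2, ← hp, i4]
    ring

namespace GolayLabelling

variable (φ : GolayLabelling 𝒮)

/-- The Leech roots orthogonal to `R`, in the order of the isotropic lines. -/
def root (i : Fin 112) : LorentzSpace := leechRootOf (φ.vec (rootZ i))

theorem root_mem (h : IsSteinerSystem 𝒮) (i : Fin 112) : φ.root i ∈ leechRootsPerpR 𝒮 := by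
  refine ⟨?_, ?_⟩
  · rw [leechRoots_eq h]
    exact ⟨_, φ.vec_mem h (rootZ_mem i), rfl⟩
  · have hsum : ∀ f : Omega → ℝ, ∑ x, f x = ∑ k, f (φ.toEquiv k) := fun f =>
      (φ.toEquiv.sum_comp f).symm
    obtain ⟨h1, h2, h3, h4⟩ := rootZ_perp i
    refine (perp_leechRootOf_iff _).2 ?_
    rw [dotProduct, hsum, hsum, ← φ.zero, ← φ.one, ← φ.two]
    simp only [φ.vec_apply]
    exact ⟨by exact_mod_cast h1, by exact_mod_cast h2, by exact_mod_cast h3, by exact_mod_cast h4⟩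

theorem root_injective : Function.Injective φ.root := by
  intro i j hij
  refine rootZ_injective (funext fun k => ?_)
  have := congrFun (leechRootOf_injective hij) (φ.toEquiv k)
  rw [φ.vec_apply, φ.vec_apply] at this
  exact_mod_cast this

theorem range_root (h : IsSteinerSystem 𝒮) : Set.range φ.root = leechRootsPerpR 𝒮 := by
  have hc := ncard_leechRootsPerpR h
  refine Set.eq_of_subset_of_ncard_le (Set.range_subset_iff.2 (φ.root_mem h)) ?_
    (Set.finite_of_ncard_ne_zero (by omega))
  rw [hc, ← Set.image_univ, Set.ncard_image_of_injective _ φ.root_injective, Set.ncard_univ]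
  simp

/-- The pairs of an element of `SU(4, 𝔽₃)` and an isometry that induce the same map of the set of
isotropic lines and of the set of roots. -/
def compatible : Submonoid (SU4 × autFixR 𝒮) where
  carrier := {s | ∃ π : Fin 112 → Fin 112, ∀ i, s.2.1 (φ.root i) = φ.root (π i) ∧
    ∀ x, OnLine i x → OnLine (π i) (s.1.1 *ᵥ x)}
  one_mem' := ⟨id, fun i => ⟨rfl, fun x hx => by
    rw [show (1 : SU4 × autFixR 𝒮).1.1 *ᵥ x = x from Matrix.one_mulVec x]
    exact hx⟩⟩
  mul_mem' := by
    rintro s t ⟨π, hπ⟩ ⟨τ, hτ⟩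
    refine ⟨π ∘ τ, fun i => ⟨?_, fun x hx => ?_⟩⟩
    · exact (congrArg s.2.1 (hτ i).1).trans (hπ _).1
    · rw [show (s * t).1 = s.1 * t.1 from rfl, SU4_mul_mulVec]
      exact (hπ _).2 _ ((hτ i).2 x hx)

/-- In a finite group, the compatible pairs form a subgroup. -/
def compatibleSubgroup (h : IsSteinerSystem 𝒮) : Subgroup (SU4 × autFixR 𝒮) where
  __ := φ.compatible
  inv_mem' := by
    intro s hs
    have : Finite (autFixR 𝒮) := (card_autFixR_le_order h).1
    have e : s⁻¹ = s ^ (orderOf s - 1) := by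
      refine inv_eq_of_mul_eq_one_right ?_
      rw [mul_pow_sub_one (orderOf_pos s).ne', pow_orderOf_eq_one]
    rw [e]
    exact pow_mem (S := φ.compatible) hs _

/-- The isometry that belongs to a generator. -/
def isoGen (h : IsSteinerSystem 𝒮) (a : Fin 3) : autFixR 𝒮 :=
  ⟨_, φ.lorentzEquiv_mem h (isLabelledIsometry_isoMat a)⟩

theorem isoGen_root (h : IsSteinerSystem 𝒮) (a : Fin 3) (i : Fin 112) :
    (φ.isoGen h a).1 (φ.root i) = φ.root (imageGen a i) :=
  φ.lorentzEquiv_leechRootOf h (isLabelledIsometry_isoMat a) (isoMat_rootZ a i)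

theorem mem_compatibleSubgroup (h : IsSteinerSystem 𝒮) {A : SU4} {g : autFixR 𝒮}
    (π : Fin 112 → Fin 112) (hg : ∀ i, g.1 (φ.root i) = φ.root (π i))
    (hA : ∀ i x, OnLine i x → OnLine (π i) (A.1 *ᵥ x)) : (A, g) ∈ φ.compatibleSubgroup h :=
  ⟨π, fun i => ⟨hg i, hA i⟩⟩

theorem gen_mem_compatible (h : IsSteinerSystem 𝒮) (a : Fin 3) :
    (suGen a, φ.isoGen h a) ∈ φ.compatibleSubgroup h :=
  φ.mem_compatibleSubgroup h (imageGen a) (φ.isoGen_root h a) fun i _ hx =>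
    OnLine.mulVec (suGen_onLine a i).1 (suGen_onLine a i).2 hx

/-- A scalar matrix fixes each isotropic line, so that only the identity is compatible with it. -/
theorem eq_one_of_compatible_scalar (h : IsSteinerSystem 𝒮) {A : SU4} {g : autFixR 𝒮}
    (hs : (A, g) ∈ φ.compatibleSubgroup h) {c : GF9} (hA : A.1 = c • 1) : g = 1 := by
  obtain ⟨π, hπ⟩ := hs
  have hc : c ≠ 0 := by
    rintro rfl
    have h1 : A.1.det = 1 := (Matrix.mem_specialUnitaryGroup_iff.1 A.2).2
    rw [hA, zero_smul, Matrix.det_zero] at h1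
    exact zero_ne_one h1
  have hid : ∀ i, i = π i := fun i => line_eq_of_le fun x hx => by
    have h1 := ((hπ i).2 x hx).smul c⁻¹
    rwa [hA, Matrix.smul_mulVec, Matrix.one_mulVec, smul_smul, inv_mul_cancel₀ hc, one_smul] at h1
  refine Subtype.ext (eq_one_of_fix_leechRootsPerpR h g.2 fun r hr => ?_)
  rw [← φ.range_root h] at hr
  obtain ⟨i, rfl⟩ := hr
  rw [(hπ i).1, ← hid]

/-- The compatible pairs are the graph of a homomorphism. They project onto `SU(4, 𝔽₃)` because of the
generators, and the isometry in a pair is unique because `1` is compatible with `1` only. -/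
theorem exists_hom (h : IsSteinerSystem 𝒮) :
    ∃ T : SU4 →* autFixR 𝒮, ∀ A, (A, T A) ∈ φ.compatibleSubgroup h := by
  suffices hb : Function.Bijective (Prod.fst ∘ (φ.compatibleSubgroup h).subtype) by
    obtain ⟨T, hT⟩ := Subgroup.exists_eq_graph hb
    exact ⟨T, fun A => by rw [hT]; exact rfl⟩
  refine ⟨?_, ?_⟩
  · rintro ⟨⟨A, g⟩, hs⟩ ⟨⟨A', g'⟩, hs'⟩ (rfl : A = A')
    have h1 := mul_mem (inv_mem hs) hs'
    have h2 : g⁻¹ * g' = 1 := by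
      refine φ.eq_one_of_compatible_scalar h (A := A⁻¹ * A) (c := 1) h1 ?_
      rw [inv_mul_cancel, one_smul]
      rfl
    obtain rfl := inv_mul_eq_one.1 h2
    rfl
  · have htop := eq_top_of_generators_mem
      (H := (φ.compatibleSubgroup h).map (MonoidHom.fst SU4 (autFixR 𝒮)))
      ⟨_, φ.gen_mem_compatible h 0, rfl⟩ ⟨_, φ.gen_mem_compatible h 1, rfl⟩
      ⟨_, φ.gen_mem_compatible h 2, rfl⟩
    intro A
    obtain ⟨s, hs, e⟩ : A ∈ (φ.compatibleSubgroup h).map (MonoidHom.fst SU4 (autFixR 𝒮)) := by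
      rw [htop]; trivial
    exact ⟨⟨s, hs⟩, e⟩

end GolayLabelling

/-! ### Linear maps that fix every isotropic line -/

/-- The partitions of the four coordinates into two pairs. -/
def pairing : Fin 3 → Fin 4 → Fin 4 := ![![0, 1, 2, 3], ![0, 2, 1, 3], ![0, 3, 1, 2]]

/-- Two elements of norm `-1`. -/
def negUnit : Fin 2 → GF9 := ![⟨1, 1⟩, ⟨1, -1⟩]

/-- The lines with two equations, each of which relates the two coordinates of a pair. -/
theorem exists_pairing_line : ∀ m s t, ∃ i,
    (lineU i (pairing m 1) = negUnit s * lineU i (pairing m 0) ∧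
      lineV i (pairing m 1) = negUnit s * lineV i (pairing m 0)) ∧
    (lineU i (pairing m 3) = negUnit t * lineU i (pairing m 2) ∧
      lineV i (pairing m 3) = negUnit t * lineV i (pairing m 2)) ∧
    OnLine i (Pi.single (pairing m 0) 1 + negUnit s • Pi.single (pairing m 1) 1) ∧
    OnLine i (Pi.single (pairing m 2) 1 + negUnit t • Pi.single (pairing m 3) 1) := by
  decide +kernel

theorem OnLine.apply_eq {i : Fin 112} {a b : Fin 4} {y : GF9} (hU : lineU i b = y * lineU i a)
    (hV : lineV i b = y * lineV i a) {x : Fin 4 → GF9} (hx : OnLine i x) : x b = y * x a := by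
  rw [hx a, hx b, hU, hV]
  ring

/-- The equation `a + y b = 0` for two distinct `y`. -/
theorem eq_zero_of_negUnit {a b : GF9} (h : ∀ s, a + negUnit s * b = 0) : a = 0 ∧ b = 0 := by
  have hne : negUnit 0 - negUnit 1 ≠ 0 := by decide
  have hb : b = 0 := by
    refine (mul_eq_zero.1 ?_).resolve_left hne
    linear_combination h 0 - h 1
  have := h 0
  rw [hb, mul_zero, add_zero] at this
  exact ⟨this, hb⟩

/-- A matrix that fixes every isotropic line is a scalar: it fixes the intersections of pairs of
lines, among which are the points spanned by `e_a + y e_b` with `y` of norm `-1`. -/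
theorem scalar_of_fix_lines {A : Matrix (Fin 4) (Fin 4) GF9}
    (hA : ∀ i x, OnLine i x → OnLine i (A *ᵥ x)) : A = A 0 0 • 1 := by
  have hmul : ∀ a b (y : GF9) k, (A *ᵥ (Pi.single a 1 + y • Pi.single b 1)) k =
      A k a + y * A k b := by
    intro a b y k
    simp [Matrix.mulVec_add, Matrix.mulVec_smul]
  have hne : negUnit 0 - negUnit 1 ≠ 0 := by decide
  have hzero : ∀ {u v : GF9}, (∀ t, u = negUnit t * v) → u = 0 ∧ v = 0 := by
    intro u v huv
    have hv : v = 0 := by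
      refine (mul_eq_zero.1 ?_).resolve_left hne
      linear_combination huv 1 - huv 0
    exact ⟨by rw [huv 0, hv, mul_zero], hv⟩
  choose l h1 h2 h3 h4 using exists_pairing_line
  -- `A (e_a + y e_b)` satisfies the equations of the lines through `e_a + y e_b`
  have e1 : ∀ m s, A (pairing m 1) (pairing m 0) + negUnit s * A (pairing m 1) (pairing m 1) =
      negUnit s * (A (pairing m 0) (pairing m 0) + negUnit s * A (pairing m 0) (pairing m 1)) := by
    intro m s
    have := (hA _ _ (h3 m s 0)).apply_eq (h1 m s 0).1 (h1 m s 0).2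
    rwa [hmul, hmul] at this
  have e2 : ∀ m, (A (pairing m 3) (pairing m 0) = 0 ∧ A (pairing m 3) (pairing m 1) = 0) ∧
      A (pairing m 2) (pairing m 0) = 0 ∧ A (pairing m 2) (pairing m 1) = 0 := by
    intro m
    have key : ∀ s, A (pairing m 3) (pairing m 0) + negUnit s * A (pairing m 3) (pairing m 1) = 0 ∧
        A (pairing m 2) (pairing m 0) + negUnit s * A (pairing m 2) (pairing m 1) = 0 := by
      intro s
      refine hzero fun t => ?_
      have := (hA _ _ (h3 m s t)).apply_eq (h2 m s t).1 (h2 m s t).2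
      rwa [hmul, hmul] at this
    exact ⟨eq_zero_of_negUnit fun s => (key s).1, eq_zero_of_negUnit fun s => (key s).2⟩
  have e3 : ∀ m, (A (pairing m 1) (pairing m 2) = 0 ∧ A (pairing m 1) (pairing m 3) = 0) ∧
      A (pairing m 0) (pairing m 2) = 0 ∧ A (pairing m 0) (pairing m 3) = 0 := by
    intro m
    have key : ∀ t, A (pairing m 1) (pairing m 2) + negUnit t * A (pairing m 1) (pairing m 3) = 0 ∧
        A (pairing m 0) (pairing m 2) + negUnit t * A (pairing m 0) (pairing m 3) = 0 := by
      intro t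
      refine hzero fun s => ?_
      have := (hA _ _ (h4 m s t)).apply_eq (h1 m s t).1 (h1 m s t).2
      rwa [hmul, hmul] at this
    exact ⟨eq_zero_of_negUnit fun s => (key s).1, eq_zero_of_negUnit fun s => (key s).2⟩
  have hdiag : ∀ a b, a ≠ b → A a b = 0 := by
    have f2 := e2
    have f3 := e3
    simp only [Fin.forall_fin_succ, Fin.forall_fin_zero, pairing] at f2 f3
    simp at f2 f3
    intro a b hab
    fin_cases a <;> fin_cases b <;> simp at hab ⊢ <;> tauto
  have hy : negUnit 0 ≠ 0 := by decide
  have heq : ∀ m, A (pairing m 1) (pairing m 1) = A 0 0 := by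
    intro m
    have hm : pairing m 0 = 0 ∧ pairing m 1 ≠ 0 := by revert m; decide
    have := e1 m 0
    rw [hm.1, hdiag _ _ hm.2, hdiag _ _ hm.2.symm, mul_zero, add_zero, zero_add] at this
    exact mul_left_cancel₀ hy this
  ext a b : 1
  by_cases hab : a = b
  · subst hab
    rw [Matrix.smul_apply, Matrix.one_apply_eq, smul_eq_mul, mul_one]
    fin_cases a
    exacts [rfl, heq 0, heq 1, heq 2]
  · rw [hdiag a b hab, Matrix.smul_apply, Matrix.one_apply_ne hab, smul_zero]

/-! ### The isomorphism -/

/-- The homomorphism is onto, as its image has order at least `|SU(4, 𝔽₃)| / 4 = 3265920`, the bound for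
the order of the stabilizer of `R`. -/
theorem exists_surjective_hom (h : IsSteinerSystem 𝒮) :
    ∃ T : SU4 →* autFixR 𝒮, Function.Surjective T ∧ T.ker = Subgroup.center SU4 := by
  obtain ⟨φ⟩ := exists_golayLabelling h
  obtain ⟨T, hT⟩ := φ.exists_hom h
  have hker : T.ker = Subgroup.center SU4 := by
    ext A
    refine ⟨fun hA => ?_, fun hA => ?_⟩
    · obtain ⟨π, hπ⟩ := hT A
      rw [MonoidHom.mem_ker] at hA
      have hid : ∀ i, i = π i := fun i => φ.root_injective (by rw [← (hπ i).1, hA]; rfl)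
      refine mem_center_of_scalar (scalar_of_fix_lines fun i x hx => ?_)
      have := (hπ i).2 x hx
      rwa [← hid] at this
    · exact φ.eq_one_of_compatible_scalar h (hT A) (scalar_of_mem_center hA)
  refine ⟨T, ?_, hker⟩
  obtain ⟨hfin, hcard⟩ := card_autFixR_le_order h
  have h1 : Nat.card T.ker * Nat.card T.range = Nat.card SU4 := by
    rw [← Subgroup.index_ker, Subgroup.card_mul_index]
  have h2 := le_card_SU4
  have h3 := card_center_SU4_le
  rw [hker] at h1
  rw [← MonoidHom.range_eq_top]
  refine Subgroup.eq_top_of_le_card _ ?_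
  have h4 : Nat.card (Subgroup.center SU4) * Nat.card T.range ≤ 4 * Nat.card T.range :=
    Nat.mul_le_mul_right _ h3
  omega

theorem nonempty_PSU43_equiv (h : IsSteinerSystem 𝒮) :
    Nonempty (PSU43 ≃* autFixR 𝒮) := by
  obtain ⟨T, hT, hker⟩ := exists_surjective_hom h
  obtain ⟨e⟩ := nonempty_SU4_equiv
  have hk : Subgroup.center (Matrix.specialUnitaryGroup (Fin 4) F9) =
      (T.comp e.symm.toMonoidHom).ker := by
    ext A
    rw [MonoidHom.mem_ker, MonoidHom.comp_apply, ← MonoidHom.mem_ker, hker]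
    exact (MulEquivClass.apply_mem_center_iff e.symm).symm
  exact ⟨(QuotientGroup.quotientMulEquivOfEq hk).trans
    (QuotientGroup.quotientKerEquivOfSurjective _ (hT.comp e.symm.surjective))⟩

/-- The stabilizer of `R` is transitive on the roots. -/
theorem exists_autFixR_apply_eq (h : IsSteinerSystem 𝒮)
    {r r' : LorentzSpace} (hr : r ∈ leechRootsPerpR 𝒮) (hr' : r' ∈ leechRootsPerpR 𝒮) :
    ∃ g : autFixR 𝒮, g.1 r = r' := by
  obtain ⟨φ⟩ := exists_golayLabelling h
  have key : ∀ i, ∃ g : autFixR 𝒮, g.1 (φ.root 0) = φ.root i := by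
    intro i
    induction i using WellFoundedLT.induction with
    | ind i ih =>
      by_cases hi : i = 0
      · exact ⟨1, by rw [hi]; rfl⟩
      · obtain ⟨j, hj, a, rfl⟩ := exists_imageGen_eq i hi
        obtain ⟨g, hg⟩ := ih j hj
        exact ⟨φ.isoGen h a * g, (congrArg (φ.isoGen h a).1 hg).trans (φ.isoGen_root h a j)⟩
  rw [← φ.range_root h] at hr hr'
  obtain ⟨i, rfl⟩ := hr
  obtain ⟨j, rfl⟩ := hr'
  obtain ⟨g, hg⟩ := key i
  obtain ⟨g', hg'⟩ := key j
  refine ⟨g' * g⁻¹, ?_⟩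
  have e : (g⁻¹ : autFixR 𝒮).1 (φ.root i) = φ.root 0 := by
    rw [← hg]
    exact g.1.symm_apply_apply _
  exact (congrArg g'.1 e).trans hg'

end

theorem mainTheorem3 (𝒮 : Set (Finset Omega)) (h𝒮 : IsSteinerSystem 𝒮) :
    -- `R` is a sublattice of `II_{1,25}`; `x, z, p, q` are Leech roots and show `R ≅ A₂ ⊕ A₂`
    ((∀ i, rootBasis i ∈ leechRoots 𝒮) ∧
      latticeR ≤ latticeII 𝒮 ∧
      LinearIndependent ℝ rootBasis ∧
      ∀ i j, lorentzForm (rootBasis i) (rootBasis j) =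
        Matrix.fromBlocks !![-2, 1; 1, -2] 0 0 !![-2, 1; 1, -2] i j) ∧
    -- there are exactly 112 Leech roots orthogonal to `R`
    (leechRootsPerpR 𝒮).ncard = 112 ∧
    -- they correspond to the Leech vectors of norm `-4` of the types (i) and (ii)
    (leechRootsPerpR 𝒮 = leechRootOf '' (vecI '' octadsI 𝒮 ∪ vecII '' octadsII 𝒮) ∧
      (octadsI 𝒮).ncard = 56 ∧ (octadsII 𝒮).ncard = 56 ∧
      (vecI '' octadsI 𝒮).ncard = 56 ∧ (vecII '' octadsII 𝒮).ncard = 56 ∧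
      ∀ l ∈ vecI '' octadsI 𝒮 ∪ vecII '' octadsII 𝒮,
        l ∈ leechLattice 𝒮 ∧ leechForm l l = -4) ∧
    -- the pointwise stabilizer of `R` in `Aut(C)` is `PSU(4, 𝔽₃)`, and it acts transitively on them
    ∃ e : PSU43 ≃* autFixR 𝒮,
      (∀ g : PSU43, ∀ r ∈ leechRootsPerpR 𝒮,
        (e g : LorentzSpace ≃ₗ[ℝ] LorentzSpace) r ∈ leechRootsPerpR 𝒮) ∧
      ∀ r ∈ leechRootsPerpR 𝒮, ∀ r' ∈ leechRootsPerpR 𝒮,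
        ∃ g : PSU43, (e g : LorentzSpace ≃ₗ[ℝ] LorentzSpace) r = r' := by
  refine ⟨⟨rootBasis_mem h𝒮, latticeR_le h𝒮, rootBasis_linearIndependent, rootBasis_gram⟩,
    ncard_leechRootsPerpR h𝒮, ⟨leechRootsPerpR_eq h𝒮, ncard_octadsI h𝒮, ncard_octadsII h𝒮,
      ncard_vecI h𝒮, ncard_vecII h𝒮, perp_vector_mem_and_norm h𝒮⟩, ?_⟩
  obtain ⟨e⟩ := nonempty_PSU43_equiv h𝒮
  refine ⟨e, fun g r hr => autFixR_mem_leechRootsPerpR h𝒮 (e g).2 hr, fun r hr r' hr' => ?_⟩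
  obtain ⟨g, hg⟩ := exists_autFixR_apply_eq h𝒮 hr hr'
  obtain ⟨g, rfl⟩ := e.surjective g
  exact ⟨g, hg⟩
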